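/- Let $K$ be a finite extension of $\mathbb{Q}_p$, let $L\supset K$ be a finite extension, and let $e=e_{L/K}$ be its ramification index. Let $\Delta_K,\Delta_L$ be the Bruhat–Tits trees of $\mathrm{PGL}(2,K)$, $\mathrm{PGL}(2,L)$, with $\Delta_K^0\to\Delta_L^0$, $\{M\}\mapsto\{M\otimes\mathcal O_L\}$. Let $\Gamma\subset \mathrm{PGL}(2,K)\subset\mathrm{PGL}(2,L)$ be a nontrivial Schottky group (finitely generated, every $\gamma\ne1$ hyperbolic), let $\Delta'_\Gamma$ be the smallest subtree (of $\Delta_K$, respectively of $\Delta_L$) containing the axes of the elements of $\Gamma$, let $x_0$ be a vertex of $\Delta'_\Gamma\subset\Delta_K$, and let $n\ge 0$. Orient edges away from $x_0$. For $E\in\{K,L\}$ let $\Delta_{E,n}\subset\Delta_E$ be the full subgraph on the vertices at distance at most $n$ from $\Delta'_\Gamma$, distances being $K$-normalized, i.e. $d_K=d_L/e$ on $\Delta_L$. Let $\bar\Delta_{E,n}$ be obtained by attaching an infinite tail to each sink. Let $\mathcal W(\bar\Delta_{E,n}/\Gamma)$ be the space of doubly infinite walks without backtracking on $\bar\Delta_{E,n}/\Gamma$,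 written as the subshift of admissible doubly infinite sequences of oriented edges of $\Delta_{E,n}/\Gamma$ in which an edge of a tail is written by repeating the terminal edge at the sink, with the subshift topology and the shift $(T\omega)_k=\omega_{k+1}$. For $\ell\ge1$ let $$\mathcal W_{T^\ell}=\mathcal W\times[0,\ell]/\bigl((T^\ell x,0)\sim(x,\ell)\bigr),$$ let $H^1$ denote the group of homotopy classes of continuous maps to the circle, and let $F_j\subset H^1(\mathcal W_T)$ $(j\ge0)$ be the subgroup of the classes $[\exp(2\pi i t f(x))]$, where $f:\mathcal W\to\mathbb Z$ is continuous and depends only on the coordinates $\omega_0,\dots,\omega_j$. Then: 1. Replacing each edge of a walk by the corresponding $e$ consecutive edges over $L$ (an edge of a tail by $e$ edges of the tail) is a well-defined map $J:\mathcal W(\bar\Delta_{K,n}/\Gamma)\to\mathcal W(\bar\Delta_{L,n}/\Gamma)$; it is a topological embedding and $J\circ T=T^{e}\circ J$. 2. There are a continuous map $J_T:\mathcal W(\bar\Delta_{K,n}/\Gamma)_T\to\mathcal W(\bar\Delta_{L,n}/\Gamma)_{T^e}$ with $[x,t]\mapsto[Jx,et]$, and a covering map $\pi_e:\mathcal W(\bar\Delta_{L,n}/\Gamma)_{T^e}\to\mathcal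 W(\bar\Delta_{L,n}/\Gamma)_T$ with $[x,s]\mapsto[T^{\lfloor s\rfloor}x,\,s-\lfloor s\rfloor]$. 3. The induced homomorphism $$(\pi_e\circ J_T)^*:H^1(\mathcal W(\bar\Delta_{L,n}/\Gamma)_T)\to H^1(\mathcal W(\bar\Delta_{K,n}/\Gamma)_T)$$ maps $F_j$ into $F_j$ for every $j\ge0$. -/

import Mathlib

open scoped NNReal Pointwise MatrixGroups

noncomputable section

namespace SchottkyWalk

/-! ### Nonarchimedean fields and their rings of integers -/

/-- The ring of integers `{x | ‖x‖ ≤ 1}` of a nonarchimedean normed field. -/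
abbrev IntRing (K : Type*) [NormedField K] [IsUltrametricDist K] : ValuationSubring K :=
  (NormedField.valuation : Valuation K ℝ≥0).valuationSubring

/-- The maximal ideal of the ring of integers. -/
abbrev maxIdeal (K : Type*) [NormedField K] [IsUltrametricDist K] : Ideal (IntRing K) :=
  IsLocalRing.maximalIdeal (IntRing K)

instance hasExtension (K L : Type*) [NormedField K] [IsUltrametricDist K] [NormedField L]
    [IsUltrametricDist L] [NormedAlgebra K L] :
    (NormedField.valuation : Valuation K ℝ≥0).HasExtension
      (NormedField.valuation : Valuation L ℝ≥0) where
  val_isEquiv_comap := by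
    rw [Valuation.isEquiv_iff_val_le_one]
    intro x
    simp [Valuation.comap_apply, NormedField.valuation_apply]

/-- The ramification index `e_{L/K}`: the exponent with `𝔪_K 𝒪_L = 𝔪_L ^ e`. -/
def ramIndex (K L : Type*) [NormedField K] [IsUltrametricDist K] [NormedField L]
    [IsUltrametricDist L] [NormedAlgebra K L] : ℕ :=
  Ideal.ramificationIdx' (maxIdeal K) (maxIdeal L)

/-! ### Vertices of the Bruhat-Tits tree -/

section Tree

variable (K : Type*) [NormedField K] [IsUltrametricDist K]

/-- The free `𝒪_K`-submodules of rank two of `K ^ 2`, i.e. the lattices. -/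
abbrev LatticeIn : Type _ :=
  {M : Submodule (IntRing K) (Fin 2 → K) // Submodule.IsLattice K M}

variable {K} in
lemma mem_units_smul {c : Kˣ} {M : Submodule (IntRing K) (Fin 2 → K)} {v : Fin 2 → K} :
    v ∈ c • M ↔ ∃ w ∈ M, c • w = v := Set.mem_smul_set

/-- Homothety of lattices. -/
def homothety : Setoid (LatticeIn K) where
  r M N := ∃ c : Kˣ, N.1 = c • M.1
  iseqv :=
    { refl := fun M => ⟨1, (one_smul _ _).symm⟩
      symm := by
        rintro M N ⟨c, h⟩
        exact ⟨c⁻¹, by rw [h, inv_smul_smul]⟩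
      trans := by
        rintro M N P ⟨c, h⟩ ⟨d, h'⟩
        exact ⟨d * c, by rw [h', h, mul_smul]⟩ }

/-- The vertex set `Δ_K⁰`: lattices up to homothety. -/
def Vertex : Type _ := Quotient (homothety K)

variable {K}

/-- The class of a lattice. -/
def Vertex.mk (M : LatticeIn K) : Vertex K := Quotient.mk (homothety K) M

/-- `d(x, y) = m`: there are representatives `N ⊆ M` of `y` and `x` with
`M / N ≃ 𝒪/𝔪^l ⊕ 𝒪/𝔪^k` and `m = |l - k|`. -/
def HasDist (x y : Vertex K) (m : ℕ) : Prop :=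
  ∃ M N : LatticeIn K, Vertex.mk M = x ∧ Vertex.mk N = y ∧ N.1 ≤ M.1 ∧
    ∃ l k : ℕ, Nonempty ((M.1 ⧸ N.1.submoduleOf M.1) ≃ₗ[IntRing K]
      (IntRing K ⧸ maxIdeal K ^ l) × (IntRing K ⧸ maxIdeal K ^ k)) ∧
      m = ((l : ℤ) - (k : ℤ)).natAbs

/-- The distance `d(x, y)` (the value `m` with `HasDist x y m` is unique). -/
def vdist (x y : Vertex K) : ℕ := sInf {m | HasDist x y m}

/-- Adjacency in the Bruhat-Tits tree. -/
def Adj (x y : Vertex K) : Prop := vdist x y = 1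

/-! ### The action of the projective linear group -/

lemma isLattice_map {M : Submodule (IntRing K) (Fin 2 → K)} (hM : Submodule.IsLattice K M)
    (g : GL (Fin 2) K) :
    Submodule.IsLattice K
      (M.map ((Matrix.mulVecLin (g : Matrix (Fin 2) (Fin 2) K)).restrictScalars (IntRing K))) where
  fg := hM.fg.map _
  span_eq_top := by
    have h : ((M.map ((Matrix.mulVecLin (g : Matrix (Fin 2) (Fin 2) K)).restrictScalars
        (IntRing K)) : Submodule (IntRing K) (Fin 2 → K)) : Set (Fin 2 → K)) =
        (Matrix.mulVecLin (g : Matrix (Fin 2) (Fin 2) K)) '' (M : Set (Fin 2 → K)) := by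
      simp
    rw [h, Submodule.span_image, hM.span_eq_top, Submodule.map_top, LinearMap.range_eq_top]
    intro v
    refine ⟨Matrix.mulVec (g⁻¹ : GL (Fin 2) K) v, ?_⟩
    rw [Matrix.mulVecLin_apply, Matrix.mulVec_mulVec, ← Matrix.GeneralLinearGroup.coe_mul,
      mul_inv_cancel, Matrix.GeneralLinearGroup.coe_one, Matrix.one_mulVec]

/-- The lattice `g M`. -/
def glLattice (g : GL (Fin 2) K) (M : LatticeIn K) : LatticeIn K :=
  ⟨M.1.map ((Matrix.mulVecLin (g : Matrix (Fin 2) (Fin 2) K)).restrictScalars (IntRing K)),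
    isLattice_map M.2 g⟩

lemma mem_glLattice {g : GL (Fin 2) K} {M : LatticeIn K} {v : Fin 2 → K} :
    v ∈ (glLattice g M).1 ↔ ∃ w ∈ M.1, Matrix.mulVec (g : Matrix (Fin 2) (Fin 2) K) w = v := by
  simp [glLattice]

/-- `GL(2, K)` acts on the vertices by `g {M} = {g M}`. -/
instance glAction : MulAction (GL (Fin 2) K) (Vertex K) where
  smul g := Quotient.map (sa := homothety K) (sb := homothety K) (glLattice g) (by
    rintro M N ⟨c, h⟩
    refine ⟨c, ?_⟩
    ext v
    rw [mem_units_smul, mem_glLattice]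
    constructor
    · rintro ⟨w, hw, rfl⟩
      rw [h, mem_units_smul] at hw
      obtain ⟨u, hu, rfl⟩ := hw
      exact ⟨_, mem_glLattice.2 ⟨u, hu, rfl⟩, by
        rw [Units.smul_def, Units.smul_def, Matrix.mulVec_smul]⟩
    · rintro ⟨w, hw, rfl⟩
      obtain ⟨u, hu, rfl⟩ := mem_glLattice.1 hw
      refine ⟨c • u, ?_, by rw [Units.smul_def, Units.smul_def, Matrix.mulVec_smul]⟩
      rw [h]
      exact mem_units_smul.2 ⟨u, hu, rfl⟩)
  one_smul x := by
    induction x using Quotient.inductionOn with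
    | _ M =>
      refine congrArg (Quotient.mk (homothety K)) (Subtype.ext ?_)
      ext v
      rw [mem_glLattice]
      simp
  mul_smul g h x := by
    induction x using Quotient.inductionOn with
    | _ M =>
      refine congrArg (Quotient.mk (homothety K)) (Subtype.ext ?_)
      ext v
      simp only [mem_glLattice]
      constructor
      · rintro ⟨w, hw, rfl⟩
        exact ⟨_, ⟨w, hw, rfl⟩, by
          rw [Matrix.mulVec_mulVec, Matrix.GeneralLinearGroup.coe_mul]⟩
      · rintro ⟨_, ⟨w, hw, rfl⟩, rfl⟩
        exact ⟨w, hw, by rw [Matrix.mulVec_mulVec, Matrix.GeneralLinearGroup.coe_mul]⟩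

lemma center_smul (g : GL (Fin 2) K) (hg : g ∈ Subgroup.center (GL (Fin 2) K)) (x : Vertex K) :
    g • x = x := by
  rw [Matrix.GeneralLinearGroup.center_eq_range_scalar] at hg
  obtain ⟨c, rfl⟩ := hg
  induction x using Quotient.inductionOn with
  | _ M =>
    refine Eq.symm (Quotient.sound (s := homothety K) ⟨c, ?_⟩)
    ext v
    rw [mem_glLattice, mem_units_smul]
    simp [Units.smul_def]

end Tree

/-- `PGL(2, K) = GL(2, K) / center`. -/
abbrev PGL (K : Type*) [Field K] : Type _ :=
  GL (Fin 2) K ⧸ Subgroup.center (GL (Fin 2) K)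

/-- The homomorphism `PGL(2, K) → PGL(2, L)`. -/
def pglMap (K L : Type*) [Field K] [Field L] [Algebra K L] : PGL K →* PGL L :=
  QuotientGroup.map _ _ (Matrix.GeneralLinearGroup.map (algebraMap K L))
    (Matrix.GeneralLinearGroup.map_center_le (algebraMap K L))

section Tree

variable {K : Type*} [NormedField K] [IsUltrametricDist K]

/-- `PGL(2, K)` acts on the vertices. -/
instance pglAction : MulAction (PGL K) (Vertex K) :=
  MulAction.compHom (Vertex K)
    (QuotientGroup.lift (Subgroup.center (GL (Fin 2) K))
      (MulAction.toPermHom (GL (Fin 2) K) (Vertex K))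
      (fun g hg => Equiv.ext fun x => center_smul g hg x))

/-- Hyperbolic elements: the eigenvalues lie in `K` and have different absolute values. -/
def IsHyperbolic (γ : PGL K) : Prop :=
  ∃ g : GL (Fin 2) K, (g : PGL K) = γ ∧ ∃ a b : K, ‖a‖ ≠ ‖b‖ ∧
    (g : Matrix (Fin 2) (Fin 2) K).charpoly =
      (Polynomial.X - Polynomial.C a) * (Polynomial.X - Polynomial.C b)

/-- Schottky groups: finitely generated, all nontrivial elements hyperbolic. -/
def IsSchottky (Γ : Subgroup (PGL K)) : Prop :=
  Γ.FG ∧ ∀ γ ∈ Γ, γ ≠ 1 → IsHyperbolic γ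

/-! ### Axes, the tree of a Schottky group and the reduction graphs -/

/-- `a` is the axis of `γ`: a doubly infinite path without backtracking, both ends of which
(half-lines up to shift of the index and finitely many terms) are fixed by `γ`. -/
def IsAxisOf (γ : PGL K) (a : ℤ → Vertex K) : Prop :=
  (∀ k, Adj (a k) (a (k + 1))) ∧ (∀ k, a (k - 1) ≠ a (k + 1)) ∧
    (∃ N m : ℤ, ∀ k, N ≤ k → γ • a k = a (k + m)) ∧
    (∃ N m : ℤ, ∀ k, k ≤ N → γ • a k = a (k + m))

/-- Vertex sets of subtrees: any two members are joined by a walk inside the set. -/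
def IsSubtree (S : Set (Vertex K)) : Prop :=
  ∀ x ∈ S, ∀ y ∈ S, Relation.ReflTransGen (fun u v => u ∈ S ∧ v ∈ S ∧ Adj u v) x y

/-- The vertices of `Δ'_Γ`, the smallest subtree containing the axes of the elements of `Γ`. -/
def axesHull (Γ : Subgroup (PGL K)) : Set (Vertex K) :=
  ⋂₀ {S | IsSubtree S ∧ ∀ γ ∈ Γ, γ ≠ 1 → ∀ a, IsAxisOf γ a → Set.range a ⊆ S}

/-- The vertices of the reduction graph of level `n`: those at normalized distance
`d / e ≤ n` from `Δ'_Γ`. For the base field itself `e = 1`; for an extension field `e` is the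
ramification index over the base field. -/
def redVertices (Γ : Subgroup (PGL K)) (e n : ℕ) : Set (Vertex K) :=
  {v | ∃ u ∈ axesHull Γ, (vdist v u : ℚ) / (e : ℚ) ≤ n}

/-- The sinks of the reduction graph, edges being oriented away from the base vertex `x₀`:
no edge of the graph that leaves `v` points away from `x₀`. -/
def IsSink (Γ : Subgroup (PGL K)) (e n : ℕ) (x₀ v : Vertex K) : Prop :=
  v ∈ redVertices Γ e n ∧
    ∀ b ∈ redVertices Γ e n, Adj v b → vdist x₀ b ≠ vdist x₀ v + 1

/-! ### Walks on the quotient of the completed reduction graph -/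

/-- Vertices modulo `Γ`. -/
abbrev VertexOrbit (Γ : Subgroup (PGL K)) : Type _ := MulAction.orbitRel.Quotient Γ (Vertex K)

/-- Ordered pairs of vertices modulo `Γ`. -/
abbrev PairOrbit (Γ : Subgroup (PGL K)) : Type _ :=
  MulAction.orbitRel.Quotient Γ (Vertex K × Vertex K)

/-- The orbit of a vertex. -/
def vertexOrbit (Γ : Subgroup (PGL K)) (a : Vertex K) : VertexOrbit Γ :=
  Quotient.mk (MulAction.orbitRel Γ (Vertex K)) a

/-- The orbit of a pair. -/
def pairOrbit (Γ : Subgroup (PGL K)) (a b : Vertex K) : PairOrbit Γ :=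
  Quotient.mk (MulAction.orbitRel Γ (Vertex K × Vertex K)) (a, b)

/-- The source of a pair. -/
def PairOrbit.source {Γ : Subgroup (PGL K)} : PairOrbit Γ → VertexOrbit Γ :=
  Quotient.map (sa := MulAction.orbitRel Γ (Vertex K × Vertex K))
    (sb := MulAction.orbitRel Γ (Vertex K)) Prod.fst (by
    rintro _ q ⟨γ, rfl⟩
    exact ⟨γ, rfl⟩)

/-- The range of a pair. -/
def PairOrbit.range {Γ : Subgroup (PGL K)} : PairOrbit Γ → VertexOrbit Γ :=
  Quotient.map (sa := MulAction.orbitRel Γ (Vertex K × Vertex K))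
    (sb := MulAction.orbitRel Γ (Vertex K)) Prod.snd (by
    rintro _ q ⟨γ, rfl⟩
    exact ⟨γ, rfl⟩)

/-- The orientation reversing involution. -/
def PairOrbit.rev {Γ : Subgroup (PGL K)} : PairOrbit Γ → PairOrbit Γ :=
  Quotient.map (sa := MulAction.orbitRel Γ (Vertex K × Vertex K))
    (sb := MulAction.orbitRel Γ (Vertex K × Vertex K)) Prod.swap (by
    rintro _ q ⟨γ, rfl⟩
    exact ⟨γ, rfl⟩)

/-- The alphabet: the oriented edges of the quotient of the reduction graph by `Γ`. -/
def Edge (Γ : Subgroup (PGL K)) (e n : ℕ) : Type _ :=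
  {w : PairOrbit Γ // ∃ a ∈ redVertices Γ e n, ∃ b ∈ redVertices Γ e n,
    Adj a b ∧ w = pairOrbit Γ a b}

/-- The alphabet is discrete. -/
instance (Γ : Subgroup (PGL K)) (e n : ℕ) : TopologicalSpace (Edge Γ e n) := ⊥

instance (Γ : Subgroup (PGL K)) (e n : ℕ) : DiscreteTopology (Edge Γ e n) := ⟨rfl⟩

/-- `w` points into a sink, i.e. into the beginning of an infinite tail. -/
def Edge.EntersTail {Γ : Subgroup (PGL K)} {e n : ℕ} (x₀ : Vertex K) (w : Edge Γ e n) : Prop :=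
  ∃ b, IsSink Γ e n x₀ b ∧ w.1.range = vertexOrbit Γ b

/-- `w` starts from a sink, i.e. comes out of an infinite tail. -/
def Edge.LeavesTail {Γ : Subgroup (PGL K)} {e n : ℕ} (x₀ : Vertex K) (w : Edge Γ e n) : Prop :=
  ∃ b, IsSink Γ e n x₀ b ∧ w.1.source = vertexOrbit Γ b

/-- Admissibility of `w w'`: either `w'` starts where `w` ends and is not the reverse of `w`,
or the letters agree and `w` is a terminal edge; in the second case the repetition
of the letter stands for the next edge of the infinite tail attached to the sink. -/
def Admissible {Γ : Subgroup (PGL K)} {e n : ℕ} (x₀ : Vertex K) (w w' : Edge Γ e n) : Prop :=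
  (w.1.range = w'.1.source ∧ w'.1 ≠ w.1.rev) ∨
    (w = w' ∧ (w.EntersTail x₀ ∨ w.LeavesTail x₀))

/-- The space of doubly infinite walks on the quotient of the completed reduction graph, a
subshift with the topology induced by the product topology. -/
def WalkSpace (Γ : Subgroup (PGL K)) (e n : ℕ) (x₀ : Vertex K) : Type _ :=
  {ω : ℤ → Edge Γ e n // ∀ k, Admissible x₀ (ω k) (ω (k + 1))}

instance (Γ : Subgroup (PGL K)) (e n : ℕ) (x₀ : Vertex K) :
    TopologicalSpace (WalkSpace Γ e n x₀) :=
  inferInstanceAs (TopologicalSpace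
    {ω : ℤ → Edge Γ e n // ∀ k, Admissible x₀ (ω k) (ω (k + 1))})

/-- The shift `(T ω) k = ω (k + 1)`. -/
def shift (Γ : Subgroup (PGL K)) (e n : ℕ) (x₀ : Vertex K) :
    WalkSpace Γ e n x₀ ≃ₜ WalkSpace Γ e n x₀ where
  toFun ω := ⟨fun k => ω.1 (k + 1), fun k => ω.2 (k + 1)⟩
  invFun ω := ⟨fun k => ω.1 (k - 1), fun k => by
    have h := ω.2 (k - 1)
    rwa [show k - 1 + 1 = k + 1 - 1 by ring] at h⟩
  left_inv ω := Subtype.ext (funext fun k => by simp)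
  right_inv ω := Subtype.ext (funext fun k => by simp)
  continuous_toFun := continuous_induced_rng.2 (continuous_pi fun k : ℤ =>
    (continuous_apply (k + 1)).comp continuous_induced_dom)
  continuous_invFun := continuous_induced_rng.2 (continuous_pi fun k : ℤ =>
    (continuous_apply (k - 1)).comp continuous_induced_dom)

end Tree

/-! ### Mapping tori and first cohomology -/

section Topology

/-- The identification `(x, ℓ) ∼ (S x, 0)` on `X × [0, ℓ]`. -/
def torusRel {X : Type*} (S : X → X) (ℓ : ℝ) (a b : X × Set.Icc (0 : ℝ) ℓ) : Prop :=
  (a.2 : ℝ) = ℓ ∧ (b.2 : ℝ) = 0 ∧ b.1 = S a.1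

/-- The mapping torus `X × [0, ℓ] / (S x, 0) ∼ (x, ℓ)`. -/
def MappingTorus {X : Type*} (S : X → X) (ℓ : ℝ) : Type _ := Quot (torusRel S ℓ)

instance {X : Type*} [TopologicalSpace X] (S : X → X) (ℓ : ℝ) :
    TopologicalSpace (MappingTorus S ℓ) :=
  inferInstanceAs (TopologicalSpace (Quot (torusRel S ℓ)))

/-- The class of `(x, t)`. -/
def MappingTorus.mk {X : Type*} (S : X → X) {ℓ : ℝ} (x : X) (t : Set.Icc (0 : ℝ) ℓ) :
    MappingTorus S ℓ := Quot.mk _ (x, t)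

lemma homotopic_mul {X : Type*} [TopologicalSpace X] {f f' g g' : C(X, Circle)}
    (h : f.Homotopic f') (h' : g.Homotopic g') : (f * g).Homotopic (f' * g') :=
  (ContinuousMap.Homotopic.refl
    (⟨fun z : Circle × Circle => z.1 * z.2, continuous_mul⟩ : C(Circle × Circle, Circle))).comp
    (h.prodMk h')

lemma homotopic_inv {X : Type*} [TopologicalSpace X] {f f' : C(X, Circle)}
    (h : f.Homotopic f') : (f⁻¹).Homotopic (f'⁻¹) :=
  (ContinuousMap.Homotopic.refl (⟨fun z : Circle => z⁻¹, continuous_inv⟩ : C(Circle, Circle))).comp h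

/-- The group of nullhomotopic maps to the circle. -/
def nullMaps (X : Type*) [TopologicalSpace X] : Subgroup C(X, Circle) where
  carrier := {f | f.Homotopic 1}
  one_mem' := ContinuousMap.Homotopic.refl _
  mul_mem' h h' := by simpa using homotopic_mul h h'
  inv_mem' h := by simpa using homotopic_inv h

/-- `H¹(X, ℤ)` as the group of homotopy classes of continuous maps to the circle. -/
def H1 (X : Type*) [TopologicalSpace X] : Type _ := Additive (C(X, Circle) ⧸ nullMaps X)

instance (X : Type*) [TopologicalSpace X] : AddCommGroup (H1 X) :=
  inferInstanceAs (AddCommGroup (Additive (C(X, Circle) ⧸ nullMaps X)))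

/-- The homotopy class of a map to the circle. -/
def H1.mk {X : Type*} [TopologicalSpace X] (u : C(X, Circle)) : H1 X :=
  Additive.ofMul (QuotientGroup.mk u)

lemma H1.mk_eq_mk {X : Type*} [TopologicalSpace X] (u v : C(X, Circle)) :
    H1.mk u = H1.mk v ↔ u.Homotopic v := by
  refine (Additive.ofMul.injective.eq_iff.trans QuotientGroup.eq).trans ⟨fun h => ?_, fun h => ?_⟩
  · have h2 := homotopic_mul (ContinuousMap.Homotopic.refl u) (show (u⁻¹ * v).Homotopic 1 from h)
    simpa using h2.symm
  · have h2 := homotopic_mul (ContinuousMap.Homotopic.refl u⁻¹) h.symm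
    show (u⁻¹ * v).Homotopic 1
    simpa using h2

/-- Pullback `H¹(Y) → H¹(X)` along a continuous map `X → Y`: `[u] ↦ [u ∘ f]`. -/
def H1.pullback {X Y : Type*} [TopologicalSpace X] [TopologicalSpace Y] (f : C(X, Y)) :
    H1 Y →+ H1 X :=
  MonoidHom.toAdditive (QuotientGroup.map (nullMaps Y) (nullMaps X)
    { toFun := fun u => u.comp f
      map_one' := rfl
      map_mul' := fun _ _ => rfl }
    (fun _ h => ContinuousMap.Homotopic.comp h (ContinuousMap.Homotopic.refl f)))

lemma H1.pullback_mk {X Y : Type*} [TopologicalSpace X] [TopologicalSpace Y] (f : C(X, Y))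
    (u : C(Y, Circle)) : H1.pullback f (H1.mk u) = H1.mk (u.comp f) := rfl

/-- The map `(x, t) ↦ exp(2 π i t f(x))` from the mapping torus to the circle. -/
def expMap {X : Type*} [TopologicalSpace X] (S : X → X) (f : C(X, ℤ)) :
    C(MappingTorus S 1, Circle) where
  toFun := Quot.lift (fun a => Circle.exp (2 * Real.pi * ((a.2 : ℝ) * (f a.1 : ℝ)))) (by
    rintro a b ⟨h1, h0, -⟩
    simp only [h1, h0, one_mul, zero_mul, mul_zero, Circle.exp_zero]
    rw [show 2 * Real.pi * ((f a.1 : ℤ) : ℝ) = ((f a.1 : ℤ) : ℝ) * (2 * Real.pi) by ring]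
    exact Circle.exp_int_mul_two_pi _)
  continuous_toFun := continuous_quot_lift _ (by fun_prop)

/-- The homomorphism `f ↦ [exp(2 π i t f(x))]`. -/
def expClass {X : Type*} [TopologicalSpace X] (S : X → X) :
    C(X, ℤ) →+ H1 (MappingTorus S 1) :=
  AddMonoidHom.mk' (fun f => H1.mk (expMap S f)) (by
    intro f g
    refine congrArg H1.mk (a₂ := expMap S f * expMap S g) (ContinuousMap.ext fun z => ?_)
    induction z using Quot.inductionOn with
    | _ a =>
      show Circle.exp _ = Circle.exp _ * Circle.exp _
      rw [← Circle.exp_add]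
      congr 1
      simp
      ring)

end Topology

/-! ### The filtration -/

section Filtration

variable {K : Type*} [NormedField K] [IsUltrametricDist K]

/-- The continuous integer valued functions of the coordinates `ω_0, …, ω_j` only. -/
def futureFun (Γ : Subgroup (PGL K)) (e n : ℕ) (x₀ : Vertex K) (j : ℕ) :
    AddSubgroup C(WalkSpace Γ e n x₀, ℤ) where
  carrier := {f | ∀ ω ω' : WalkSpace Γ e n x₀,
    (∀ i : ℕ, i ≤ j → ω.1 (i : ℤ) = ω'.1 (i : ℤ)) → f ω = f ω'}
  zero_mem' := fun _ _ _ => rfl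
  add_mem' hf hg := fun ω ω' h => by simp [hf ω ω' h, hg ω ω' h]
  neg_mem' hf := fun ω ω' h => by simp [hf ω ω' h]

/-- The mapping torus of the shift. -/
abbrev WalkTorus (Γ : Subgroup (PGL K)) (e n : ℕ) (x₀ : Vertex K) : Type _ :=
  MappingTorus (shift Γ e n x₀) 1

/-- The `j`-th step `F_j` of the filtration of `H¹` of the mapping torus: the classes
`[exp(2 π i t f(x))]` of the functions `f` of the coordinates `ω_0, …, ω_j`. -/
def filtration (Γ : Subgroup (PGL K)) (e n : ℕ) (x₀ : Vertex K) (j : ℕ) :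
    AddSubgroup (H1 (WalkTorus Γ e n x₀)) :=
  (futureFun Γ e n x₀ j).map (expClass (shift Γ e n x₀))

end Filtration

/-! ### Extension of the ground field -/

section Extension

variable (K L : Type*) [NormedField K] [IsUltrametricDist K] [NormedField L]
  [IsUltrametricDist L] [NormedAlgebra K L]

/-- The map `K ^ 2 → L ^ 2`. -/
def coordMap : (Fin 2 → K) → (Fin 2 → L) := fun v i => algebraMap K L (v i)

variable {K}

/-- The `𝒪_L`-lattice `M ⊗ 𝒪_L` in `L ^ 2`: the `𝒪_L`-span of the image of `M`. -/
def extLattice (M : LatticeIn K) : LatticeIn L :=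
  ⟨Submodule.span (IntRing L) (coordMap K L '' (M.1 : Set (Fin 2 → K))), by
    let f : (Fin 2 → K) →ₗ[IntRing K] (Fin 2 → L) :=
      { toFun := coordMap K L
        map_add' := fun v w => by ext i; simp [coordMap]
        map_smul' := fun c v => by
          ext i
          show algebraMap K L ((c : K) * v i) = _
          rw [map_mul, ← Algebra.smul_def]
          rfl }
    let F : (Fin 2 → K) →ₗ[K] (Fin 2 → L) :=
      { toFun := coordMap K L
        map_add' := fun v w => by ext i; simp [coordMap]
        map_smul' := fun c v => by
          ext i
          simp [coordMap, Algebra.smul_def] }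
    constructor
    · obtain ⟨s, hs⟩ := M.2.fg
      refine ⟨(s.finite_toSet.image (coordMap K L)).toFinset, ?_⟩
      rw [Set.Finite.coe_toFinset]
      apply le_antisymm
      · rw [← hs]
        exact Submodule.span_mono (Set.image_mono Submodule.subset_span)
      · rw [Submodule.span_le]
        have h1 : (coordMap K L '' (M.1 : Set (Fin 2 → K))) =
            ((M.1.map f : Submodule (IntRing K) (Fin 2 → L)) : Set (Fin 2 → L)) := by
          simp [f]
        rw [h1, ← hs, Submodule.map_span]
        exact Submodule.span_le_restrictScalars (IntRing K) (IntRing L) _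
    · rw [Submodule.span_span_of_tower, eq_top_iff]
      have h1 : ∀ v : Fin 2 → K,
          coordMap K L v ∈ Submodule.span L (coordMap K L '' (M.1 : Set (Fin 2 → K))) := by
        intro v
        have hv : v ∈ Submodule.span K (M.1 : Set (Fin 2 → K)) := by
          rw [M.2.span_eq_top]
          trivial
        have h2 : F v ∈ (Submodule.span K (M.1 : Set (Fin 2 → K))).map F :=
          Submodule.mem_map_of_mem hv
        rw [Submodule.map_span] at h2
        exact Submodule.span_le_restrictScalars K L _ h2
      intro v _
      rw [pi_eq_sum_univ v]
      refine Submodule.sum_mem _ fun i _ => Submodule.smul_mem _ _ ?_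
      convert h1 (Pi.single i 1) using 1
      ext j
      simp [coordMap, Pi.single_apply, eq_comm, apply_ite (algebraMap K L)]⟩

/-- The map `Δ_K⁰ → Δ_L⁰`, `{M} ↦ {M ⊗ 𝒪_L}`. -/
def extVertex : Vertex K → Vertex L :=
  Quotient.map (sa := homothety K) (sb := homothety L) (extLattice L) (by
    rintro M N ⟨c, h⟩
    refine ⟨Units.map (algebraMap K L) c, ?_⟩
    show Submodule.span _ _ = _ • Submodule.span _ _
    refine Eq.trans ?_ (Submodule.smul_span (Units.map (algebraMap K L : K →* L) c)
      (coordMap K L '' (M.1 : Set (Fin 2 → K)))).symm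
    refine congrArg (Submodule.span (IntRing L)) ?_
    rw [h]
    ext v
    simp only [Set.mem_image, Set.mem_smul_set, SetLike.mem_coe]
    constructor
    · rintro ⟨w, hw, rfl⟩
      obtain ⟨u, hu, rfl⟩ := mem_units_smul.1 hw
      exact ⟨_, ⟨u, hu, rfl⟩, by ext i; simp [coordMap, Units.smul_def]⟩
    · rintro ⟨_, ⟨u, hu, rfl⟩, rfl⟩
      exact ⟨_, mem_units_smul.2 ⟨u, hu, rfl⟩, by
        ext i; simp [coordMap, Units.smul_def]⟩)

/-- `Γ` as a subgroup of `PGL(2, L)`. -/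
abbrev extGroup (Γ : Subgroup (PGL K)) : Subgroup (PGL L) := Γ.map (pglMap K L)

/-- The letter at position `k` stands for an edge of a tail: it repeats a terminal edge that
has been traversed before. -/
def OutTail {Γ : Subgroup (PGL K)} {e n : ℕ} {x₀ : Vertex K} (ω : WalkSpace Γ e n x₀) (k : ℤ) :
    Prop :=
  ω.1 (k - 1) = ω.1 k ∧ (ω.1 k).EntersTail x₀

/-- The letter at position `k` stands for an edge of a tail, traversed towards the graph. -/
def InTail {Γ : Subgroup (PGL K)} {e n : ℕ} {x₀ : Vertex K} (ω : WalkSpace Γ e n x₀) (k : ℤ) :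
    Prop :=
  ω.1 (k + 1) = ω.1 k ∧ (ω.1 k).LeavesTail x₀

/-- `η` is obtained from `ω` by replacing each edge by the corresponding `e = e_{L/K}`
consecutive edges of the tree over `L`. If the edge `ω k` is the class of `(a, b)`, these are
the edges of the walk `c 0, …, c e` of length `e` in the tree over `L` which joins the images of
`a` and `b`. An edge of a tail is replaced by `e` edges of the tail, all of which are written as
repetitions of the terminal edge next to the sink. -/
def Subdivides {Γ : Subgroup (PGL K)} {n : ℕ} {x₀ : Vertex K} (ω : WalkSpace Γ 1 n x₀)
    (η : WalkSpace (extGroup L Γ) (ramIndex K L) n (extVertex L x₀)) : Prop :=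
  ∀ k : ℤ, ∃ (a b : Vertex K) (c : ℕ → Vertex L),
    (ω.1 k).1 = pairOrbit Γ a b ∧
    c 0 = extVertex L a ∧ c (ramIndex K L) = extVertex L b ∧
    (∀ i < ramIndex K L, Adj (c i) (c (i + 1))) ∧
    ∀ i < ramIndex K L,
      (OutTail ω k → (η.1 (k * ramIndex K L + i)).1 =
        pairOrbit (extGroup L Γ) (c (ramIndex K L - 1)) (c (ramIndex K L))) ∧
      (InTail ω k → (η.1 (k * ramIndex K L + i)).1 = pairOrbit (extGroup L Γ) (c 0) (c 1)) ∧
      (¬ OutTail ω k → ¬ InTail ω k →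
        (η.1 (k * ramIndex K L + i)).1 = pairOrbit (extGroup L Γ) (c i) (c (i + 1)))

end Extension

end SchottkyWalk

end

open SchottkyWalk

/-!
The proof has three parts: the geometry of the two trees, the combinatorics of the letters of a
walk, and the topology of mapping tori.

*Trees.* For `X = g⁻¹ h` and the maximum norm `|X|` of the entries, the distance `d` of the
vertices `{g 𝒪²}` and `{h 𝒪²}` is given by `|det X| = |X|² |ϖ| ^ d` (`relPos_vdist`). Hence the
map of vertices `{M} ↦ {M ⊗ 𝒪_L}` multiplies distances by `e` (`vdist_extVertex`), because `|ϖ_K|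
= |ϖ_L| ^ e`. Describing vertices by discs, the same formula shows that `vdist` is the distance of
a tree (`treeMetric_vdist`), and statements about trees are reduced to linear arithmetic with the
four point condition. A hyperbolic element translates a line by a nonzero amount, and the line
over `L` is the subdivision of the line over `K`; so `Γ` acts freely on the vertices over `L`, and
by uniqueness of axes the tree of `Γ` over `L` is the subdivision of its tree over `K`
(`IsSchottky.eq_one_of_ext_smul_eq`, `axesHull_ext_subset`). It follows that distances from the
tree of `Γ` are multiplied by `e` as well. As the trees have no end points, the sinks are the
vertices at maximal distance from the tree of `Γ`, and sinks are mapped to sinks (`IsSink.atDist`,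
`AtDist.isSink_ext`).

*Walks.* Each edge `w` has `e` segments `s w 0, …, s w (e - 1)` over `L`, which lie in the
reduction graph over `L`. Freeness of the action and the absence of backtracking over `K` exclude
backtracking over `L`, so `J` is defined by writing segments block by block, the last segment
repeatedly for an outgoing tail and the first one for an incoming tail
(`IsSegmentMap.admissible_subdivLetter`). A segment determines the edge it comes from
(`IsSegmentMap.injective`); therefore `J` has a continuous left inverse into the space of
sequences, and is an embedding.

*Mapping tori.* A mapping torus is the quotient of `X × ℝ` by `(x, s + ℓ) ∼ (S x, s)`
(`torusPoint`), and `π_e` is induced by the identity of `X × ℝ`; this makes it a covering with `e`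
sheets. Lifting angles to the real line shows that the pullback of the class of `f` is the class
of `g = ∑_{i < e} f ∘ T^i ∘ J` (`pullback_expClass`). If `f` depends on `ω_0, …, ω_j`, then `g`
depends on the blocks `0, …, j` of letters only, but the way in which a letter is subdivided
depends on whether it belongs to a tail, hence also on `ω_{-1}`, and on `ω_1` if `j = 0`. A walk
that enters a tail never leaves it again, so this dependence is confined to a single time; it is a
coboundary and does not change the class in `H¹` (`exists_cohomologous_futureFun`,
`expClass_eq_of_cohomologous`).
-/

open scoped NNReal Pointwise MatrixGroups

noncomputable section

namespace SchottkyWalk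

/-! ### Uniformizers -/

section Unif

variable {K : Type*} [NormedField K]

/-- `ϖ` generates the maximal ideal of a nonarchimedean field with nontrivial discrete
absolute value. -/
structure IsUnif (ϖ : K) : Prop where
  pos : 0 < ‖ϖ‖
  lt_one : ‖ϖ‖ < 1
  le : ∀ x : K, ‖x‖ < 1 → ‖x‖ ≤ ‖ϖ‖

/-- In a locally compact field the open unit ball is compact, since it is also closed; so the norm
attains its maximum there. -/
lemma exists_isUnif [IsUltrametricDist K] [ProperSpace K] (h : ∃ y : K, y ≠ 0 ∧ ‖y‖ < 1) :
    ∃ ϖ : K, IsUnif ϖ := by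
  obtain ⟨y, hy0, hy⟩ := h
  have hc : IsCompact (Metric.ball (0 : K) 1) :=
    Metric.isCompact_of_isClosed_isBounded (IsUltrametricDist.isClosed_ball 0 1)
      Metric.isBounded_ball
  obtain ⟨ϖ, hϖ, hmax⟩ := hc.exists_isMaxOn ⟨y, by simpa using hy⟩ continuous_norm.continuousOn
  refine ⟨ϖ, ?_, by simpa using hϖ, fun x hx => hmax (by simpa using hx)⟩
  exact (norm_pos_iff.2 hy0).trans_le (hmax (show y ∈ Metric.ball (0 : K) 1 by simpa using hy))

namespace IsUnif

variable {ϖ : K} (hϖ : IsUnif ϖ)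
include hϖ

lemma ne_zero : ϖ ≠ 0 := norm_pos_iff.1 hϖ.pos

lemma zpow_le {m n : ℤ} : ‖ϖ‖ ^ m ≤ ‖ϖ‖ ^ n ↔ n ≤ m :=
  zpow_le_zpow_iff_right_of_lt_one₀ hϖ.pos hϖ.lt_one

lemma zpow_inj {m n : ℤ} : ‖ϖ‖ ^ m = ‖ϖ‖ ^ n ↔ m = n := by
  rw [le_antisymm_iff, hϖ.zpow_le, hϖ.zpow_le]
  omega

lemma exists_zpow {x : K} (hx : x ≠ 0) : ∃ k : ℤ, ‖x‖ = ‖ϖ‖ ^ k := by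
  obtain ⟨k, h1, h2⟩ := exists_mem_Ioc_zpow (norm_pos_iff.2 hx)
    (show 1 < ‖ϖ‖⁻¹ from (one_lt_inv₀ hϖ.pos).2 hϖ.lt_one)
  refine ⟨-(k + 1), ?_⟩
  rw [inv_zpow'] at h1 h2
  have hp : (0 : ℝ) < ‖ϖ‖ ^ (-(k + 1)) := zpow_pos hϖ.pos _
  by_contra hne
  have hlt : ‖x * ϖ ^ (k + 1)‖ < 1 := by
    rw [norm_mul, norm_zpow, ← lt_div_iff₀ (zpow_pos hϖ.pos _), one_div, ← zpow_neg]
    exact lt_of_le_of_ne h2 hne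
  have := hϖ.le _ hlt
  rw [norm_mul, norm_zpow, ← le_div_iff₀ (zpow_pos hϖ.pos _), div_eq_mul_inv, ← zpow_neg] at this
  refine absurd h1 (not_lt.2 (this.trans (le_of_eq ?_)))
  rw [← zpow_one_add₀ hϖ.pos.ne']
  congr 1
  ring

end IsUnif

variable [IsUltrametricDist K]

lemma mem_intRing {x : K} : x ∈ IntRing K ↔ ‖x‖ ≤ 1 := by
  rw [Valuation.mem_valuationSubring_iff, ← NNReal.coe_le_coe]
  rfl

lemma norm_intRing_le (x : IntRing K) : ‖(x : K)‖ ≤ 1 := mem_intRing.1 x.2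

lemma isUnit_intRing {x : IntRing K} : IsUnit x ↔ ‖(x : K)‖ = 1 := by
  constructor
  · rintro ⟨u, rfl⟩
    have h : ((u : IntRing K) : K) * ((u⁻¹ : (IntRing K)ˣ) : IntRing K) = 1 := by
      exact_mod_cast congrArg (Subtype.val) u.mul_inv
    have h' := congrArg norm h
    rw [norm_mul, norm_one] at h'
    have h1 := norm_intRing_le (u : IntRing K)
    have h2 := norm_intRing_le ((u⁻¹ : (IntRing K)ˣ) : IntRing K)
    nlinarith [norm_nonneg ((u : IntRing K) : K)]
  · intro h
    have h0 : (x : K) ≠ 0 := by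
      rintro h0
      rw [h0, norm_zero] at h
      exact zero_ne_one h
    refine IsUnit.of_mul_eq_one ⟨(x : K)⁻¹, mem_intRing.2 (by rw [norm_inv, h, inv_one])⟩
      (Subtype.ext ?_)
    exact mul_inv_cancel₀ h0

lemma mem_maxIdeal {x : IntRing K} : x ∈ maxIdeal K ↔ ‖(x : K)‖ < 1 := by
  rw [IsLocalRing.mem_maximalIdeal, mem_nonunits_iff, isUnit_intRing]
  exact ⟨fun h => lt_of_le_of_ne (norm_intRing_le x) h, fun h => h.ne⟩

lemma dvd_intRing {x y : IntRing K} : x ∣ y ↔ ‖(y : K)‖ ≤ ‖(x : K)‖ := by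
  constructor
  · rintro ⟨z, rfl⟩
    have := mul_le_mul_of_nonneg_left (norm_intRing_le z) (norm_nonneg (x : K))
    simpa using this
  · intro h
    rcases eq_or_ne (x : K) 0 with hx | hx
    · rw [hx, norm_zero, norm_le_zero_iff] at h
      rw [show y = 0 from Subtype.ext h]
      exact dvd_zero _
    · refine ⟨⟨(y : K) / x, mem_intRing.2 ?_⟩, Subtype.ext ?_⟩
      · rw [norm_div]
        exact div_le_one_of_le₀ h (norm_nonneg _)
      · exact (mul_div_cancel₀ _ hx).symm

/-- A uniformizer as an element of the ring of integers. -/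
def IsUnif.toInt {ϖ : K} (hϖ : IsUnif ϖ) : IntRing K := ⟨ϖ, mem_intRing.2 hϖ.lt_one.le⟩

lemma IsUnif.maxIdeal_pow {ϖ : K} (hϖ : IsUnif ϖ) (l : ℕ) :
    maxIdeal K ^ l = Ideal.span {hϖ.toInt ^ l} := by
  rw [← Ideal.span_singleton_pow]
  congr 1
  ext x
  rw [mem_maxIdeal, Ideal.mem_span_singleton, dvd_intRing]
  exact ⟨hϖ.le _, fun h => h.trans_lt hϖ.lt_one⟩

lemma IsUnif.mem_maxIdeal_pow {ϖ : K} (hϖ : IsUnif ϖ) {l : ℕ} {x : IntRing K} :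
    x ∈ maxIdeal K ^ l ↔ ‖(x : K)‖ ≤ ‖ϖ‖ ^ l := by
  rw [hϖ.maxIdeal_pow, Ideal.mem_span_singleton, dvd_intRing, ← norm_pow]
  rfl

lemma IsUnif.associated_pow {ϖ : K} (hϖ : IsUnif ϖ) {x : IntRing K} (hx : x ≠ 0) :
    ∃ n : ℕ, Associated (hϖ.toInt ^ n) x := by
  obtain ⟨k, hk⟩ := hϖ.exists_zpow (x := (x : K)) (fun h => hx (Subtype.ext h))
  have h0 : 0 ≤ k := by
    have := norm_intRing_le x
    rwa [hk, ← zpow_zero ‖ϖ‖, hϖ.zpow_le] at this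
  obtain ⟨n, rfl⟩ := Int.eq_ofNat_of_zero_le h0
  have h2 : ‖((hϖ.toInt ^ n : IntRing K) : K)‖ = ‖(x : K)‖ := by
    rw [hk]
    simp [IsUnif.toInt]
  exact ⟨n, associated_of_dvd_dvd (dvd_intRing.2 h2.ge) (dvd_intRing.2 h2.le)⟩

lemma IsUnif.isPrincipalIdealRing {ϖ : K} (hϖ : IsUnif ϖ) :
    IsPrincipalIdealRing (IntRing K) := by
  have : IsDiscreteValuationRing (IntRing K) := by
    refine IsDiscreteValuationRing.ofHasUnitMulPowIrreducibleFactorization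
      ⟨hϖ.toInt, ?_, fun {x} hx => hϖ.associated_pow hx⟩
    refine ⟨fun h => hϖ.lt_one.ne (isUnit_intRing.1 h), fun a b hab => ?_⟩
    by_contra! hcon
    have ha := hϖ.le _ (mem_maxIdeal.1 ((IsLocalRing.mem_maximalIdeal a).2 hcon.1))
    have hb := mem_maxIdeal.1 ((IsLocalRing.mem_maximalIdeal b).2 hcon.2)
    have h : ‖ϖ‖ = ‖(a : K)‖ * ‖(b : K)‖ := by
      rw [← norm_mul]
      exact congrArg (fun z : IntRing K => ‖(z : K)‖) hab
    have h3 := mul_lt_mul_of_pos_left hb hϖ.pos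
    have h4 := mul_le_mul_of_nonneg_right ha (norm_nonneg (b : K))
    linarith
  infer_instance

end Unif

/-! ### Ramification index -/

section Ram

variable {K L : Type*} [NormedField K] [IsUltrametricDist K] [NormedField L]
  [IsUltrametricDist L] [NormedAlgebra K L]

/-- The ramification index in terms of absolute values. -/
lemma norm_uniformizer_eq {ϖ : K} {ϖ' : L} (hϖ : IsUnif ϖ) (hϖ' : IsUnif ϖ') :
    0 < ramIndex K L ∧ ‖ϖ‖ = ‖ϖ'‖ ^ ramIndex K L := by
  obtain ⟨k, hk⟩ := hϖ'.exists_zpow (x := algebraMap K L ϖ)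
    (by simpa using hϖ.ne_zero)
  rw [norm_algebraMap'] at hk
  have h0 : 0 < k := by
    by_contra h
    have h1 := hϖ.lt_one
    rw [hk] at h1
    refine absurd h1 (not_lt.2 ?_)
    rw [← zpow_zero ‖ϖ'‖, hϖ'.zpow_le]
    omega
  obtain ⟨e, rfl⟩ := Int.eq_ofNat_of_zero_le h0.le
  have hle : ∀ m : ℕ, Ideal.map (algebraMap (IntRing K) (IntRing L)) (maxIdeal K) ≤
      maxIdeal L ^ m ↔ m ≤ e := by
    intro m
    have h1 := hϖ.maxIdeal_pow 1
    rw [pow_one, pow_one] at h1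
    rw [h1, Ideal.map_span, Set.image_singleton, Ideal.span_singleton_le_iff_mem,
      hϖ'.mem_maxIdeal_pow]
    have h2 : ((algebraMap (IntRing K) (IntRing L) hϖ.toInt : IntRing L) : L) =
      algebraMap K L ϖ := rfl
    rw [h2, norm_algebraMap', hk, ← zpow_natCast ‖ϖ'‖ m, hϖ'.zpow_le]
    omega
  have he : ramIndex K L = e :=
    Ideal.ramificationIdx'_spec ((hle e).2 le_rfl) (fun h => by have := (hle _).1 h; omega)
  rw [he]
  exact ⟨by omega, by simpa using hk⟩

end Ram

/-! ### The maximum norm of a matrix -/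

section MaxNorm

variable {K : Type*} [NormedField K]

/-- The maximum of the absolute values of the entries of a `2 × 2` matrix. -/
def maxNorm (X : Matrix (Fin 2) (Fin 2) K) : ℝ :=
  max (max ‖X 0 0‖ ‖X 0 1‖) (max ‖X 1 0‖ ‖X 1 1‖)

lemma maxNorm_le_iff {X : Matrix (Fin 2) (Fin 2) K} {r : ℝ} :
    maxNorm X ≤ r ↔ ∀ i j, ‖X i j‖ ≤ r := by
  simp [maxNorm, Fin.forall_fin_two, and_assoc]

lemma norm_le_maxNorm (X : Matrix (Fin 2) (Fin 2) K) (i j : Fin 2) : ‖X i j‖ ≤ maxNorm X :=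
  maxNorm_le_iff.1 le_rfl i j

lemma exists_norm_eq_maxNorm (X : Matrix (Fin 2) (Fin 2) K) : ∃ i j, ‖X i j‖ = maxNorm X := by
  unfold maxNorm
  rcases max_choice (max ‖X 0 0‖ ‖X 0 1‖) (max ‖X 1 0‖ ‖X 1 1‖) with h | h <;> rw [h]
  · rcases max_choice ‖X 0 0‖ ‖X 0 1‖ with h | h <;> rw [h]
    exacts [⟨0, 0, rfl⟩, ⟨0, 1, rfl⟩]
  · rcases max_choice ‖X 1 0‖ ‖X 1 1‖ with h | h <;> rw [h]
    exacts [⟨1, 0, rfl⟩, ⟨1, 1, rfl⟩]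

lemma maxNorm_smul (c : K) (X : Matrix (Fin 2) (Fin 2) K) :
    maxNorm (c • X) = ‖c‖ * maxNorm X := by
  simp [maxNorm, mul_max_of_nonneg]

lemma maxNorm_pos (g : GL (Fin 2) K) : 0 < maxNorm (g : Matrix (Fin 2) (Fin 2) K) := by
  by_contra! h
  have h0 : (g : Matrix (Fin 2) (Fin 2) K) = 0 := by
    ext i j
    exact norm_le_zero_iff.1 (maxNorm_le_iff.1 h i j)
  exact g.ne_zero h0

lemma maxNorm_inv (g : GL (Fin 2) K) :
    maxNorm ((g⁻¹ : GL (Fin 2) K) : Matrix (Fin 2) (Fin 2) K) =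
      maxNorm (g : Matrix (Fin 2) (Fin 2) K) / ‖(g : Matrix (Fin 2) (Fin 2) K).det‖ := by
  rw [Matrix.coe_units_inv, Matrix.inv_def, maxNorm_smul, Ring.inverse_eq_inv', norm_inv,
    Matrix.adjugate_fin_two, div_eq_inv_mul]
  congr 1
  simp only [maxNorm, Matrix.of_apply, Matrix.cons_val', Matrix.cons_val_zero, Matrix.cons_val_one,
    norm_neg, Matrix.cons_val_fin_one]
  simp only [max_comm, max_left_comm, max_assoc]

lemma maxNorm_map {L : Type*} [NormedField L] [NormedAlgebra K L]
    (X : Matrix (Fin 2) (Fin 2) K) : maxNorm (X.map (algebraMap K L)) = maxNorm X := by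
  simp [maxNorm]

lemma det_ne_zero (g : GL (Fin 2) K) : (g : Matrix (Fin 2) (Fin 2) K).det ≠ 0 :=
  (Matrix.isUnit_iff_isUnit_det _).1 g.isUnit |>.ne_zero

variable [IsUltrametricDist K]

lemma maxNorm_mul_le (X Y : Matrix (Fin 2) (Fin 2) K) :
    maxNorm (X * Y) ≤ maxNorm X * maxNorm Y := by
  rw [maxNorm_le_iff]
  intro i j
  rw [Matrix.mul_apply, Fin.sum_univ_two]
  have h (k : Fin 2) : ‖X i k * Y k j‖ ≤ maxNorm X * maxNorm Y := by
    rw [norm_mul]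
    exact mul_le_mul (norm_le_maxNorm X i k) (norm_le_maxNorm Y k j) (norm_nonneg _)
      ((norm_nonneg _).trans (norm_le_maxNorm X i k))
  exact (IsUltrametricDist.norm_add_le_max _ _).trans (max_le (h 0) (h 1))

end MaxNorm

/-! ### Lattices as translates of the standard lattice -/

section Lattices

variable {K : Type*} [NormedField K] [IsUltrametricDist K]

/-- The standard lattice `𝒪 ^ 2`. -/
def stdLattice (K : Type*) [NormedField K] [IsUltrametricDist K] : LatticeIn K :=
  ⟨Submodule.span (IntRing K) (Set.range fun i : Fin 2 => (Pi.single i 1 : Fin 2 → K)), by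
    constructor
    · exact Submodule.fg_span (Set.finite_range _)
    · rw [Submodule.span_span_of_tower, eq_top_iff]
      intro v _
      rw [pi_eq_sum_univ v]
      refine Submodule.sum_mem _ fun i _ => Submodule.smul_mem _ _ (Submodule.subset_span ⟨i, ?_⟩)
      ext j
      simp [Pi.single_apply, eq_comm]⟩

lemma mem_stdLattice {v : Fin 2 → K} : v ∈ (stdLattice K).1 ↔ ∀ i, ‖v i‖ ≤ 1 := by
  constructor
  · intro h
    refine Submodule.span_induction ?_ ?_ ?_ ?_ h
    · rintro _ ⟨j, rfl⟩ i
      rcases eq_or_ne i j with rfl | hij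
      · simp
      · simp [hij]
    · simp
    · intro x y _ _ hx hy i
      exact (IsUltrametricDist.norm_add_le_max _ _).trans (max_le (hx i) (hy i))
    · intro a x _ hx i
      show ‖(a : K) * x i‖ ≤ 1
      rw [norm_mul]
      exact mul_le_one₀ (norm_intRing_le a) (norm_nonneg _) (hx i)
  · intro h
    rw [pi_eq_sum_univ v]
    refine Submodule.sum_mem _ fun i _ => ?_
    have h1 : (fun j => if i = j then (1 : K) else 0) = Pi.single i 1 := by
      ext j
      simp [Pi.single_apply, eq_comm]
    rw [h1]
    exact Submodule.smul_mem _ (⟨v i, mem_intRing.2 (h i)⟩ : IntRing K)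
      (Submodule.subset_span ⟨i, rfl⟩)

lemma mem_glLattice_std {g : GL (Fin 2) K} {v : Fin 2 → K} :
    v ∈ (glLattice g (stdLattice K)).1 ↔
      ∀ i, ‖Matrix.mulVec ((g⁻¹ : GL (Fin 2) K) : Matrix (Fin 2) (Fin 2) K) v i‖ ≤ 1 := by
  rw [mem_glLattice, ← mem_stdLattice]
  constructor
  · rintro ⟨w, hw, rfl⟩
    rwa [Matrix.mulVec_mulVec, ← Matrix.GeneralLinearGroup.coe_mul, inv_mul_cancel,
      Matrix.GeneralLinearGroup.coe_one, Matrix.one_mulVec]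
  · intro h
    refine ⟨_, h, ?_⟩
    rw [Matrix.mulVec_mulVec, ← Matrix.GeneralLinearGroup.coe_mul, mul_inv_cancel,
      Matrix.GeneralLinearGroup.coe_one, Matrix.one_mulVec]

/-- A matrix maps `𝒪 ^ 2` into the ball of radius `r` exactly when its entries are bounded
by `r`. -/
lemma forall_mulVec_le_iff {X : Matrix (Fin 2) (Fin 2) K} {r : ℝ} :
    (∀ w ∈ (stdLattice K).1, ∀ i, ‖Matrix.mulVec X w i‖ ≤ r) ↔ maxNorm X ≤ r := by
  rw [maxNorm_le_iff]
  constructor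
  · intro h i j
    have := h (Pi.single j 1) (Submodule.subset_span ⟨j, rfl⟩) i
    simpa using this
  · intro h w hw i
    rw [Matrix.mulVec, dotProduct, Fin.sum_univ_two]
    refine (IsUltrametricDist.norm_add_le_max _ _).trans (max_le ?_ ?_) <;>
    · rw [norm_mul]
      exact (mul_le_of_le_one_right (norm_nonneg _) (mem_stdLattice.1 hw _)).trans (h _ _)

lemma glLattice_le_iff {g h : GL (Fin 2) K} :
    (glLattice h (stdLattice K)).1 ≤ (glLattice g (stdLattice K)).1 ↔
      maxNorm ((g⁻¹ * h : GL (Fin 2) K) : Matrix (Fin 2) (Fin 2) K) ≤ 1 := by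
  rw [← forall_mulVec_le_iff]
  constructor
  · intro H w hw i
    have := mem_glLattice_std.1 (H (mem_glLattice.2 ⟨w, hw, rfl⟩)) i
    rwa [Matrix.mulVec_mulVec, ← Matrix.GeneralLinearGroup.coe_mul] at this
  · intro H v hv
    obtain ⟨w, hw, rfl⟩ := mem_glLattice.1 hv
    rw [mem_glLattice_std, Matrix.mulVec_mulVec, ← Matrix.GeneralLinearGroup.coe_mul]
    exact H w hw

/-- Over a principal ideal ring a lattice has a basis, i.e. is a translate of `𝒪 ^ 2`. -/
lemma exists_glLattice {ϖ : K} (hϖ : IsUnif ϖ) (M : LatticeIn K) :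
    ∃ g : GL (Fin 2) K, M = glLattice g (stdLattice K) := by
  have := hϖ.isPrincipalIdealRing
  have := M.2
  have hfr : Module.finrank (IntRing K) M.1 = 2 := by
    simpa using Submodule.IsLattice.finrank_of_pi K M.1
  let b : Module.Basis (Fin 2) (IntRing K) M.1 := Module.finBasisOfFinrankEq _ _ hfr
  let B : Module.Basis (Fin 2) K (Fin 2 → K) := b.extendOfIsLattice K
  let X : Matrix (Fin 2) (Fin 2) K := (Pi.basisFun K (Fin 2)).toMatrix B
  have hX : IsUnit X := by
    have := (Pi.basisFun K (Fin 2)).invertibleToMatrix B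
    exact isUnit_of_invertible X
  have hcol : ∀ w : Fin 2 → K, Matrix.mulVec X w = ∑ i, w i • ((b i : M.1) : Fin 2 → K) := by
    intro w
    rw [Matrix.mulVec_eq_sum]
    refine Finset.sum_congr rfl fun i _ => ?_
    ext j
    simp [X, B, Module.Basis.toMatrix_apply, Matrix.transpose_apply, mul_comm]
  refine ⟨hX.unit, Subtype.ext ?_⟩
  ext v
  rw [mem_glLattice]
  simp only [IsUnit.unit_spec]
  constructor
  · intro hv
    refine ⟨fun i => (b.repr ⟨v, hv⟩ i : K), mem_stdLattice.2 fun i => norm_intRing_le _, ?_⟩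
    rw [hcol]
    have := congrArg (M.1.subtype) (b.sum_repr ⟨v, hv⟩)
    rw [map_sum] at this
    exact this
  · rintro ⟨w, hw, rfl⟩
    rw [hcol]
    refine Submodule.sum_mem _ fun i _ => ?_
    exact M.1.smul_mem (⟨w i, mem_intRing.2 (mem_stdLattice.1 hw i)⟩ : IntRing K) (b i).2

end Lattices

/-! ### Elementary divisors -/

section ElementaryDivisors

variable {R : Type*} [CommRing R]

/-- Two generators of `(R / I) ^ 2` are independent over `R / I`, because surjective endomorphisms
of a finite module are injective. -/
lemma mem_of_surjective_of_map_eq_zero (I : Ideal R) (F : (Fin 2 → R) →ₗ[R] (R ⧸ I) × (R ⧸ I))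
    (hF : Function.Surjective F) {a : Fin 2 → R} (ha : F a = 0) (i : Fin 2) : a i ∈ I := by
  let T : (R ⧸ I) × (R ⧸ I) →ₗ[R ⧸ I] (R ⧸ I) × (R ⧸ I) :=
    (LinearMap.toSpanSingleton (R ⧸ I) _ (F (Pi.single 0 1))).coprod
      (LinearMap.toSpanSingleton (R ⧸ I) _ (F (Pi.single 1 1)))
  have hT (b : Fin 2 → R) : T (Ideal.Quotient.mk I (b 0), Ideal.Quotient.mk I (b 1)) = F b := by
    have hb : b = b 0 • Pi.single 0 1 + b 1 • Pi.single 1 1 := by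
      ext j
      fin_cases j <;> simp
    conv_rhs => rw [hb, map_add, map_smul, map_smul]
    rfl
  have hinj : Function.Injective T := OrzechProperty.injective_of_surjective_endomorphism T
    fun y => by
      obtain ⟨b, rfl⟩ := hF y
      exact ⟨_, hT b⟩
  have h0 := hinj (((hT a).trans ha).trans (map_zero T).symm)
  rw [Prod.ext_iff] at h0
  fin_cases i
  · exact Ideal.Quotient.eq_zero_iff_mem.1 h0.1
  · exact Ideal.Quotient.eq_zero_iff_mem.1 h0.2

variable {P : Ideal R} {N : Submodule R (Fin 2 → R)} {l k : ℕ}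

/-- The smaller elementary divisor of `N ⊆ R ^ 2` is the largest power of `P` that divides all
elements of `N`. -/
lemma forall_mem_pow_iff (hP : ∀ m n : ℕ, P ^ m ≤ P ^ n → n ≤ m)
    (φ : ((Fin 2 → R) ⧸ N) ≃ₗ[R] (R ⧸ P ^ l) × (R ⧸ P ^ k)) (r : ℕ) :
    (∀ a ∈ N, ∀ i, a i ∈ P ^ r) ↔ r ≤ min l k := by
  constructor
  · intro h
    -- reduction modulo `P ^ r` induces a surjection from the quotient by `N` to `(R / P ^ r) ^ 2`
    let q : (Fin 2 → R) →ₗ[R] (R ⧸ P ^ r) × (R ⧸ P ^ r) :=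
      ((Submodule.mkQ (P ^ r)).comp (LinearMap.proj 0)).prod
        ((Submodule.mkQ (P ^ r)).comp (LinearMap.proj 1))
    have hq : Function.Surjective q := by
      rintro ⟨x, y⟩
      obtain ⟨x, rfl⟩ := Submodule.mkQ_surjective _ x
      obtain ⟨y, rfl⟩ := Submodule.mkQ_surjective _ y
      exact ⟨![x, y], rfl⟩
    let q' : ((Fin 2 → R) ⧸ N) →ₗ[R] (R ⧸ P ^ r) × (R ⧸ P ^ r) := N.liftQ q fun a ha => by
      rw [LinearMap.mem_ker]
      exact Prod.ext (Ideal.Quotient.eq_zero_iff_mem.2 (h a ha 0))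
        (Ideal.Quotient.eq_zero_iff_mem.2 (h a ha 1))
    have hq' : Function.Surjective q' := fun y => by
      obtain ⟨a, rfl⟩ := hq y
      exact ⟨N.mkQ a, rfl⟩
    let p : (Fin 2 → R) →ₗ[R] (R ⧸ P ^ l) × (R ⧸ P ^ k) :=
      ((Submodule.mkQ (P ^ l)).comp (LinearMap.proj 0)).prod
        ((Submodule.mkQ (P ^ k)).comp (LinearMap.proj 1))
    have hp : Function.Surjective p := by
      rintro ⟨x, y⟩
      obtain ⟨x, rfl⟩ := Submodule.mkQ_surjective _ x
      obtain ⟨y, rfl⟩ := Submodule.mkQ_surjective _ y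
      exact ⟨![x, y], rfl⟩
    have key (a : Fin 2 → R) (ha : p a = 0) (i : Fin 2) : a i ∈ P ^ r :=
      mem_of_surjective_of_map_eq_zero (P ^ r) (q'.comp (φ.symm.toLinearMap.comp p))
        (hq'.comp (φ.symm.surjective.comp hp)) (by simp [ha]) i
    refine le_min (hP _ _ fun x hx => ?_) (hP _ _ fun x hx => ?_)
    · exact key ![x, 0] (Prod.ext (Ideal.Quotient.eq_zero_iff_mem.2 hx)
        (Submodule.mkQ (P ^ k)).map_zero) 0
    · exact key ![0, x] (Prod.ext (Submodule.mkQ (P ^ l)).map_zero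
        (Ideal.Quotient.eq_zero_iff_mem.2 hx)) 1
  · intro h a ha
    have h1 : P ^ l ≤ P ^ r := Ideal.pow_le_pow_right (h.trans (min_le_left _ _))
    have h2 : P ^ k ≤ P ^ r := Ideal.pow_le_pow_right (h.trans (min_le_right _ _))
    let f : (R ⧸ P ^ l) × (R ⧸ P ^ k) →ₗ[R] (R ⧸ P ^ r) × (R ⧸ P ^ r) :=
      (Submodule.factor h1).prodMap (Submodule.factor h2)
    refine mem_of_surjective_of_map_eq_zero (P ^ r) (f.comp (φ.toLinearMap.comp N.mkQ)) ?_ ?_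
    · exact (Function.Surjective.prodMap (Submodule.factor_surjective h1)
        (Submodule.factor_surjective h2)).comp (φ.surjective.comp N.mkQ_surjective)
    · have : N.mkQ a = 0 := (Submodule.Quotient.mk_eq_zero N).2 ha
      simp [this]

/-- The larger elementary divisor of `N ⊆ R ^ 2` is the annihilator of the quotient. -/
lemma forall_pow_mem_iff {t : R} (ht : P = Ideal.span {t}) (hP : ∀ m n : ℕ, P ^ m ≤ P ^ n → n ≤ m)
    (φ : ((Fin 2 → R) ⧸ N) ≃ₗ[R] (R ⧸ P ^ l) × (R ⧸ P ^ k)) (s : ℕ) :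
    (∀ a : Fin 2 → R, t ^ s • a ∈ N) ↔ max l k ≤ s := by
  have ht' (m : ℕ) : P ^ m = Ideal.span {t ^ m} := by rw [ht, Ideal.span_singleton_pow]
  have h1 : (∀ a : Fin 2 → R, t ^ s • a ∈ N) ↔
      ∀ z : (R ⧸ P ^ l) × (R ⧸ P ^ k), t ^ s • z = 0 := by
    constructor
    · intro h z
      obtain ⟨a, ha⟩ := (φ.surjective.comp N.mkQ_surjective) z
      have h2 : N.mkQ (t ^ s • a) = 0 := (Submodule.Quotient.mk_eq_zero N).2 (h a)
      rw [← ha, Function.comp_apply, ← map_smul, ← map_smul, h2, map_zero]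
    · intro h a
      have h2 : φ (N.mkQ (t ^ s • a)) = 0 := by rw [map_smul, map_smul]; exact h _
      exact (Submodule.Quotient.mk_eq_zero N).1 (φ.map_eq_zero_iff.1 h2)
  rw [h1]
  constructor
  · intro h
    have h2 := Prod.ext_iff.1 (h (1, 1))
    have h3 : Ideal.Quotient.mk (P ^ l) (t ^ s * 1) = 0 := h2.1
    have h4 : Ideal.Quotient.mk (P ^ k) (t ^ s * 1) = 0 := h2.2
    rw [mul_one, Ideal.Quotient.eq_zero_iff_mem] at h3 h4
    refine max_le (hP _ _ ?_) (hP _ _ ?_) <;> rw [ht' s, Ideal.span_singleton_le_iff_mem]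
    exacts [h3, h4]
  · rintro h ⟨x, y⟩
    obtain ⟨x, rfl⟩ := Ideal.Quotient.mk_surjective x
    obtain ⟨y, rfl⟩ := Ideal.Quotient.mk_surjective y
    have hs : t ^ s ∈ P ^ s := ht' s ▸ Ideal.mem_span_singleton_self _
    refine Prod.ext ?_ ?_
    · exact Ideal.Quotient.eq_zero_iff_mem.2 (Ideal.mul_mem_right x _
        (Ideal.pow_le_pow_right ((le_max_left _ _).trans h) hs))
    · exact Ideal.Quotient.eq_zero_iff_mem.2 (Ideal.mul_mem_right y _
        (Ideal.pow_le_pow_right ((le_max_right _ _).trans h) hs))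

end ElementaryDivisors

/-! ### The distance formula -/

section DistanceFormula

variable {K : Type*} [NormedField K]

/-- The relative position of `g 𝒪 ^ 2` and `h 𝒪 ^ 2` is `m`, in terms of `X = g⁻¹ h`. The relation
is invariant under scaling of `X`, and `m` is the difference of the exponents of the elementary
divisors of `X`, as `|X|` is the larger absolute value of an elementary divisor. -/
def RelPos (ϖ : K) (X : GL (Fin 2) K) (m : ℕ) : Prop :=
  ‖(X : Matrix (Fin 2) (Fin 2) K).det‖ = maxNorm (X : Matrix (Fin 2) (Fin 2) K) ^ 2 * ‖ϖ‖ ^ m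

lemma RelPos.unique {ϖ : K} (hϖ : IsUnif ϖ) {X : GL (Fin 2) K} {m n : ℕ} (hm : RelPos ϖ X m)
    (hn : RelPos ϖ X n) : m = n := by
  have h := mul_left_cancel₀ (pow_pos (maxNorm_pos X) 2).ne' (hm.symm.trans hn)
  rw [← zpow_natCast, ← zpow_natCast, hϖ.zpow_inj] at h
  exact_mod_cast h

/-- The scalar matrices as a homomorphism `Kˣ → GL(2, K)`. -/
abbrev scalarGL : Kˣ →* GL (Fin 2) K := Matrix.GeneralLinearGroup.scalar (Fin 2)

lemma coe_scalarGL_mul (c : Kˣ) (g : GL (Fin 2) K) :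
    ((scalarGL c * g : GL (Fin 2) K) : Matrix (Fin 2) (Fin 2) K) =
      (c : K) • (g : Matrix (Fin 2) (Fin 2) K) := by
  ext i j
  simp [scalarGL]

lemma relPos_scalar_mul {ϖ : K} {c : Kˣ} {X : GL (Fin 2) K} {m : ℕ} :
    RelPos ϖ (scalarGL c * X) m ↔ RelPos ϖ X m := by
  unfold RelPos
  rw [coe_scalarGL_mul, Matrix.det_smul, maxNorm_smul, norm_mul, norm_pow, Fintype.card_fin,
    mul_pow, mul_assoc]
  exact mul_right_inj' (pow_pos (norm_pos_iff.2 c.ne_zero) 2).ne'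

variable [IsUltrametricDist K]

/-- The `𝒪`-linear map `a ↦ g a` from `𝒪 ^ 2` to `g 𝒪 ^ 2`. -/
def coordLinear (g : GL (Fin 2) K) :
    (Fin 2 → IntRing K) →ₗ[IntRing K] (glLattice g (stdLattice K)).1 where
  toFun a := ⟨Matrix.mulVec (g : Matrix (Fin 2) (Fin 2) K) fun i => (a i : K),
    mem_glLattice.2 ⟨_, mem_stdLattice.2 fun i => norm_intRing_le (a i), rfl⟩⟩
  map_add' a b := by
    have h : (fun i => ((a + b) i : K)) = (fun i => (a i : K)) + fun i => (b i : K) := rfl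
    exact Subtype.ext ((congrArg _ h).trans (Matrix.mulVec_add _ _ _))
  map_smul' c a := by
    have h : (fun i => ((c • a) i : K)) = (c : K) • fun i => (a i : K) := rfl
    exact Subtype.ext ((congrArg _ h).trans (Matrix.mulVec_smul _ (c : K) _))

lemma coordLinear_bijective (g : GL (Fin 2) K) : Function.Bijective (coordLinear g) :=
  ⟨fun a b h => by
    have h0 : Matrix.mulVec (g : Matrix (Fin 2) (Fin 2) K) (fun i => (a i : K)) =
      Matrix.mulVec (g : Matrix (Fin 2) (Fin 2) K) fun i => (b i : K) := congrArg Subtype.val h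
    have h1 := Matrix.mulVec_injective_of_isUnit g.isUnit h0
    exact funext fun i => Subtype.ext (congrFun h1 i),
  fun v => by
    obtain ⟨w, hw, h⟩ := mem_glLattice.1 v.2
    exact ⟨fun i => ⟨w i, mem_intRing.2 (mem_stdLattice.1 hw i)⟩, Subtype.ext h⟩⟩

/-- The columns of `g` as a basis of `g 𝒪 ^ 2`. -/
def coordEquiv (g : GL (Fin 2) K) :
    (Fin 2 → IntRing K) ≃ₗ[IntRing K] (glLattice g (stdLattice K)).1 :=
  LinearEquiv.ofBijective (coordLinear g) (coordLinear_bijective g)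

/-- If `g 𝒪 ^ 2 / h 𝒪 ^ 2 ≃ 𝒪 / 𝔪 ^ l ⊕ 𝒪 / 𝔪 ^ k`, then `|X| = |ϖ| ^ min l k` and
`|X⁻¹| = |ϖ| ^ (- max l k)` for `X = g⁻¹ h`; so `|X|` and `|det X| = |X| / |X⁻¹|` determine
`|l - k|`. -/
lemma relPos_of_quotient {ϖ : K} (hϖ : IsUnif ϖ) {g h : GL (Fin 2) K}
    (hle : (glLattice h (stdLattice K)).1 ≤ (glLattice g (stdLattice K)).1) {l k : ℕ}
    (φ : ((glLattice g (stdLattice K)).1 ⧸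
      (glLattice h (stdLattice K)).1.submoduleOf (glLattice g (stdLattice K)).1) ≃ₗ[IntRing K]
      (IntRing K ⧸ maxIdeal K ^ l) × (IntRing K ⧸ maxIdeal K ^ k)) :
    RelPos ϖ (g⁻¹ * h) ((l : ℤ) - (k : ℤ)).natAbs := by
  set X : GL (Fin 2) K := g⁻¹ * h with hX
  let N : Submodule (IntRing K) (Fin 2 → IntRing K) :=
    ((glLattice h (stdLattice K)).1.submoduleOf (glLattice g (stdLattice K)).1).comap
      (coordEquiv g).toLinearMap
  have hN (a : Fin 2 → IntRing K) : a ∈ N ↔ ∀ i, ‖Matrix.mulVec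
      ((X⁻¹ : GL (Fin 2) K) : Matrix (Fin 2) (Fin 2) K) (fun i => (a i : K)) i‖ ≤ 1 := by
    show Matrix.mulVec (g : Matrix (Fin 2) (Fin 2) K) (fun i => (a i : K)) ∈
      (glLattice h (stdLattice K)).1 ↔ _
    rw [mem_glLattice_std, Matrix.mulVec_mulVec, ← Matrix.GeneralLinearGroup.coe_mul, hX, mul_inv_rev,
      inv_inv]
  have hX1 := glLattice_le_iff.1 hle
  rw [← hX] at hX1
  let ψ : ((Fin 2 → IntRing K) ⧸ N) ≃ₗ[IntRing K]
      (IntRing K ⧸ maxIdeal K ^ l) × (IntRing K ⧸ maxIdeal K ^ k) :=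
    (Submodule.Quotient.equiv N _ (coordEquiv g)
      (Submodule.map_comap_eq_of_surjective (coordEquiv g).surjective _)).trans φ
  have hP (m n : ℕ) (hmn : maxIdeal K ^ m ≤ maxIdeal K ^ n) : n ≤ m := by
    rw [hϖ.maxIdeal_pow m, Ideal.span_singleton_le_iff_mem, hϖ.mem_maxIdeal_pow] at hmn
    have : ‖((hϖ.toInt ^ m : IntRing K) : K)‖ = ‖ϖ‖ ^ m := by simp [IsUnif.toInt]
    rwa [this, pow_le_pow_iff_right_of_lt_one₀ hϖ.pos hϖ.lt_one] at hmn
  have hmin (r : ℕ) : maxNorm (X : Matrix (Fin 2) (Fin 2) K) ≤ ‖ϖ‖ ^ r ↔ r ≤ min l k := by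
    rw [← forall_mem_pow_iff hP ψ r, ← forall_mulVec_le_iff]
    constructor
    · intro H a ha i
      rw [hϖ.mem_maxIdeal_pow]
      have := H _ (mem_stdLattice.2 ((hN a).1 ha)) i
      rwa [Matrix.mulVec_mulVec, ← Matrix.GeneralLinearGroup.coe_mul, mul_inv_cancel,
        Matrix.GeneralLinearGroup.coe_one, Matrix.one_mulVec] at this
    · intro H w hw i
      have h1 := forall_mulVec_le_iff.2 hX1 w hw
      have := H (fun i => ⟨Matrix.mulVec (X : Matrix (Fin 2) (Fin 2) K) w i, mem_intRing.2 (h1 i)⟩)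
        ((hN _).2 (by
          rw [Matrix.mulVec_mulVec, ← Matrix.GeneralLinearGroup.coe_mul, inv_mul_cancel,
            Matrix.GeneralLinearGroup.coe_one, Matrix.one_mulVec]
          exact mem_stdLattice.1 hw)) i
      rwa [hϖ.mem_maxIdeal_pow] at this
  have hmax (s : ℕ) : ‖ϖ‖ ^ s * maxNorm ((X⁻¹ : GL (Fin 2) K) : Matrix (Fin 2) (Fin 2) K) ≤ 1 ↔
      max l k ≤ s := by
    have h1 := hϖ.maxIdeal_pow 1
    rw [pow_one, pow_one] at h1
    rw [← forall_pow_mem_iff h1 hP ψ s, ← norm_pow, ← maxNorm_smul, ← forall_mulVec_le_iff]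
    have h2 (a : Fin 2 → IntRing K) : (fun i => (((hϖ.toInt ^ s • a) i : IntRing K) : K)) =
        ϖ ^ s • fun i => (a i : K) := by
      ext i
      simp [IsUnif.toInt]
    constructor
    · intro H a
      rw [hN, h2, Matrix.mulVec_smul, ← Matrix.smul_mulVec]
      exact H _ (mem_stdLattice.2 fun i => norm_intRing_le (a i))
    · intro H w hw
      have := H (fun i => ⟨w i, mem_intRing.2 (mem_stdLattice.1 hw i)⟩)
      rw [hN, h2, Matrix.mulVec_smul, ← Matrix.smul_mulVec] at this
      exact this
  obtain ⟨i, j, hij⟩ := exists_norm_eq_maxNorm (X : Matrix (Fin 2) (Fin 2) K)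
  obtain ⟨u, hu⟩ := hϖ.exists_zpow (x := (X : Matrix (Fin 2) (Fin 2) K) i j) (by
    rw [← norm_pos_iff, hij]; exact maxNorm_pos X)
  rw [hij] at hu
  obtain ⟨d, hd⟩ := hϖ.exists_zpow (det_ne_zero X)
  have hinv : maxNorm ((X⁻¹ : GL (Fin 2) K) : Matrix (Fin 2) (Fin 2) K) = ‖ϖ‖ ^ (u - d) := by
    rw [maxNorm_inv, hu, hd, zpow_sub₀ hϖ.pos.ne']
  have hone : 1 ≤ maxNorm ((X⁻¹ : GL (Fin 2) K) : Matrix (Fin 2) (Fin 2) K) := by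
    have h1 := maxNorm_mul_le (X : Matrix (Fin 2) (Fin 2) K)
      ((X⁻¹ : GL (Fin 2) K) : Matrix (Fin 2) (Fin 2) K)
    rw [← Matrix.GeneralLinearGroup.coe_mul, mul_inv_cancel, Matrix.GeneralLinearGroup.coe_one] at h1
    have h2 : (1 : ℝ) ≤ maxNorm (1 : Matrix (Fin 2) (Fin 2) K) := by
      simpa using norm_le_maxNorm (1 : Matrix (Fin 2) (Fin 2) K) 0 0
    nlinarith [maxNorm_pos X, maxNorm_pos X⁻¹]
  rw [hu, ← zpow_zero ‖ϖ‖, hϖ.zpow_le] at hX1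
  rw [hinv, ← zpow_zero ‖ϖ‖, hϖ.zpow_le] at hone
  have hmin' (r : ℕ) : (r : ℤ) ≤ u ↔ r ≤ min l k := by
    rw [← hmin, hu, ← zpow_natCast, hϖ.zpow_le]
  have hmax' (s : ℕ) : d - u ≤ s ↔ max l k ≤ s := by
    rw [← hmax, hinv, ← zpow_natCast, ← zpow_add₀ hϖ.pos.ne', ← zpow_zero ‖ϖ‖, hϖ.zpow_le]
    omega
  have hu' : u = (min l k : ℕ) := by
    have h1 := (hmin' (min l k)).2 le_rfl
    have h2 := (hmin' u.toNat).1 (by omega)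
    omega
  have hd' : d - u = (max l k : ℕ) := by
    have h1 := (hmax' (max l k)).2 le_rfl
    have h2 := (hmax' (d - u).toNat).1 (by omega)
    omega
  unfold RelPos
  rw [hd, hu, ← zpow_natCast, ← zpow_natCast, ← zpow_mul, ← zpow_add₀ hϖ.pos.ne', hϖ.zpow_inj]
  omega

/-- The class of the standard lattice. -/
def stdVertex (K : Type*) [NormedField K] [IsUltrametricDist K] : Vertex K :=
  Vertex.mk (stdLattice K)

lemma exists_smul_stdVertex {ϖ : K} (hϖ : IsUnif ϖ) (x : Vertex K) :
    ∃ g : GL (Fin 2) K, g • stdVertex K = x := by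
  induction x using Quotient.inductionOn with
  | _ M =>
    obtain ⟨g, rfl⟩ := exists_glLattice hϖ M
    exact ⟨g, rfl⟩

lemma smul_glLattice (c : Kˣ) (g : GL (Fin 2) K) :
    c • (glLattice g (stdLattice K)).1 = (glLattice (scalarGL c * g) (stdLattice K)).1 := by
  ext v
  rw [mem_units_smul, mem_glLattice]
  simp only [mem_glLattice, coe_scalarGL_mul, Matrix.smul_mulVec]
  constructor
  · rintro ⟨_, ⟨w, hw, rfl⟩, rfl⟩
    exact ⟨w, hw, rfl⟩
  · rintro ⟨w, hw, rfl⟩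
    exact ⟨_, ⟨w, hw, rfl⟩, rfl⟩

lemma mk_eq_smul_stdVertex {g : GL (Fin 2) K} {M : LatticeIn K}
    (h : Vertex.mk M = g • stdVertex K) :
    ∃ c : Kˣ, M = glLattice (scalarGL c * g) (stdLattice K) := by
  obtain ⟨c, hc⟩ := Quotient.exact (s := homothety K) h.symm
  exact ⟨c, Subtype.ext (by rw [hc, smul_glLattice])⟩

omit [IsUltrametricDist K] in
lemma scalarGL_comm (c : Kˣ) (g : GL (Fin 2) K) : g * scalarGL c = scalarGL c * g := by
  apply Units.ext
  rw [coe_scalarGL_mul]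
  ext i j
  simp [scalarGL, mul_comm]

omit [IsUltrametricDist K] in
lemma scalar_conj (c d : Kˣ) (g h : GL (Fin 2) K) :
    (scalarGL c * g)⁻¹ * (scalarGL d * h) = scalarGL (c⁻¹ * d) * (g⁻¹ * h) :=  calc
    _ = (g⁻¹ * scalarGL c⁻¹) * (scalarGL d * h) := by rw [mul_inv_rev, map_inv]
    _ = scalarGL c⁻¹ * (g⁻¹ * scalarGL d) * h := by
      rw [scalarGL_comm]
      simp only [mul_assoc]
    _ = scalarGL (c⁻¹ * d) * (g⁻¹ * h) := by
      rw [scalarGL_comm, map_mul]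
      simp only [mul_assoc]

lemma HasDist.relPos {ϖ : K} (hϖ : IsUnif ϖ) {g h : GL (Fin 2) K} {m : ℕ}
    (H : HasDist (g • stdVertex K) (h • stdVertex K) m) : RelPos ϖ (g⁻¹ * h) m := by
  obtain ⟨M, N, hM, hN, hle, l, k, ⟨φ⟩, rfl⟩ := H
  obtain ⟨c, rfl⟩ := mk_eq_smul_stdVertex hM
  obtain ⟨d, rfl⟩ := mk_eq_smul_stdVertex hN
  have := relPos_of_quotient hϖ hle φ
  rwa [scalar_conj, relPos_scalar_mul] at this

/-- Existence of elementary divisors. -/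
lemma exists_hasDist {ϖ : K} (hϖ : IsUnif ϖ) (x y : Vertex K) : ∃ m, HasDist x y m := by
  obtain ⟨g, rfl⟩ := exists_smul_stdVertex hϖ x
  obtain ⟨h, rfl⟩ := exists_smul_stdVertex hϖ y
  obtain ⟨i, j, hij⟩ := exists_norm_eq_maxNorm ((g⁻¹ * h : GL (Fin 2) K) : Matrix (Fin 2) (Fin 2) K)
  have h0 : ((g⁻¹ * h : GL (Fin 2) K) : Matrix (Fin 2) (Fin 2) K) i j ≠ 0 := by
    rw [← norm_pos_iff, hij]; exact maxNorm_pos _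
  let c : Kˣ := (Units.mk0 _ h0)⁻¹
  have hle : (glLattice (scalarGL c * h) (stdLattice K)).1 ≤ (glLattice g (stdLattice K)).1 := by
    rw [glLattice_le_iff, show g⁻¹ * (scalarGL c * h) = scalarGL c * (g⁻¹ * h) by
      rw [← mul_assoc, scalarGL_comm, mul_assoc], coe_scalarGL_mul, maxNorm_smul, ← hij, ← norm_mul]
    simp only [c, Units.val_inv_eq_inv_val, Units.val_mk0]
    rw [inv_mul_cancel₀ h0, norm_one]
  set M := glLattice g (stdLattice K) with hM
  set N := glLattice (scalarGL c * h) (stdLattice K) with hN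
  have := hϖ.isPrincipalIdealRing
  have := M.2
  have := N.2
  have hfrM : Module.finrank (IntRing K) M.1 = 2 := by
    simpa using Submodule.IsLattice.finrank_of_pi K M.1
  have hfrN : Module.finrank (IntRing K) N.1 = 2 := by
    simpa using Submodule.IsLattice.finrank_of_pi K N.1
  have hfr : Module.finrank (IntRing K) (N.1.submoduleOf M.1) =
      Module.finrank (IntRing K) M.1 :=
    ((Submodule.submoduleOfEquivOfLe hle).finrank_eq.trans hfrN).trans hfrM.symm
  let b : Module.Basis (Fin 2) (IntRing K) M.1 := Module.finBasisOfFinrankEq _ _ hfrM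
  let E := (N.1.submoduleOf M.1).quotientEquivPiSpan b hfr
  have hcoef (i : Fin 2) : ∃ n : ℕ, Ideal.span
      {Submodule.smithNormalFormCoeffs b hfr i} = maxIdeal K ^ n := by
    obtain ⟨n, hn⟩ := hϖ.associated_pow (Submodule.smithNormalFormCoeffs_ne_zero b hfr i)
    exact ⟨n, by rw [hϖ.maxIdeal_pow, Ideal.span_singleton_eq_span_singleton.2 hn.symm]⟩
  obtain ⟨l, hl⟩ := hcoef 0
  obtain ⟨k, hk⟩ := hcoef 1
  refine ⟨_, M, N, rfl, ?_, hle, l, k, ⟨?_⟩, rfl⟩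
  · refine Eq.symm (Quotient.sound (s := homothety K) ⟨c, ?_⟩)
    rw [smul_glLattice]
  · let E' := LinearEquiv.piFinTwo (IntRing K)
      fun i => IntRing K ⧸ Ideal.span {Submodule.smithNormalFormCoeffs b hfr i}
    exact (E.trans E').trans
      ((Submodule.quotEquivOfEq _ _ hl).prodCongr (Submodule.quotEquivOfEq _ _ hk))

/-- The distance formula: `|det X| = |X|² |ϖ|^d` for the distance `d` of `g 𝒪²` and `h 𝒪²`,
`X = g⁻¹ h` and the maximum norm `|X|`. -/
lemma relPos_vdist {ϖ : K} (hϖ : IsUnif ϖ) (g h : GL (Fin 2) K) :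
    RelPos ϖ (g⁻¹ * h) (vdist (g • stdVertex K) (h • stdVertex K)) :=
  HasDist.relPos hϖ (Nat.sInf_mem (exists_hasDist hϖ _ _))

lemma vdist_eq_iff {ϖ : K} (hϖ : IsUnif ϖ) {g h : GL (Fin 2) K} {m : ℕ} :
    vdist (g • stdVertex K) (h • stdVertex K) = m ↔ RelPos ϖ (g⁻¹ * h) m :=
  ⟨fun H => H ▸ relPos_vdist hϖ g h, fun H => (relPos_vdist hϖ g h).unique hϖ H⟩

end DistanceFormula

/-! ### Trees as integral metric spaces -/

/-- The vertex set of a tree without end points, described by its distance function: an integral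
metric with even perimeters of triangles, which satisfies the four point condition and in
which any two points are joined by a path. All statements about trees below follow from these
properties by linear arithmetic. -/
structure TreeMetric {V : Type*} (d : V → V → ℕ) : Prop where
  eq_of_zero : ∀ {x y}, d x y = 0 → x = y
  self : ∀ x, d x x = 0
  symm : ∀ x y, d x y = d y x
  parity : ∀ x y z, ∃ k, d x y + d y z + d x z = 2 * k
  fourPt : ∀ x y z w, d x y + d z w ≤ d x z + d y w ∨ d x y + d z w ≤ d x w + d y z
  step : ∀ {x y}, d x y ≠ 0 → ∃ z, d x z = 1 ∧ d z y + 1 = d x y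
  two : ∀ x, ∃ y z, d x y = 1 ∧ d x z = 1 ∧ d y z = 2

namespace TreeMetric

variable {V : Type*} {d : V → V → ℕ} (T : TreeMetric d)

/-- Geodesic convexity. -/
def Convex (d : V → V → ℕ) (S : Set V) : Prop :=
  ∀ x ∈ S, ∀ y ∈ S, ∀ z, d x z + d z y = d x y → z ∈ S

/-- `u` is the point of `S` nearest to `v`: all paths from `v` to `S` pass through `u`. -/
def IsProj (d : V → V → ℕ) (S : Set V) (v u : V) : Prop :=
  u ∈ S ∧ ∀ w ∈ S, d v w = d v u + d u w

include T

lemma tri (x y z : V) : d x z ≤ d x y + d y z := by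
  have := T.fourPt x z y y
  have := T.self y
  have := T.symm y z
  omega

lemma ne_of_pos {x y : V} (h : d x y ≠ 0) : x ≠ y := by
  rintro rfl
  exact h (T.self x)

lemma between_unique {x y z z' : V} (h : d x z + d z y = d x y) (h' : d x z' + d z' y = d x y)
    (he : d x z = d x z') : z = z' := by
  apply T.eq_of_zero
  have := T.fourPt z z' x y
  have := T.symm z x
  have := T.symm z' x
  omega

lemma exists_between {x y : V} : ∀ {k : ℕ}, k ≤ d x y →
    ∃ z, d x z = k ∧ d z y + k = d x y := by
  intro k
  induction k with
  | zero => exact fun _ => ⟨x, T.self x, rfl⟩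
  | succ k ih =>
    intro hk
    obtain ⟨z, h1, h2⟩ := ih (by omega)
    obtain ⟨w, h3, h4⟩ := T.step (x := z) (y := y) (by omega)
    refine ⟨w, ?_, by omega⟩
    have := T.tri x z w
    have := T.tri x w y
    omega

lemma exists_path (x y : V) : ∃ c : ℕ → V, c 0 = x ∧ c (d x y) = y ∧
    ∀ i < d x y, d (c i) (c (i + 1)) = 1 := by
  choose c hc using fun i : ℕ => T.exists_between (x := x) (y := y) (k := min i (d x y))
    (min_le_right _ _)
  refine ⟨c, ?_, ?_, fun i hi => ?_⟩
  · have := (hc 0).1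
    exact (T.eq_of_zero (by omega)).symm
  · have := (hc (d x y)).2
    exact T.eq_of_zero (by omega)
  · have h1 := hc i
    have h2 := hc (i + 1)
    have := T.fourPt (c i) (c (i + 1)) x y
    have := T.tri x (c i) (c (i + 1))
    have := T.symm (c i) x
    have := T.symm (c (i + 1)) x
    omega

lemma walk_le {c : ℕ → V} {e : ℕ} (hc : ∀ i < e, d (c i) (c (i + 1)) = 1) (i : ℕ) :
    ∀ k, i + k ≤ e → d (c i) (c (i + k)) ≤ k := by
  intro k
  induction k with
  | zero => intro _; exact (T.self _).le
  | succ k ih =>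
    intro h
    have h1 := ih (by omega)
    have h2 := hc (i + k) (by omega)
    have h3 := T.tri (c i) (c (i + k)) (c (i + (k + 1)))
    rw [add_assoc] at h2
    omega

/-- A path whose length is the distance of its end points is a geodesic. -/
lemma walk_dist {c : ℕ → V} {e : ℕ} (hc : ∀ i < e, d (c i) (c (i + 1)) = 1)
    (he : d (c 0) (c e) = e) {i j : ℕ} (hij : i ≤ j) (hj : j ≤ e) : d (c i) (c j) = j - i := by
  have h1 := T.walk_le hc 0 i (by omega)
  have h2 := T.walk_le hc i (j - i) (by omega)
  have h3 := T.walk_le hc j (e - j) (by omega)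
  rw [zero_add] at h1
  rw [show i + (j - i) = j by omega] at h2
  rw [show j + (e - j) = e by omega] at h3
  have := T.tri (c 0) (c i) (c e)
  have := T.tri (c i) (c j) (c e)
  omega

lemma walk_unique {c c' : ℕ → V} {e : ℕ} (hc : ∀ i < e, d (c i) (c (i + 1)) = 1)
    (hc' : ∀ i < e, d (c' i) (c' (i + 1)) = 1) (he : d (c 0) (c e) = e) (h0 : c 0 = c' 0)
    (h1 : c e = c' e) {i : ℕ} (hi : i ≤ e) : c i = c' i := by
  have he' : d (c' 0) (c' e) = e := by rw [← h0, ← h1, he]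
  have h2 := T.walk_dist hc he (Nat.zero_le i) hi
  have h3 := T.walk_dist hc he hi le_rfl
  have h4 := T.walk_dist hc' he' (Nat.zero_le i) hi
  have h5 := T.walk_dist hc' he' hi le_rfl
  rw [← h0] at h4 he'
  rw [← h1] at h5 he'
  exact T.between_unique (x := c 0) (y := c e) (by omega) (by omega) (by omega)

/-- A walk cannot pass from one side of a vertex to the other one without visiting it. -/
lemma convex_iff (S : Set V) : Convex d S ↔
    ∀ x ∈ S, ∀ y ∈ S, Relation.ReflTransGen (fun u v => u ∈ S ∧ v ∈ S ∧ d u v = 1) x y := by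
  constructor
  · intro hS x hx y hy
    obtain ⟨n, hn⟩ : ∃ n, d x y = n := ⟨_, rfl⟩
    induction n generalizing x with
    | zero => rw [T.eq_of_zero hn]
    | succ n ih =>
      obtain ⟨z, h1, h2⟩ := T.step (x := x) (y := y) (by omega)
      have hz : z ∈ S := hS x hx y hy z (by omega)
      exact .head ⟨hx, hz, h1⟩ (ih z hz (by omega))
  · intro H x hx y hy z hz
    by_contra hzS
    have hxz : d x z ≠ 0 := fun h => hzS (T.eq_of_zero h ▸ hx)
    have key : ∀ w, Relation.ReflTransGen (fun u v => u ∈ S ∧ v ∈ S ∧ d u v = 1) x w →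
        d x w < d x z + d z w := by
      intro w hw
      induction hw with
      | refl => have := T.symm x z; have := T.self x; omega
      | @tail v w _ h ih =>
        have h1 : d v z ≠ 0 := fun h' => hzS (T.eq_of_zero h' ▸ h.1)
        have h2 : d w z ≠ 0 := fun h' => hzS (T.eq_of_zero h' ▸ h.2.1)
        have := h.2.2
        have := T.fourPt x w z v
        have := T.symm v z
        have := T.symm w z
        have := T.symm w v
        have := T.parity x z v
        have := T.parity x z w
        have := T.tri x z w
        omega
    have := key y (H x hx y hy)
    omega

lemma exists_proj {S : Set V} (hS : Convex d S) (hne : S.Nonempty) (v : V) :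
    ∃ u, IsProj d S v u := by
  obtain ⟨u, hu, hmin⟩ := exists_minimal_of_wellFoundedLT (fun n => ∃ u ∈ S, d v u = n)
    (hne.elim fun u hu => ⟨_, u, hu, rfl⟩)
  obtain ⟨u, huS, rfl⟩ := hu
  have hmin' : ∀ w ∈ S, d v u ≤ d v w := fun w hw => by
    by_contra h
    have := hmin (y := d v w) ⟨w, hw, rfl⟩ (by omega)
    omega
  refine ⟨u, huS, fun w hw => ?_⟩
  rcases eq_or_ne (d u w) 0 with h0 | h0
  · rw [← T.eq_of_zero h0, T.self, add_zero]
  · obtain ⟨z, h1, h2⟩ := T.step h0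
    have hz := hmin' z (hS u huS w hw z (by omega))
    have := T.parity v u z
    have := T.fourPt v z u w
    have := T.tri v u w
    have := T.symm z u
    have := T.symm z w
    omega

/-- Neighbours at the same distance from a convex set belong to it. -/
lemma proj_eq_zero {S : Set V} {v v' u u' : V} (hu : IsProj d S v u) (hu' : IsProj d S v' u')
    (hv : d v v' = 1) (h : d v u = d v' u') : d v u = 0 := by
  have h1 := hu.2 u' hu'.1
  have h2 := hu'.2 u hu.1
  have := T.fourPt v u' v' u
  have := T.symm u u'
  have := T.symm v v'
  have := T.symm v' u'
  have := T.symm u' v'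
  have := T.parity v v' u
  have := T.tri v v' u'
  omega

/-- The union of the geodesics between points of a set is convex. -/
lemma convex_segments (S : Set V) :
    Convex d {w | ∃ u ∈ S, ∃ v ∈ S, d u w + d w v = d u v} := by
  have key : ∀ u v w x z : V, d u w + d w v = d u v → d w z + d z x = d w x →
      d u z + d z x = d u x ∨ d v z + d z x = d v x := by
    intro u v w x z h1 h2
    have := T.fourPt w x u z
    have := T.fourPt w x v z
    have := T.fourPt u v x z
    have := T.tri u z x
    have := T.tri v z x
    have := T.symm w u
    have := T.symm x z
    have := T.symm x u
    have := T.symm x v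
    omega
  rintro x ⟨u, hu, v, hv, h⟩ y ⟨u', hu', v', hv', h'⟩ z hz
  have h1 : ∃ p ∈ S, d p z + d z y = d p y := by
    rcases key u v x y z h hz with h1 | h1
    exacts [⟨u, hu, h1⟩, ⟨v, hv, h1⟩]
  obtain ⟨p, hp, h1⟩ := h1
  rcases key u' v' y p z h' (by rw [T.symm y z, T.symm z p, T.symm y p]; omega) with h2 | h2
  exacts [⟨u', hu', p, hp, h2⟩, ⟨v', hv', p, hp, h2⟩]

/-- Of two neighbours of `v`, at most one is closer to `x`. -/
lemma farther_of_two {x v y z : V} (h1 : d v y = 1) (h2 : d v z = 1) (h3 : 2 ≤ d y z) :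
    d x y = d x v + 1 ∨ d x z = d x v + 1 := by
  have := T.fourPt y z v x
  have := T.parity x v y
  have := T.parity x v z
  have := T.tri x v y
  have := T.tri x v z
  have := T.symm v x
  have := T.symm y v
  have := T.symm z v
  have := T.symm y x
  have := T.symm z x
  omega

/-- Each vertex has a neighbour farther away from a given vertex. -/
lemma exists_farther (x v : V) : ∃ w, d v w = 1 ∧ d x w = d x v + 1 := by
  obtain ⟨y, z, h1, h2, h3⟩ := T.two v
  rcases T.farther_of_two (x := x) h1 h2 h3.ge with h | h
  exacts [⟨y, h1, h⟩, ⟨z, h2, h⟩]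

/-! ### Lines and translations -/

lemma line_dist_nat {a : ℤ → V} (h1 : ∀ k, d (a k) (a (k + 1)) = 1)
    (h2 : ∀ k, a (k - 1) ≠ a (k + 1)) (j : ℤ) (n : ℕ) :
    d (a j) (a (j + n)) = n ∧ d (a j) (a (j + n + 1)) = n + 1 := by
  induction n with
  | zero => simpa [T.self] using h1 j
  | succ n ih =>
    push_cast
    rw [← add_assoc]
    refine ⟨ih.2, ?_⟩
    have h3 := h2 (j + n + 1)
    rw [add_sub_cancel_right] at h3
    have h4 : d (a (j + n)) (a (j + n + 1 + 1)) ≠ 0 := fun h => h3 (T.eq_of_zero h)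
    have h5 := h1 (j + n)
    have h6 := h1 (j + n + 1)
    have := T.parity (a (j + n)) (a (j + n + 1)) (a (j + n + 1 + 1))
    have := T.fourPt (a j) (a (j + n + 1)) (a (j + n)) (a (j + n + 1 + 1))
    have := T.symm (a (j + n + 1)) (a (j + n))
    have := T.tri (a j) (a (j + n + 1)) (a (j + n + 1 + 1))
    omega

/-- A doubly infinite path without backtracking is a geodesic. -/
lemma line_dist {a : ℤ → V} (h1 : ∀ k, d (a k) (a (k + 1)) = 1)
    (h2 : ∀ k, a (k - 1) ≠ a (k + 1)) (j k : ℤ) : d (a j) (a k) = (j - k).natAbs := by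
  rcases le_total j k with h | h
  · have := (T.line_dist_nat h1 h2 j (k - j).toNat).1
    rw [show j + ((k - j).toNat : ℤ) = k by omega] at this
    omega
  · have := (T.line_dist_nat h1 h2 k (j - k).toNat).1
    rw [show k + ((j - k).toNat : ℤ) = j by omega] at this
    rw [T.symm]
    omega

lemma convex_range_line {a : ℤ → V} (ha : ∀ j k, d (a j) (a k) = (j - k).natAbs) :
    Convex d (Set.range a) := by
  rintro _ ⟨j, rfl⟩ _ ⟨k, rfl⟩ z hz
  rcases le_total j k with h | h
  · refine ⟨j + d (a j) z, ?_⟩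
    have h3 := ha j k
    refine T.between_unique (x := a j) (y := a k) ?_ hz ?_ <;> simp only [ha] <;> omega
  · refine ⟨j - d (a j) z, ?_⟩
    have h3 := ha j k
    refine T.between_unique (x := a j) (y := a k) ?_ hz ?_ <;> simp only [ha] <;> omega

section Translation

variable {f : V → V} (hf : ∀ x y, d (f x) (f y) = d x y) {a : ℤ → V}
  (ha : ∀ j k, d (a j) (a k) = (j - k).natAbs) {m : ℤ} (hm : m ≠ 0) (hfa : ∀ k, f (a k) = a (k + m))

include hf ha hm hfa

/-- The displacement of a vertex under an isometry that translates a line. -/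
lemma displacement {v : V} {p : ℤ} (hp : IsProj d (Set.range a) v (a p)) :
    d v (f v) = m.natAbs + 2 * d v (a p) := by
  have h1 := hp.2 (a (p + m)) ⟨_, rfl⟩
  have h2 := hp.2 (a (p - m)) ⟨_, rfl⟩
  have h3 := hf v (a p)
  have h4 := hf v (a (p - m))
  rw [hfa] at h3 h4
  rw [sub_add_cancel] at h4
  have h5 := ha p (p + m)
  have h6 := ha p (p - m)
  have := T.fourPt v (a (p + m)) (f v) (a p)
  have := T.tri v (a p) (a (p + m))
  have := T.tri v (a (p + m)) (f v)
  have := T.symm (a (p + m)) (a p)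
  have := T.symm (a (p + m)) (f v)
  omega

lemma ne_of_translation (v : V) : f v ≠ v := by
  intro h
  obtain ⟨_, ⟨p, rfl⟩, hp⟩ := T.exists_proj (T.convex_range_line ha) ⟨_, 0, rfl⟩ v
  have := T.displacement hf ha hm hfa ⟨⟨p, rfl⟩, hp⟩
  rw [h, T.self] at this
  omega

/-- An isometry that translates a line `a` has no other axis: a line, both ends of which
are translated into themselves, has points with constant displacement at both ends, hence
runs inside `a` there. -/
lemma mem_range_of_translated_ends {b : ℤ → V} (hb : ∀ j k, d (b j) (b k) = (j - k).natAbs)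
    {N m₁ : ℤ} (h1 : ∀ k, N ≤ k → f (b k) = b (k + m₁)) {N' m₂ : ℤ}
    (h2 : ∀ k, k ≤ N' → f (b k) = b (k + m₂)) (k : ℤ) : b k ∈ Set.range a := by
  have hconv := T.convex_range_line ha
  have key : ∀ k m', f (b k) = b (k + m') → f (b (k + 1)) = b (k + 1 + m') →
      b k ∈ Set.range a := by
    intro k m' h3 h4
    obtain ⟨_, ⟨p, rfl⟩, hp⟩ := T.exists_proj hconv ⟨_, 0, rfl⟩ (b k)
    obtain ⟨_, ⟨q, rfl⟩, hq⟩ := T.exists_proj hconv ⟨_, 0, rfl⟩ (b (k + 1))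
    have hp' : IsProj d (Set.range a) (b k) (a p) := ⟨⟨p, rfl⟩, hp⟩
    have hq' : IsProj d (Set.range a) (b (k + 1)) (a q) := ⟨⟨q, rfl⟩, hq⟩
    have h5 := T.displacement hf ha hm hfa hp'
    have h6 := T.displacement hf ha hm hfa hq'
    rw [h3, hb] at h5
    rw [h4, hb] at h6
    have h7 := T.proj_eq_zero hp' hq' (by rw [hb]; omega) (by omega)
    exact ⟨p, (T.eq_of_zero h7).symm⟩
  have h3 := key (max N k) m₁ (h1 _ (le_max_left _ _)) (h1 _ (by omega))
  have h4 := key (min N' k - 1) m₂ (h2 _ (by omega)) (h2 _ (by omega))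
  refine hconv _ h4 _ h3 (b k) ?_
  simp only [hb]
  omega

end Translation

end TreeMetric

/-! ### The Bruhat-Tits tree is a tree -/

section BruhatTits

variable {K : Type*} [NormedField K]

/-- The matrix with rows `(c ^ n, a)` and `(0, 1)`. For a uniformizer `c`, its lattice class
corresponds to the disc of radius `|c| ^ n` around `a`. -/
def upper (c : Kˣ) (n : ℤ) (a : K) : GL (Fin 2) K :=
  Matrix.GeneralLinearGroup.mkOfDetNeZero !![(c : K) ^ n, a; 0, 1]
    (by simpa [Matrix.det_fin_two_of] using zpow_ne_zero n c.ne_zero)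

lemma coe_upper (c : Kˣ) (n : ℤ) (a : K) :
    (upper c n a : Matrix (Fin 2) (Fin 2) K) = !![(c : K) ^ n, a; 0, 1] := rfl

lemma upper_inv_mul (c : Kˣ) (n m : ℤ) (a b : K) :
    (upper c n a)⁻¹ * upper c m b = upper c (m - n) ((c : K) ^ (-n) * (b - a)) := by
  rw [inv_mul_eq_iff_eq_mul]
  apply Units.ext
  rw [Matrix.GeneralLinearGroup.coe_mul]
  simp only [coe_upper]
  ext i j
  fin_cases i <;> fin_cases j <;> simp [Matrix.mul_apply, Fin.sum_univ_two]
  · rw [← zpow_add₀ c.ne_zero]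
    congr 1
    ring
  · rw [mul_inv_cancel_left₀ (zpow_ne_zero n c.ne_zero)]
    ring

lemma coe_inv_mul_eq {A B : GL (Fin 2) K} {X : Matrix (Fin 2) (Fin 2) K}
    (h : (B : Matrix (Fin 2) (Fin 2) K) = (A : Matrix (Fin 2) (Fin 2) K) * X) :
    ((A⁻¹ * B : GL (Fin 2) K) : Matrix (Fin 2) (Fin 2) K) = X := by
  rw [Matrix.GeneralLinearGroup.coe_mul, h, ← mul_assoc, ← Matrix.GeneralLinearGroup.coe_mul,
    inv_mul_cancel, Matrix.GeneralLinearGroup.coe_one, one_mul]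

variable [IsUltrametricDist K] {ϖ : K} (hϖ : IsUnif ϖ)
include hϖ

omit hϖ in
lemma RelPos.eq_smul {g h : GL (Fin 2) K} (H : RelPos ϖ (g⁻¹ * h) 0) :
    g • stdVertex K = h • stdVertex K := by
  set X := g⁻¹ * h with hX
  obtain ⟨i, j, hij⟩ := exists_norm_eq_maxNorm (X : Matrix (Fin 2) (Fin 2) K)
  have h0 : (X : Matrix (Fin 2) (Fin 2) K) i j ≠ 0 := by
    rw [← norm_pos_iff, hij]; exact maxNorm_pos _
  let c : Kˣ := (Units.mk0 _ h0)⁻¹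
  have hc : ‖(c : K)‖ = (maxNorm (X : Matrix (Fin 2) (Fin 2) K))⁻¹ := by
    simp only [c, Units.val_inv_eq_inv_val, Units.val_mk0, norm_inv, hij]
  have hpos := maxNorm_pos X
  have hX' : g⁻¹ * (scalarGL c * h) = scalarGL c * X := by
    rw [← mul_assoc, scalarGL_comm, mul_assoc]
  have h1 : maxNorm ((g⁻¹ * (scalarGL c * h) : GL (Fin 2) K) : Matrix (Fin 2) (Fin 2) K) = 1 := by
    rw [hX', coe_scalarGL_mul, maxNorm_smul, hc, inv_mul_cancel₀ hpos.ne']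
  have h2 : maxNorm (((scalarGL c * h)⁻¹ * g : GL (Fin 2) K) : Matrix (Fin 2) (Fin 2) K) = 1 := by
    rw [show (scalarGL c * h)⁻¹ * g = (g⁻¹ * (scalarGL c * h))⁻¹ by group, maxNorm_inv, h1, hX',
      coe_scalarGL_mul, Matrix.det_smul, norm_mul, norm_pow, Fintype.card_fin, H, hc, pow_zero,
      mul_one, inv_pow, inv_mul_cancel₀ (pow_pos hpos 2).ne', one_div_one]
  refine Eq.symm (Quotient.sound (s := homothety K) ⟨c, ?_⟩)
  rw [smul_glLattice]
  exact le_antisymm (glLattice_le_iff.2 h2.le) (glLattice_le_iff.2 h1.le)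

/-- Every vertex is a disc: by column operations over `𝒪` and scaling, an invertible matrix can be
brought into upper triangular form with lower right entry `1`. -/
lemma exists_upper (x : Vertex K) :
    ∃ (n : ℤ) (a : K), upper (Units.mk0 ϖ hϖ.ne_zero) n a • stdVertex K = x := by
  obtain ⟨g, rfl⟩ := exists_smul_stdVertex hϖ x
  set u := Units.mk0 ϖ hϖ.ne_zero
  set G : Matrix (Fin 2) (Fin 2) K := (g : Matrix (Fin 2) (Fin 2) K) with hG
  have hdet : G.det ≠ 0 := det_ne_zero g
  -- the representative is found by clearing the larger one of the entries of the second row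
  have key : ∀ (n : ℤ) (δ a : K), δ ≠ 0 → ‖G.det / δ ^ 2‖ = ‖ϖ‖ ^ n →
      max ‖G 0 0 - a * G 1 0‖ ‖G 0 1 - a * G 1 1‖ = ‖ϖ‖ ^ n * ‖δ‖ →
      max ‖G 1 0‖ ‖G 1 1‖ = ‖δ‖ → upper u n a • stdVertex K = g • stdVertex K := by
    intro n δ a hδ hn h1 h2
    let X : Matrix (Fin 2) (Fin 2) K :=
      !![ϖ ^ (-n) * (G 0 0 - a * G 1 0), ϖ ^ (-n) * (G 0 1 - a * G 1 1); G 1 0, G 1 1]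
    have hX : (((upper u n a)⁻¹ * g : GL (Fin 2) K) : Matrix (Fin 2) (Fin 2) K) = X := by
      have h0 : ϖ ^ n ≠ 0 := zpow_ne_zero n hϖ.ne_zero
      refine coe_inv_mul_eq ?_
      ext i j
      fin_cases i <;> fin_cases j <;>
        simp [X, u, G, coe_upper, Matrix.mul_apply, Fin.sum_univ_two, h0]
    refine RelPos.eq_smul (ϖ := ϖ) ?_
    unfold RelPos
    have h4 : maxNorm X = ‖δ‖ := by
      simp only [maxNorm, X, Matrix.of_apply, Matrix.cons_val', Matrix.cons_val_zero,
        Matrix.cons_val_one, Matrix.cons_val_fin_one, norm_mul, norm_zpow]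
      rw [← mul_max_of_nonneg _ _ (zpow_pos hϖ.pos _).le, h1, h2, ← mul_assoc,
        ← zpow_add₀ hϖ.pos.ne', neg_add_cancel, zpow_zero, one_mul, max_self]
    have h5 : X.det = ϖ ^ (-n) * G.det := by
      rw [Matrix.det_fin_two G]
      simp only [X, Matrix.det_fin_two_of]
      ring
    rw [hX, h4, h5, norm_mul, norm_zpow, pow_zero, mul_one, zpow_neg, ← hn, norm_div, norm_pow]
    have := norm_pos_iff.2 hδ
    have := norm_pos_iff.2 hdet
    field_simp
  have hdet' := hdet
  rw [Matrix.det_fin_two] at hdet'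
  rcases le_total ‖G 1 0‖ ‖G 1 1‖ with h | h
  · have h0 : G 1 1 ≠ 0 := by
      intro h0
      rw [h0, norm_zero, norm_le_zero_iff] at h
      exact hdet' (by rw [h0, h]; ring)
    obtain ⟨n, hn⟩ := hϖ.exists_zpow (div_ne_zero hdet (pow_ne_zero 2 h0))
    refine ⟨n, G 0 1 / G 1 1, key n _ _ h0 hn ?_ (max_eq_right h)⟩
    have h1 : G 0 0 - G 0 1 / G 1 1 * G 1 0 = G.det / G 1 1 ^ 2 * G 1 1 := by
      rw [Matrix.det_fin_two]
      field_simp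
    rw [h1, norm_mul, hn, div_mul_cancel₀ _ h0, sub_self, norm_zero]
    exact max_eq_left (mul_nonneg (zpow_pos hϖ.pos _).le (norm_nonneg _))
  · have h0 : G 1 0 ≠ 0 := by
      intro h0
      rw [h0, norm_zero, norm_le_zero_iff] at h
      exact hdet' (by rw [h0, h]; ring)
    obtain ⟨n, hn⟩ := hϖ.exists_zpow (div_ne_zero hdet (pow_ne_zero 2 h0))
    refine ⟨n, G 0 0 / G 1 0, key n _ _ h0 hn ?_ (max_eq_left h)⟩
    have h1 : G 0 1 - G 0 0 / G 1 0 * G 1 1 = -(G.det / G 1 0 ^ 2 * G 1 0) := by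
      rw [Matrix.det_fin_two]
      field_simp
      ring
    rw [h1, norm_neg, norm_mul, hn, div_mul_cancel₀ _ h0, sub_self, norm_zero]
    exact max_eq_right (mul_nonneg (zpow_pos hϖ.pos _).le (norm_nonneg _))

/-- The distance of two vertices given by discs: `j` is the level of the smallest disc that
contains both. -/
lemma relPos_upper {n m j : ℤ} {a b : K} (hj : max (‖ϖ‖ ^ n) (max (‖ϖ‖ ^ m) ‖b - a‖) = ‖ϖ‖ ^ j) :
    (vdist (upper (Units.mk0 ϖ hϖ.ne_zero) n a • stdVertex K)
      (upper (Units.mk0 ϖ hϖ.ne_zero) m b • stdVertex K) : ℤ) = n + m - 2 * j := by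
  have h1 : j ≤ n := by
    rw [← hϖ.zpow_le, ← hj]; exact le_max_left _ _
  have h2 : j ≤ m := by
    rw [← hϖ.zpow_le, ← hj]; exact (le_max_left _ _).trans (le_max_right _ _)
  have h3 : vdist (upper (Units.mk0 ϖ hϖ.ne_zero) n a • stdVertex K)
      (upper (Units.mk0 ϖ hϖ.ne_zero) m b • stdVertex K) = (n + m - 2 * j).toNat := by
    rw [vdist_eq_iff hϖ, upper_inv_mul]
    unfold RelPos
    have h4 : maxNorm (upper (Units.mk0 ϖ hϖ.ne_zero) (m - n) (ϖ ^ (-n) * (b - a)) :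
        Matrix (Fin 2) (Fin 2) K) = ‖ϖ‖ ^ (j - n) := by
      have h5 : ‖ϖ‖ ^ (j - n) = max 1 (max (‖ϖ‖ ^ (m - n)) (‖ϖ‖ ^ (-n) * ‖b - a‖)) := by
        rw [sub_eq_neg_add j, zpow_add₀ hϖ.pos.ne', ← hj,
          mul_max_of_nonneg _ _ (zpow_pos hϖ.pos _).le, mul_max_of_nonneg _ _ (zpow_pos hϖ.pos _).le,
          ← zpow_add₀ hϖ.pos.ne', ← zpow_add₀ hϖ.pos.ne', neg_add_cancel, zpow_zero, neg_add_eq_sub]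
      rw [h5, coe_upper]
      simp only [maxNorm, Matrix.of_apply, Matrix.cons_val', Matrix.cons_val_zero,
        Matrix.cons_val_one, Matrix.cons_val_fin_one, norm_mul, norm_zpow, norm_zero, norm_one,
        Units.val_mk0]
      rw [max_eq_right (zero_le_one' ℝ), max_comm]
    rw [show ((Units.mk0 ϖ hϖ.ne_zero : Kˣ) : K) = ϖ from rfl, h4, coe_upper, Matrix.det_fin_two_of,
      ← zpow_natCast, ← zpow_natCast, ← zpow_mul, ← zpow_add₀ hϖ.pos.ne']
    simp only [Units.val_mk0, mul_one, mul_zero, sub_zero, norm_zpow]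
    rw [hϖ.zpow_inj]
    omega
  omega

/-- The Bruhat-Tits tree is a tree. With respect to a point at infinity, a vertex is a disc, and the
confluent `J x y` of the paths from `x` and `y` to infinity is the smallest disc that
contains both. The strong triangle inequality is the ultrametric inequality of `J`. -/
theorem treeMetric_vdist : TreeMetric (vdist : Vertex K → Vertex K → ℕ) := by
  choose n a hna using exists_upper hϖ
  have hex : ∀ (n m : ℤ) (a b : K), ∃ j : ℤ, max (‖ϖ‖ ^ n) (max (‖ϖ‖ ^ m) ‖b - a‖) = ‖ϖ‖ ^ j := by
    intro n m a b
    rcases eq_or_ne (b - a) 0 with h | h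
    · rw [h, norm_zero, max_eq_left (zpow_pos hϖ.pos m).le]
      rcases max_choice (‖ϖ‖ ^ n) (‖ϖ‖ ^ m) with h | h <;> exact ⟨_, h⟩
    · obtain ⟨k, hk⟩ := hϖ.exists_zpow h
      rw [hk]
      rcases max_choice (‖ϖ‖ ^ n) (max (‖ϖ‖ ^ m) (‖ϖ‖ ^ k)) with h | h <;> rw [h]
      · exact ⟨_, rfl⟩
      · rcases max_choice (‖ϖ‖ ^ m) (‖ϖ‖ ^ k) with h | h <;> exact ⟨_, h⟩
  choose J hJ using fun x y : Vertex K => hex (n x) (n y) (a x) (a y)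
  have hd : ∀ x y, (vdist x y : ℤ) = n x + n y - 2 * J x y := by
    intro x y
    conv_lhs => rw [← hna x, ← hna y]
    exact relPos_upper hϖ (hJ x y)
  have hle1 : ∀ x y, J x y ≤ n x := fun x y => by
    rw [← hϖ.zpow_le, ← hJ]; exact le_max_left _ _
  have hle2 : ∀ x y, J x y ≤ n y := fun x y => by
    rw [← hϖ.zpow_le, ← hJ]; exact (le_max_left _ _).trans (le_max_right _ _)
  have hsymm : ∀ x y, J x y = J y x := fun x y => by
    rw [← hϖ.zpow_inj, ← hJ, ← hJ, norm_sub_rev, max_left_comm]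
  have hself : ∀ x, J x x = n x := fun x => by
    rw [← hϖ.zpow_inj, ← hJ, sub_self, norm_zero, max_eq_left (zpow_pos hϖ.pos (n x)).le, max_self]
  have hultra : ∀ x y z, J x y ≤ J x z ∨ J y z ≤ J x z := by
    intro x y z
    rw [← hϖ.zpow_le, ← hϖ.zpow_le, ← le_max_iff, ← hJ x z, max_le_iff, max_le_iff]
    refine ⟨?_, ?_, ?_⟩
    · exact le_max_of_le_left (hϖ.zpow_le.2 (hle1 _ _))
    · exact le_max_of_le_right (hϖ.zpow_le.2 (hle2 _ _))
    · rw [show a z - a x = (a y - a x) + (a z - a y) by ring]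
      refine (IsUltrametricDist.norm_add_le_max _ _).trans (max_le_max ?_ ?_)
      · rw [← hJ]; exact (le_max_right _ _).trans (le_max_right _ _)
      · rw [← hJ]; exact (le_max_right _ _).trans (le_max_right _ _)
  refine ⟨?_, ?_, ?_, ?_, ?_, ?_, ?_⟩
  · intro x y h
    rw [← hna x, ← hna y, vdist_eq_iff hϖ] at h
    rw [← hna x, ← hna y]
    exact RelPos.eq_smul h
  · intro x
    have := hd x x
    have := hself x
    omega
  · intro x y
    have := hd x y
    have := hd y x
    have := hsymm x y
    omega
  · intro x y z
    have := hd x y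
    have := hd y z
    have := hd x z
    exact ⟨(vdist x y + vdist y z + vdist x z) / 2, by omega⟩
  · intro x y z w
    have := hd x y
    have := hd z w
    have := hd x z
    have := hd y w
    have := hd x w
    have := hd y z
    have := hultra x z y
    have := hultra x w y
    have := hultra z x w
    have := hultra z y w
    have := hsymm z x
    have := hsymm z y
    have := hsymm w y
    omega
  · intro x y hxy
    rcases lt_or_ge (J x y) (n x) with h | h
    · refine ⟨upper (Units.mk0 ϖ hϖ.ne_zero) (n x - 1) (a x) • stdVertex K, ?_, ?_⟩
      · have h1 := relPos_upper hϖ (n := n x) (m := n x - 1) (j := n x - 1) (a := a x) (b := a x) (by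
          rw [sub_self, norm_zero, max_eq_left (zpow_pos hϖ.pos _).le, max_eq_right]
          rw [hϖ.zpow_le]; omega)
        rw [hna x] at h1
        omega
      · have h1 := relPos_upper hϖ (n := n x - 1) (m := n y) (j := J x y) (a := a x) (b := a y) (by
          refine le_antisymm (max_le ?_ ?_) ?_
          · rw [hϖ.zpow_le]; omega
          · rw [← hJ]; exact le_max_right _ _
          · have h2 := hJ x y
            rcases max_choice (‖ϖ‖ ^ n x) (max (‖ϖ‖ ^ n y) ‖a y - a x‖) with h3 | h3
            · rw [h3, hϖ.zpow_inj] at h2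
              omega
            · rw [← h2, h3]
              exact le_max_right _ _)
        rw [hna y] at h1
        have := hd x y
        omega
    · have h0 := hd x y
      have h1 := hle1 x y
      have h2 := hle2 x y
      have hxy' : ‖a y - a x‖ ≤ ‖ϖ‖ ^ n x := by
        rw [show n x = J x y by omega, ← hJ]
        exact (le_max_right _ _).trans (le_max_right _ _)
      refine ⟨upper (Units.mk0 ϖ hϖ.ne_zero) (n x + 1) (a y) • stdVertex K, ?_, ?_⟩
      · have h3 := relPos_upper hϖ (n := n x) (m := n x + 1) (j := n x) (a := a x) (b := a y) (by
          refine max_eq_left (max_le ?_ hxy')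
          rw [hϖ.zpow_le]; omega)
        rw [hna x] at h3
        omega
      · have h3 := relPos_upper hϖ (n := n x + 1) (m := n y) (j := n x + 1) (a := a y) (b := a y) (by
          rw [sub_self, norm_zero, max_eq_left (zpow_pos hϖ.pos _).le, max_eq_left]
          rw [hϖ.zpow_le]; omega)
        rw [hna y] at h3
        omega
  · intro x
    have hcon (k l : ℤ) (hkl : k ≤ l) := relPos_upper hϖ (n := k) (m := l) (j := k) (a := a x)
      (b := a x) (by
        rw [sub_self, norm_zero, max_eq_left (zpow_pos hϖ.pos _).le, max_eq_left]
        rw [hϖ.zpow_le]; omega)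
    have h1 := relPos_upper hϖ (n := n x) (m := n x - 1) (j := n x - 1) (a := a x) (b := a x) (by
      rw [sub_self, norm_zero, max_eq_left (zpow_pos hϖ.pos _).le, max_eq_right]
      rw [hϖ.zpow_le]; omega)
    have h2 := hcon (n x) (n x + 1) (by omega)
    have h3 := hcon (n x - 1) (n x + 1) (by omega)
    rw [hna x] at h1 h2
    exact ⟨upper (Units.mk0 ϖ hϖ.ne_zero) (n x - 1) (a x) • stdVertex K,
      upper (Units.mk0 ϖ hϖ.ne_zero) (n x + 1) (a x) • stdVertex K, by omega, by omega, by omega⟩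

end BruhatTits

/-! ### Group action and extension of the ground field -/

section Action

variable {K : Type*} [NormedField K] [IsUltrametricDist K] {ϖ : K}

lemma pgl_smul_eq (g : GL (Fin 2) K) (x : Vertex K) : (g : PGL K) • x = g • x := rfl

lemma vdist_smul (hϖ : IsUnif ϖ) (γ : PGL K) (x y : Vertex K) :
    vdist (γ • x) (γ • y) = vdist x y := by
  obtain ⟨g, rfl⟩ := QuotientGroup.mk_surjective γ
  obtain ⟨h, rfl⟩ := exists_smul_stdVertex hϖ x
  obtain ⟨h', rfl⟩ := exists_smul_stdVertex hϖ y
  rw [pgl_smul_eq, pgl_smul_eq, ← mul_smul, ← mul_smul, vdist_eq_iff hϖ,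
    show (g * h)⁻¹ * (g * h') = h⁻¹ * h' by group]
  exact relPos_vdist hϖ h h'

omit [IsUltrametricDist K] in
lemma exists_eigenvector {G : Matrix (Fin 2) (Fin 2) K} {a b : K}
    (h : G.charpoly = (Polynomial.X - Polynomial.C a) * (Polynomial.X - Polynomial.C b)) :
    ∃ v : Fin 2 → K, v ≠ 0 ∧ G.mulVec v = a • v := by
  have h1 : (Matrix.scalar (Fin 2) a - G).det = 0 := by
    rw [← Matrix.eval_charpoly, h]
    simp
  obtain ⟨v, hv, h2⟩ := Matrix.exists_mulVec_eq_zero_iff.2 h1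
  refine ⟨v, hv, ?_⟩
  rw [Matrix.sub_mulVec, sub_eq_zero] at h2
  rw [← h2]
  ext i
  simp [Matrix.mulVec_diagonal]

/-- A hyperbolic element is conjugate to a diagonal matrix, hence translates the line of the lattices
spanned by multiples of two eigenvectors. -/
lemma IsHyperbolic.exists_axis (hϖ : IsUnif ϖ) {γ : PGL K} (hγ : IsHyperbolic γ) :
    ∃ (a : ℤ → Vertex K) (m : ℤ), m ≠ 0 ∧ (∀ j k, vdist (a j) (a k) = (j - k).natAbs) ∧
      ∀ k, γ • a k = a (k + m) := by
  obtain ⟨g, rfl, a, b, hab, hchar⟩ := hγ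
  obtain ⟨v, hv0, hv⟩ := exists_eigenvector hchar
  obtain ⟨w, hw0, hw⟩ := exists_eigenvector (hchar.trans (mul_comm _ _))
  let P : Matrix (Fin 2) (Fin 2) K := !![v 0, w 0; v 1, w 1]
  have hne : a ≠ b := fun h => hab (h ▸ rfl)
  have hP : P.det ≠ 0 := by
    intro h0
    obtain ⟨c, hc, h1⟩ := Matrix.exists_mulVec_eq_zero_iff.2 h0
    have h2 : c 0 • v + c 1 • w = 0 := by
      ext i
      have := congrFun h1 i
      fin_cases i <;> simp [P, Matrix.mulVec, dotProduct, Fin.sum_univ_two] at this ⊢ <;>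
        linear_combination this
    have h3 : (c 0 * a) • v + (c 1 * b) • w = 0 := by
      rw [mul_smul, mul_smul, ← hv, ← hw, ← Matrix.mulVec_smul, ← Matrix.mulVec_smul,
        ← Matrix.mulVec_add, h2, Matrix.mulVec_zero]
    have h4 : (c 0 * (a - b)) • v = 0 := by
      calc
        _ = ((c 0 * a) • v + (c 1 * b) • w) - b • (c 0 • v + c 1 • w) := by module
        _ = 0 := by rw [h3, h2, smul_zero, sub_zero]
    have h5 : c 0 = 0 := by
      rcases smul_eq_zero.1 h4 with h | h
      · exact (mul_eq_zero.1 h).resolve_right (sub_ne_zero.2 hne)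
      · exact absurd h hv0
    rw [h5, zero_smul, zero_add] at h2
    have h6 : c 1 = 0 := (smul_eq_zero.1 h2).resolve_right hw0
    refine hc (funext fun i => ?_)
    fin_cases i
    exacts [h5, h6]
  have hprod : a * b ≠ 0 := by
    have h1 := congrArg (Polynomial.eval 0) hchar
    rw [Matrix.eval_charpoly, map_zero, zero_sub, Matrix.det_neg] at h1
    simp only [Fintype.card_fin, Polynomial.eval_mul, Polynomial.eval_sub, Polynomial.eval_X,
      Polynomial.eval_C, zero_sub, neg_mul_neg, even_two, Even.neg_pow, one_pow, one_mul] at h1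
    rw [← h1]
    exact det_ne_zero g
  let Q : GL (Fin 2) K := Matrix.GeneralLinearGroup.mkOfDetNeZero P hP
  obtain ⟨ha0, hb0⟩ := mul_ne_zero_iff.1 hprod
  obtain ⟨m, hm⟩ := hϖ.exists_zpow (div_ne_zero ha0 hb0)
  set u := Units.mk0 ϖ hϖ.ne_zero with hu
  refine ⟨fun k => (Q * upper u k 0) • stdVertex K, m, ?_, ?_, ?_⟩
  · rintro rfl
    rw [zpow_zero, norm_div, div_eq_one_iff_eq (norm_ne_zero_iff.2 hb0)] at hm
    exact hab hm
  · have hle : ∀ j k : ℤ, j ≤ k → vdist ((Q * upper u j 0) • stdVertex K)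
        ((Q * upper u k 0) • stdVertex K) = (j - k).natAbs := by
      intro j k hjk
      rw [mul_smul, mul_smul, ← pgl_smul_eq Q, ← pgl_smul_eq Q, vdist_smul hϖ]
      have := relPos_upper hϖ (n := j) (m := k) (j := j) (a := 0) (b := 0) (by
        rw [sub_self, norm_zero, max_eq_left (zpow_pos hϖ.pos _).le, max_eq_left]
        rwa [hϖ.zpow_le])
      rw [← hu] at this
      omega
    intro j k
    show vdist ((Q * upper u j 0) • stdVertex K) ((Q * upper u k 0) • stdVertex K) = _
    rcases le_total j k with h | h
    · exact hle j k h
    · rw [(treeMetric_vdist hϖ).symm]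
      have := hle k j h
      omega
  · intro k
    rw [pgl_smul_eq, ← mul_smul]
    have hX : (((Q * upper u (k + m) 0)⁻¹ * (g * (Q * upper u k 0)) : GL (Fin 2) K) :
        Matrix (Fin 2) (Fin 2) K) = !![a * ϖ ^ (-m), 0; 0, b] := by
      refine coe_inv_mul_eq ?_
      have hQ : (Q : Matrix (Fin 2) (Fin 2) K) = P := rfl
      have hϖm : ϖ ^ m ≠ 0 := zpow_ne_zero m hϖ.ne_zero
      have h1 := congrFun hv
      have h2 := congrFun hw
      simp only [Matrix.mulVec, dotProduct, Fin.sum_univ_two, Pi.smul_apply, smul_eq_mul] at h1 h2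
      simp only [Matrix.GeneralLinearGroup.coe_mul, hQ, coe_upper, P]
      ext i j
      fin_cases j
      · have := h1 i
        fin_cases i <;> simp [Matrix.mul_apply, Fin.sum_univ_two, u, zpow_add₀ hϖ.ne_zero] at this ⊢ <;>
          field_simp <;> linear_combination ϖ ^ k * this
      · have := h2 i
        fin_cases i <;> simp [Matrix.mul_apply, Fin.sum_univ_two] at this ⊢ <;>
          linear_combination this
    refine (RelPos.eq_smul (ϖ := ϖ) ?_).symm
    unfold RelPos
    have hab' : ‖a * ϖ ^ (-m)‖ = ‖b‖ := by
      rw [norm_mul, norm_zpow, zpow_neg, ← hm, norm_div]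
      have := norm_pos_iff.2 ha0
      have := norm_pos_iff.2 hb0
      field_simp
    rw [hX, Matrix.det_fin_two_of, mul_zero, sub_zero, norm_mul, hab']
    simp only [maxNorm, Matrix.of_apply, Matrix.cons_val', Matrix.cons_val_zero,
      Matrix.cons_val_one, Matrix.cons_val_fin_one, hab', norm_zero]
    rw [max_eq_left (norm_nonneg b), max_eq_right (norm_nonneg b), max_self, pow_zero, mul_one, sq]

end Action

section Extension

variable {K L : Type*} [NormedField K] [IsUltrametricDist K] [NormedField L]
  [IsUltrametricDist L] [NormedAlgebra K L]

/-- The homomorphism `GL(2, K) → GL(2, L)`. -/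
abbrev glMap (K L : Type*) [Field K] [Field L] [Algebra K L] : GL (Fin 2) K →* GL (Fin 2) L :=
  Matrix.GeneralLinearGroup.map (algebraMap K L)

omit [IsUltrametricDist K] [IsUltrametricDist L] in
lemma coe_glMap (g : GL (Fin 2) K) : (glMap K L g : Matrix (Fin 2) (Fin 2) L) =
    (g : Matrix (Fin 2) (Fin 2) K).map (algebraMap K L) := rfl

omit [IsUltrametricDist K] [IsUltrametricDist L] in
lemma coordMap_mulVec (X : Matrix (Fin 2) (Fin 2) K) (w : Fin 2 → K) :
    coordMap K L (X.mulVec w) = (X.map (algebraMap K L)).mulVec (coordMap K L w) := by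
  ext i
  simp [coordMap, Matrix.mulVec, dotProduct]

lemma extVertex_smul_stdVertex (g : GL (Fin 2) K) :
    extVertex L (g • stdVertex K) = glMap K L g • stdVertex L := by
  refine congrArg (Vertex.mk (K := L)) (Subtype.ext ?_)
  show Submodule.span (IntRing L)
    (coordMap K L '' ((glLattice g (stdLattice K)).1 : Set (Fin 2 → K))) = _
  apply le_antisymm
  · rw [Submodule.span_le]
    rintro _ ⟨v, hv, rfl⟩
    obtain ⟨w, hw, rfl⟩ := mem_glLattice.1 hv
    rw [coordMap_mulVec]
    refine mem_glLattice.2 ⟨_, mem_stdLattice.2 fun i => ?_, rfl⟩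
    rw [coordMap, norm_algebraMap']
    exact mem_stdLattice.1 hw i
  · intro v hv
    obtain ⟨w, hw, rfl⟩ := mem_glLattice.1 hv
    rw [pi_eq_sum_univ w, Matrix.mulVec_sum]
    refine Submodule.sum_mem _ fun i _ => ?_
    rw [Matrix.mulVec_smul]
    refine Submodule.smul_mem _ (⟨w i, mem_intRing.2 (mem_stdLattice.1 hw i)⟩ : IntRing L)
      (Submodule.subset_span ?_)
    refine ⟨Matrix.mulVec (g : Matrix (Fin 2) (Fin 2) K) (Pi.single i 1),
      mem_glLattice.2 ⟨_, Submodule.subset_span ⟨i, rfl⟩, rfl⟩, ?_⟩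
    rw [coordMap_mulVec]
    congr 1
    ext j
    simp [coordMap, Pi.single_apply, eq_comm, apply_ite (algebraMap K L)]

variable {ϖ : K} {ϖ' : L}

lemma extVertex_smul (hϖ : IsUnif ϖ) (γ : PGL K) (x : Vertex K) :
    extVertex L (γ • x) = pglMap K L γ • extVertex L x := by
  obtain ⟨g, rfl⟩ := QuotientGroup.mk_surjective γ
  obtain ⟨h, rfl⟩ := exists_smul_stdVertex hϖ x
  rw [pgl_smul_eq, ← mul_smul, extVertex_smul_stdVertex, extVertex_smul_stdVertex, map_mul, mul_smul]
  rfl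

/-- Extension of the ground field multiplies distances by the ramification index. -/
lemma vdist_extVertex (hϖ : IsUnif ϖ) (hϖ' : IsUnif ϖ') (x y : Vertex K) :
    vdist (extVertex L x) (extVertex L y) = ramIndex K L * vdist x y := by
  obtain ⟨g, rfl⟩ := exists_smul_stdVertex hϖ x
  obtain ⟨h, rfl⟩ := exists_smul_stdVertex hϖ y
  rw [extVertex_smul_stdVertex, extVertex_smul_stdVertex, vdist_eq_iff hϖ', ← map_inv, ← map_mul]
  have H := relPos_vdist hϖ g h
  unfold RelPos at *
  rw [coe_glMap, maxNorm_map, pow_mul, ← (norm_uniformizer_eq hϖ hϖ').2, ← H,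
    ← RingHom.mapMatrix_apply, ← RingHom.map_det, norm_algebraMap']

end Extension

/-! ### Subdivision of lines -/

namespace TreeMetric

variable {V : Type*} {d : V → V → ℕ} (T : TreeMetric d)
include T

/-- A line of points at mutual distances `e |j - k|` can be refined to a geodesic. -/
lemma exists_subdivision {A : ℤ → V} {e : ℕ} (he : 0 < e)
    (hA : ∀ j k, d (A j) (A k) = e * (j - k).natAbs) :
    ∃ b : ℤ → V, (∀ k, b (e * k) = A k) ∧ ∀ i j, d (b i) (b j) = (i - j).natAbs := by
  have hpos : (0 : ℤ) < e := by exact_mod_cast he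
  have hA1 : ∀ k, d (A k) (A (k + 1)) = e := fun k => by
    rw [hA, show k - (k + 1) = -1 by ring]; simp
  have hA2 : ∀ j k : ℤ, j ≤ k → (d (A j) (A k) : ℤ) = e * k - e * j := fun j k h => by
    rw [hA, Nat.cast_mul, Int.natCast_natAbs, abs_of_nonpos (by omega)]
    ring
  have hr : ∀ i : ℤ, (i % e).toNat ≤ d (A (i / e)) (A (i / e + 1)) := fun i => by
    rw [hA1]
    have := Int.emod_lt_of_pos i hpos
    omega
  choose b hb1 hb2 using fun i : ℤ => T.exists_between (hr i)
  have hdiv : ∀ i : ℤ, i % e + e * (i / e) = i := fun i => Int.emod_add_mul_ediv i e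
  have hmod : ∀ i : ℤ, 0 ≤ i % e := fun i => Int.emod_nonneg _ hpos.ne'
  -- the position of `b i` with respect to distant points of the line
  have hleft : ∀ (i j : ℤ), j ≤ i / e → (d (A j) (b i) : ℤ) = i - e * j ∧
      ∀ k, i / e + 1 ≤ k → (d (b i) (A k) : ℤ) = e * k - i := by
    intro i j hj
    have key : ∀ k, i / e + 1 ≤ k → (d (A j) (b i) : ℤ) = i - e * j ∧
        (d (b i) (A k) : ℤ) = e * k - i := by
      intro k hk
      have h1 := hb1 i
      have h2 := hb2 i
      rw [hA1] at h2
      have h3 := T.tri (A j) (A (i / e)) (b i)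
      have h4 := T.tri (b i) (A (i / e + 1)) (A k)
      have h5 := T.tri (A j) (b i) (A k)
      have h6 := hA2 j (i / e) hj
      have h7 := hA2 (i / e + 1) k hk
      have h8 := hA2 j k (by omega)
      rw [mul_add, mul_one] at h7
      have := hdiv i
      have := hmod i
      omega
    exact ⟨(key _ le_rfl).1, fun k hk => (key k hk).2⟩
  refine ⟨b, fun k => ?_, fun i j => ?_⟩
  · have h1 := hb1 (e * k)
    rw [Int.mul_emod_right, Int.mul_ediv_cancel_left _ hpos.ne', Int.toNat_zero] at h1
    exact (T.eq_of_zero h1).symm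
  · set N := min (i / e) (j / e)
    set M := max (i / e) (j / e) + 1
    have h1 := (hleft i N (min_le_left _ _)).1
    have h2 := (hleft i N (min_le_left _ _)).2 M (by omega)
    have h3 := (hleft j N (min_le_right _ _)).1
    have h4 := (hleft j N (min_le_right _ _)).2 M (by omega)
    have h5 := hA2 N M (by omega)
    have := T.fourPt (b i) (b j) (A N) (A M)
    have := T.tri (A N) (b i) (b j)
    have := T.tri (A N) (b j) (b i)
    have := T.symm (b i) (A N)
    have := T.symm (b j) (A N)
    have := T.symm (b i) (b j)
    omega

/-- An isometry that shifts a segment of the line `A` shifts its subdivision. -/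
lemma subdivision_shift {A b : ℤ → V} {e : ℕ} (hbA : ∀ k, b (e * k) = A k)
    (hb : ∀ i j, d (b i) (b j) = (i - j).natAbs) {f : V → V} (hf : ∀ x y, d (f x) (f y) = d x y)
    {k m : ℤ} (h1 : f (A k) = A (k + m)) (h2 : f (A (k + 1)) = A (k + 1 + m)) {i : ℤ}
    (hi1 : e * k ≤ i) (hi2 : i ≤ e * (k + 1)) : f (b i) = b (i + e * m) := by
  rw [← hbA, ← hbA] at h1 h2
  have e1 : (e : ℤ) * (k + 1) = e * k + e := by ring
  have e2 : (e : ℤ) * (k + m) = e * k + e * m := by ring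
  have e3 : (e : ℤ) * (k + 1 + m) = e * k + e + e * m := by ring
  have h3 := hf (b (e * k)) (b i)
  have h4 := hf (b i) (b (e * (k + 1)))
  have h5 := hb (e * k) i
  have h6 := hb i (e * (k + 1))
  have h7 := hb (e * (k + m)) (i + e * m)
  have h8 := hb (i + e * m) (e * (k + 1 + m))
  have h9 := hb (e * (k + m)) (e * (k + 1 + m))
  rw [h1] at h3
  rw [h2] at h4
  exact T.between_unique (x := b (e * (k + m))) (y := b (e * (k + 1 + m))) (by omega) (by omega)
    (by omega)

end TreeMetric

/-! ### The tree of a Schottky group -/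

section Hull

open TreeMetric

variable {K : Type*} [NormedField K] [IsUltrametricDist K] {ϖ : K}

lemma isSubtree_iff (hϖ : IsUnif ϖ) (S : Set (Vertex K)) :
    IsSubtree S ↔ Convex vdist S := ((treeMetric_vdist hϖ).convex_iff S).symm

lemma IsAxisOf.vdist_eq (hϖ : IsUnif ϖ) {γ : PGL K} {a : ℤ → Vertex K} (ha : IsAxisOf γ a)
    (j k : ℤ) : vdist (a j) (a k) = (j - k).natAbs :=
  (treeMetric_vdist hϖ).line_dist ha.1 ha.2.1 j k

lemma isAxisOf_of_vdist (hϖ : IsUnif ϖ) {γ : PGL K} {a : ℤ → Vertex K}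
    (ha : ∀ j k, vdist (a j) (a k) = (j - k).natAbs)
    (h1 : ∃ N m : ℤ, ∀ k, N ≤ k → γ • a k = a (k + m))
    (h2 : ∃ N m : ℤ, ∀ k, k ≤ N → γ • a k = a (k + m)) : IsAxisOf γ a := by
  refine ⟨fun k => ?_, fun k => ?_, h1, h2⟩
  · rw [Adj, ha]
    omega
  · refine (treeMetric_vdist hϖ).ne_of_pos ?_
    rw [ha]
    omega

variable {Γ : Subgroup (PGL K)}

lemma convex_axesHull (hϖ : IsUnif ϖ) : Convex vdist (axesHull Γ) := by
  intro x hx y hy z hz S hS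
  exact (isSubtree_iff hϖ S).1 hS.1 x (hx S hS) y (hy S hS) z hz

lemma axis_subset_axesHull {γ : PGL K} (hγ : γ ∈ Γ) (h1 : γ ≠ 1) {a : ℤ → Vertex K}
    (ha : IsAxisOf γ a) (k : ℤ) : a k ∈ axesHull Γ := fun _ hS => hS.2 γ hγ h1 a ha ⟨k, rfl⟩

lemma axesHull_subset (hϖ : IsUnif ϖ) {S : Set (Vertex K)} (hS : Convex vdist S)
    (h : ∀ γ ∈ Γ, γ ≠ 1 → ∀ a, IsAxisOf γ a → Set.range a ⊆ S) : axesHull Γ ⊆ S :=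
  fun _ hx => hx S ⟨(isSubtree_iff hϖ S).2 hS, h⟩

lemma IsAxisOf.conj {γ δ : PGL K} (hϖ : IsUnif ϖ) {a : ℤ → Vertex K} (ha : IsAxisOf γ a) :
    IsAxisOf (δ * γ * δ⁻¹) (fun k => δ • a k) := by
  obtain ⟨h1, h2, ⟨N, m, h3⟩, N', m', h4⟩ := ha
  refine ⟨fun k => ?_, fun k h => h2 k (smul_left_cancel δ h), ⟨N, m, fun k hk => ?_⟩,
    ⟨N', m', fun k hk => ?_⟩⟩
  · rw [Adj, vdist_smul hϖ]
    exact h1 k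
  · rw [mul_smul, inv_smul_smul, mul_smul, h3 k hk]
  · rw [mul_smul, inv_smul_smul, mul_smul, h4 k hk]

lemma smul_mem_axesHull (hϖ : IsUnif ϖ) {γ : PGL K} (hγ : γ ∈ Γ) {x : Vertex K}
    (hx : x ∈ axesHull Γ) : γ • x ∈ axesHull Γ := by
  have hsub : axesHull Γ ⊆ {y | γ • y ∈ axesHull Γ} := by
    refine axesHull_subset hϖ ?_ ?_
    · intro x hx y hy z hz
      refine convex_axesHull hϖ _ hx _ hy _ ?_
      rwa [vdist_smul hϖ, vdist_smul hϖ, vdist_smul hϖ]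
    · rintro δ hδ h1 a ha _ ⟨k, rfl⟩
      refine axis_subset_axesHull (Γ.mul_mem (Γ.mul_mem hγ hδ) (Γ.inv_mem hγ)) ?_
        (ha.conj (δ := γ) hϖ) k
      rwa [Ne, conj_eq_one_iff]
  exact hsub hx

/-- The vertex `v` has distance `n` from the tree of `Γ`. -/
def AtDist (Γ : Subgroup (PGL K)) (v : Vertex K) (n : ℕ) : Prop :=
  ∃ p, IsProj vdist (axesHull Γ) v p ∧ vdist v p = n

lemma AtDist.smul (hϖ : IsUnif ϖ) {γ : PGL K} (hγ : γ ∈ Γ) {v : Vertex K} {n : ℕ}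
    (h : AtDist Γ v n) : AtDist Γ (γ • v) n := by
  obtain ⟨p, hp, rfl⟩ := h
  refine ⟨γ • p, ⟨smul_mem_axesHull hϖ hγ hp.1, fun w hw => ?_⟩, vdist_smul hϖ _ _ _⟩
  have h1 := hp.2 _ (smul_mem_axesHull hϖ (Γ.inv_mem hγ) hw)
  rw [← vdist_smul hϖ γ, ← vdist_smul hϖ γ v p, ← vdist_smul hϖ γ p, smul_inv_smul] at h1
  exact h1

/-- Neighbours outside of the tree of `Γ` have different distances from it. -/
lemma AtDist.eq_zero_of_adj (hϖ : IsUnif ϖ) {a b : Vertex K} {n : ℕ} (ha : AtDist Γ a n)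
    (hb : AtDist Γ b n) (hab : Adj a b) : n = 0 := by
  obtain ⟨p, hp, rfl⟩ := ha
  obtain ⟨q, hq, h⟩ := hb
  exact (treeMetric_vdist hϖ).proj_eq_zero hp hq hab h.symm

lemma mem_redVertices {e n : ℕ} (he : 0 < e) {v : Vertex K} :
    v ∈ redVertices Γ e n ↔ ∃ u ∈ axesHull Γ, vdist v u ≤ n * e := by
  simp only [redVertices, Set.mem_ofPred_eq]
  have he' : (0 : ℚ) < e := by exact_mod_cast he
  simp only [div_le_iff₀ he']
  norm_cast

/-- The tree of `Γ` has no end points. -/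
lemma exists_farther_mem_axesHull (hϖ : IsUnif ϖ) (x₀ : Vertex K) {v : Vertex K}
    (hv : v ∈ axesHull Γ) : ∃ b ∈ axesHull Γ, Adj v b ∧ vdist x₀ b = vdist x₀ v + 1 := by
  have T := treeMetric_vdist hϖ
  by_contra! hcon
  -- an end point could be removed from the tree
  have hsub : axesHull Γ ⊆ axesHull Γ \ {v} := by
    refine axesHull_subset hϖ ?_ ?_
    · rintro x ⟨hx, hxv⟩ y ⟨hy, hyv⟩ z hz
      refine ⟨convex_axesHull hϖ _ hx _ hy _ hz, ?_⟩
      rintro rfl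
      obtain ⟨b, h1, h2⟩ := T.step (x := z) (y := x) fun h => hxv (T.eq_of_zero h).symm
      obtain ⟨c, h3, h4⟩ := T.step (x := z) (y := y) fun h => hyv (T.eq_of_zero h).symm
      have hb : b ∈ axesHull Γ := convex_axesHull hϖ _ hv _ hx _ (by omega)
      have hc : c ∈ axesHull Γ := convex_axesHull hϖ _ hv _ hy _ (by omega)
      have := T.tri x b c
      have := T.tri x c y
      have := T.symm x b
      have := T.symm x z
      rcases T.farther_of_two (x := x₀) h1 h3 (by omega) with h | h
      · exact hcon b hb h1 h
      · exact hcon c hc h3 h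
    · rintro γ hγ h1 a ha _ ⟨k, rfl⟩
      refine ⟨axis_subset_axesHull hγ h1 ha k, ?_⟩
      rintro rfl
      have hd := ha.vdist_eq hϖ
      rcases T.farther_of_two (x := x₀) (v := a k) (y := a (k - 1)) (z := a (k + 1))
        (by rw [hd]; omega) (by rw [hd]; omega) (by rw [hd]; omega) with h | h
      · exact hcon _ (axis_subset_axesHull hγ h1 ha _) (by rw [Adj, hd]; omega) h
      · exact hcon _ (axis_subset_axesHull hγ h1 ha _) (by rw [Adj, hd]; omega) h
  exact (hsub hv).2 rfl

/-- The sinks are the vertices at maximal distance from the tree of `Γ`. -/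
lemma IsSink.atDist (hϖ : IsUnif ϖ) {n : ℕ} {x₀ v : Vertex K} (h : IsSink Γ 1 n x₀ v) :
    AtDist Γ v n ∧ 0 < n := by
  have T := treeMetric_vdist hϖ
  obtain ⟨hv, hsink⟩ := h
  obtain ⟨u, hu, huv⟩ := (mem_redVertices one_pos).1 hv
  obtain ⟨p, hp⟩ := T.exists_proj (convex_axesHull hϖ) ⟨u, hu⟩ v
  have h1 := hp.2 u hu
  have hn : vdist v p = n := by
    by_contra hne
    obtain ⟨w, h2, h3⟩ := T.exists_farther x₀ v
    refine hsink w ((mem_redVertices one_pos).2 ⟨p, hp.1, ?_⟩) h2 h3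
    have := T.tri w v p
    have := T.symm w v
    omega
  refine ⟨⟨p, hp, hn⟩, ?_⟩
  by_contra h0
  have hvp : v = p := T.eq_of_zero (by omega)
  obtain ⟨b, hb, h2, h3⟩ := exists_farther_mem_axesHull hϖ x₀ (hvp ▸ hp.1)
  exact hsink b ((mem_redVertices one_pos).2 ⟨b, hb, by rw [T.self]; omega⟩) h2 h3

end Hull

/-! ### The tree of a Schottky group after extension of the ground field -/

section ExtHull

open TreeMetric

variable {K L : Type*} [NormedField K] [IsUltrametricDist K] [NormedField L]
  [IsUltrametricDist L] [NormedAlgebra K L] {ϖ : K} {ϖ' : L} {Γ : Subgroup (PGL K)}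

lemma exists_extLine (hϖ : IsUnif ϖ) (hϖ' : IsUnif ϖ') {a : ℤ → Vertex K}
    (ha : ∀ j k, vdist (a j) (a k) = (j - k).natAbs) :
    ∃ b : ℤ → Vertex L, (∀ k, b (ramIndex K L * k) = extVertex L (a k)) ∧
      ∀ i j, vdist (b i) (b j) = (i - j).natAbs :=
  (treeMetric_vdist hϖ').exists_subdivision (A := fun k => extVertex L (a k))
    (norm_uniformizer_eq hϖ hϖ').1 fun j k => by rw [vdist_extVertex hϖ hϖ', ha]

lemma extLine_shift (hϖ : IsUnif ϖ) (hϖ' : IsUnif ϖ') {a : ℤ → Vertex K} {b : ℤ → Vertex L}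
    (hba : ∀ k, b (ramIndex K L * k) = extVertex L (a k))
    (hb : ∀ i j, vdist (b i) (b j) = (i - j).natAbs) {γ : PGL K} {m i : ℤ}
    (h1 : γ • a (i / ramIndex K L) = a (i / ramIndex K L + m))
    (h2 : γ • a (i / ramIndex K L + 1) = a (i / ramIndex K L + 1 + m)) :
    pglMap K L γ • b i = b (i + ramIndex K L * m) := by
  have hpos : (0 : ℤ) < ramIndex K L := by exact_mod_cast (norm_uniformizer_eq hϖ hϖ').1
  have := Int.emod_add_mul_ediv i (ramIndex K L)
  have := Int.emod_nonneg i hpos.ne'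
  have := Int.emod_lt_of_pos i hpos
  refine (treeMetric_vdist hϖ').subdivision_shift (A := fun k => extVertex L (a k)) hba hb
    (f := fun x => pglMap K L γ • x) (vdist_smul hϖ' _) (k := i / ramIndex K L) ?_ ?_ ?_ ?_
  · rw [← extVertex_smul hϖ, h1]
  · rw [← extVertex_smul hϖ, h2]
  · omega
  · rw [mul_add, mul_one]
    omega

lemma IsSchottky.exists_extAxis (hϖ : IsUnif ϖ) (hϖ' : IsUnif ϖ') (hΓ : IsSchottky Γ) {γ : PGL K}
    (hγ : γ ∈ Γ) (h1 : γ ≠ 1) : ∃ (a : ℤ → Vertex K) (b : ℤ → Vertex L) (m : ℤ), m ≠ 0 ∧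
      IsAxisOf γ a ∧ (∀ k, b (ramIndex K L * k) = extVertex L (a k)) ∧
      (∀ i j, vdist (b i) (b j) = (i - j).natAbs) ∧ ∀ k, pglMap K L γ • b k = b (k + m) := by
  obtain ⟨a, m, hm, ha, hγa⟩ := (hΓ.2 γ hγ h1).exists_axis hϖ
  obtain ⟨b, hba, hb⟩ := exists_extLine (L := L) hϖ hϖ' ha
  refine ⟨a, b, ramIndex K L * m, mul_ne_zero ?_ hm, isAxisOf_of_vdist hϖ ha
    ⟨0, m, fun k _ => hγa k⟩ ⟨0, m, fun k _ => hγa k⟩, hba, hb, fun k =>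
      extLine_shift hϖ hϖ' hba hb (hγa _) (hγa _)⟩
  exact_mod_cast (norm_uniformizer_eq hϖ hϖ').1.ne'

/-- A Schottky group acts freely on the vertices of the tree over an extension field. -/
lemma IsSchottky.eq_one_of_ext_smul_eq (hϖ : IsUnif ϖ) (hϖ' : IsUnif ϖ') (hΓ : IsSchottky Γ)
    {γ : PGL K} (hγ : γ ∈ Γ) {w : Vertex L} (h : pglMap K L γ • w = w) : γ = 1 := by
  by_contra h1
  obtain ⟨a, b, m, hm, -, -, hb, hγb⟩ := hΓ.exists_extAxis hϖ hϖ' hγ h1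
  exact (treeMetric_vdist hϖ').ne_of_translation (vdist_smul hϖ' _) hb hm hγb w h

lemma extVertex_mem_axesHull (hϖ : IsUnif ϖ) (hϖ' : IsUnif ϖ') (hΓ : IsSchottky Γ)
    {v : Vertex K} (hv : v ∈ axesHull Γ) : extVertex L v ∈ axesHull (extGroup L Γ) := by
  intro S hS
  have hpos := (norm_uniformizer_eq hϖ hϖ').1
  have hsub : axesHull Γ ⊆ extVertex L ⁻¹' S := by
    refine axesHull_subset hϖ ?_ ?_
    · intro x hx y hy z hz
      refine (isSubtree_iff hϖ' S).1 hS.1 _ hx _ hy _ ?_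
      rw [vdist_extVertex hϖ hϖ', vdist_extVertex hϖ hϖ', vdist_extVertex hϖ hϖ', ← mul_add, hz]
    · rintro γ hγ h1 a ha _ ⟨k, rfl⟩
      obtain ⟨b, hba, hb⟩ := exists_extLine (L := L) hϖ hϖ' (ha.vdist_eq hϖ)
      obtain ⟨-, -, ⟨N, m, h3⟩, N', m', h4⟩ := ha
      have hposZ : (0 : ℤ) < ramIndex K L := by exact_mod_cast hpos
      have hb' : IsAxisOf (pglMap K L γ) b := by
        refine isAxisOf_of_vdist hϖ' hb ⟨ramIndex K L * N, ramIndex K L * m, fun k hk => ?_⟩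
          ⟨ramIndex K L * (N' - 1), ramIndex K L * m', fun k hk => ?_⟩
        · have : N ≤ k / ramIndex K L := by
            rwa [Int.le_ediv_iff_mul_le hposZ, mul_comm]
          exact extLine_shift hϖ hϖ' hba hb (h3 _ this) (h3 _ (by omega))
        · have : k / ramIndex K L ≤ N' - 1 := by
            have := Int.ediv_le_ediv hposZ hk
            rwa [Int.mul_ediv_cancel_left _ hposZ.ne'] at this
          exact extLine_shift hϖ hϖ' hba hb (h4 _ (by omega)) (h4 _ (by omega))
      have hne : pglMap K L γ ≠ 1 := fun h =>
        h1 (hΓ.eq_one_of_ext_smul_eq hϖ hϖ' hγ (w := b 0) (by rw [h, one_smul]))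
      have := hS.2 _ (Subgroup.mem_map_of_mem _ hγ) hne b hb' ⟨ramIndex K L * k, rfl⟩
      rwa [hba] at this
  exact hsub hv

/-- The tree of `Γ` over `L` is the subdivision of the tree over `K`: by uniqueness of axes no
others appear over `L`. -/
lemma axesHull_ext_subset (hϖ : IsUnif ϖ) (hϖ' : IsUnif ϖ') (hΓ : IsSchottky Γ) :
    axesHull (extGroup L Γ) ⊆ {w | ∃ u ∈ extVertex L '' axesHull Γ,
      ∃ v ∈ extVertex L '' axesHull Γ, vdist u w + vdist w v = vdist u v} := by
  refine axesHull_subset hϖ' ((treeMetric_vdist hϖ').convex_segments _) ?_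
  rintro _ ⟨γ, hγ, rfl⟩ h1 c hc _ ⟨i, rfl⟩
  have hγ1 : γ ≠ 1 := by
    rintro rfl
    exact h1 (map_one _)
  obtain ⟨a, b, m, hm, ha, hba, hb, hγb⟩ := hΓ.exists_extAxis (L := L) hϖ hϖ' hγ hγ1
  have hcd := hc.vdist_eq hϖ'
  obtain ⟨-, -, ⟨N, m₁, h3⟩, N', m₂, h4⟩ := hc
  obtain ⟨j, hj⟩ := (treeMetric_vdist hϖ').mem_range_of_translated_ends (vdist_smul hϖ' _) hb hm
    hγb hcd h3 h4 i
  rw [← hj]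
  have hpos : (0 : ℤ) < ramIndex K L := by exact_mod_cast (norm_uniformizer_eq hϖ hϖ').1
  have := Int.emod_add_mul_ediv j (ramIndex K L)
  have := Int.emod_nonneg j hpos.ne'
  have := Int.emod_lt_of_pos j hpos
  refine ⟨_, ⟨_, axis_subset_axesHull hγ hγ1 ha (j / ramIndex K L), rfl⟩,
    _, ⟨_, axis_subset_axesHull hγ hγ1 ha (j / ramIndex K L + 1), rfl⟩, ?_⟩
  rw [← hba, ← hba, hb, hb, hb, mul_add, mul_one]
  omega

/-- The distance from the tree of `Γ` is multiplied by the ramification index. -/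
lemma AtDist.ext (hϖ : IsUnif ϖ) (hϖ' : IsUnif ϖ') (hΓ : IsSchottky Γ) {v : Vertex K} {n : ℕ}
    (h : AtDist Γ v n) : AtDist (extGroup L Γ) (extVertex L v) (ramIndex K L * n) := by
  have T := treeMetric_vdist hϖ'
  obtain ⟨p, hp, rfl⟩ := h
  have hmem := extVertex_mem_axesHull (L := L) hϖ hϖ' hΓ hp.1
  obtain ⟨q, hq⟩ := T.exists_proj (convex_axesHull hϖ') ⟨_, hmem⟩ (extVertex L v)
  have key : ∀ w ∈ axesHull (extGroup L Γ), ramIndex K L * vdist v p ≤ vdist (extVertex L v) w := by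
    intro w hw
    obtain ⟨_, ⟨u, hu, rfl⟩, _, ⟨u', hu', rfl⟩, h⟩ := axesHull_ext_subset hϖ hϖ' hΓ hw
    have h1 := vdist_extVertex hϖ hϖ' v u
    have h2 := vdist_extVertex hϖ hϖ' v u'
    have h3 := vdist_extVertex hϖ hϖ' u u'
    rw [hp.2 u hu, mul_add] at h1
    rw [hp.2 u' hu', mul_add] at h2
    have h4 := Nat.mul_le_mul_left (ramIndex K L) ((treeMetric_vdist hϖ).tri u p u')
    rw [(treeMetric_vdist hϖ).symm u p, mul_add] at h4
    have := T.tri (extVertex L v) w (extVertex L u)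
    have := T.tri (extVertex L v) w (extVertex L u')
    have := T.symm (extVertex L u) w
    omega
  have h1 := key q hq.1
  have h2 := hq.2 _ hmem
  rw [vdist_extVertex hϖ hϖ'] at h2
  have h3 : q = extVertex L p := T.eq_of_zero (by omega)
  exact ⟨q, hq, by rw [h3, vdist_extVertex hϖ hϖ']⟩

/-- Over `L`, the image of a sink is a sink. -/
lemma AtDist.isSink_ext (hϖ : IsUnif ϖ) (hϖ' : IsUnif ϖ') (hΓ : IsSchottky Γ) {x₀ v : Vertex K}
    (hx₀ : x₀ ∈ axesHull Γ) {n : ℕ} (hn : 0 < n) (h : AtDist Γ v n) :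
    IsSink (extGroup L Γ) (ramIndex K L) n (extVertex L x₀) (extVertex L v) := by
  have T := treeMetric_vdist hϖ'
  have hpos := (norm_uniformizer_eq hϖ hϖ').1
  obtain ⟨p, hp, hvp⟩ := h.ext (L := L) hϖ hϖ' hΓ
  have hen : 0 < ramIndex K L * n := Nat.mul_pos hpos hn
  have hcomm := mul_comm n (ramIndex K L)
  refine ⟨(mem_redVertices hpos).2 ⟨p, hp.1, by rw [hvp, hcomm]⟩, fun w hw hvw hfar => ?_⟩
  obtain ⟨u, hu, hwu⟩ := (mem_redVertices hpos).1 hw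
  have h1 := hp.2 u hu
  have h2 := hp.2 _ (extVertex_mem_axesHull (L := L) hϖ hϖ' hΓ hx₀)
  have hvw' : vdist (extVertex L v) w = 1 := hvw
  -- a neighbour of `v` in the reduction graph is closer to the tree of `Γ`
  have h3 : vdist w p + 1 ≤ ramIndex K L * n := by
    have := T.tri (extVertex L v) w u
    have := T.parity (extVertex L v) w p
    have := T.parity (extVertex L v) w u
    have := T.tri w u p
    have := T.tri w (extVertex L v) p
    have := T.symm w (extVertex L v)
    have := T.symm p (extVertex L v)
    have := T.symm p u
    have := T.fourPt w p (extVertex L v) u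
    omega
  have h4 := T.tri (extVertex L x₀) p w
  have := T.symm (extVertex L x₀) p
  have := T.symm (extVertex L x₀) (extVertex L v)
  have := T.symm p w
  omega

end ExtHull

/-! ### Mapping tori as quotients of `X × ℝ` -/

section Torus

lemma homeomorph_mul_apply {X : Type*} [TopologicalSpace X] (S T : X ≃ₜ X) (x : X) :
    (S * T) x = S (T x) := rfl

variable {X : Type*} {F : X → X}

/-- The point `[F ^ k x, s - k ℓ]` of the mapping torus, where `k = ⌊s / ℓ⌋`: the quotient map
`X × ℝ → MappingTorus F ℓ`. Powers are taken of a homeomorphism `S` that agrees with `F`. -/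
def torusPoint [TopologicalSpace X] (F : X → X) (S : X ≃ₜ X) {ℓ : ℝ} (hℓ : 0 < ℓ) (p : X × ℝ) :
    MappingTorus F ℓ :=
  MappingTorus.mk F ((S ^ ⌊p.2 / ℓ⌋) p.1) ⟨ℓ * Int.fract (p.2 / ℓ),
    mul_nonneg hℓ.le (Int.fract_nonneg _), mul_le_of_le_one_right hℓ.le (Int.fract_lt_one _).le⟩

lemma MappingTorus.mk_eq_mk_zero {ℓ : ℝ} (hℓ : 0 ≤ ℓ) (x : X) :
    MappingTorus.mk F x ⟨ℓ, hℓ, le_rfl⟩ = MappingTorus.mk F (F x) ⟨0, le_rfl, hℓ⟩ :=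
  Quot.sound ⟨rfl, rfl, rfl⟩

variable [TopologicalSpace X] {S : X ≃ₜ X} (hF : ∀ x, F x = S x) {ℓ : ℝ} (hℓ : 0 < ℓ)

lemma torusPoint_add (x : X) (s : ℝ) (k : ℤ) :
    torusPoint F S hℓ (x, s + k * ℓ) = torusPoint F S hℓ ((S ^ k) x, s) := by
  have h : (s + k * ℓ) / ℓ = s / ℓ + k := by field_simp
  simp only [torusPoint, h, Int.floor_add_intCast, Int.fract_add_intCast, zpow_add,
    homeomorph_mul_apply]

include hF in
lemma torusPoint_of_mem (x : X) (t : Set.Icc (0 : ℝ) ℓ) :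
    torusPoint F S hℓ (x, t) = MappingTorus.mk F x t := by
  rcases eq_or_lt_of_le t.2.2 with h | h
  · have h1 : (t : ℝ) / ℓ = 1 := by rw [h, div_self hℓ.ne']
    have h2 : t = ⟨ℓ, hℓ.le, le_rfl⟩ := Subtype.ext h
    rw [h2, MappingTorus.mk_eq_mk_zero hℓ.le, hF]
    simp [torusPoint, div_self hℓ.ne']
  · have h1 : ⌊(t : ℝ) / ℓ⌋ = 0 := by
      rw [Int.floor_eq_zero_iff]
      exact ⟨div_nonneg t.2.1 hℓ.le, (div_lt_one hℓ).2 h⟩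
    have h2 : ℓ * Int.fract ((t : ℝ) / ℓ) = t := by
      rw [Int.fract, h1, Int.cast_zero, sub_zero, mul_div_cancel₀ _ hℓ.ne']
    simp only [torusPoint, h1, h2, zpow_zero]
    rfl

include hF in
lemma torusPoint_surjective : Function.Surjective (torusPoint F S hℓ) := by
  intro z
  induction z using Quot.inductionOn with
  | _ a => exact ⟨(a.1, a.2), torusPoint_of_mem hF hℓ a.1 a.2⟩

lemma continuous_mk : Continuous fun a : X × Set.Icc (0 : ℝ) ℓ => MappingTorus.mk F a.1 a.2 :=
  continuous_quot_mk

include hF in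
lemma continuous_torusPoint : Continuous (torusPoint F S hℓ) := by
  -- on the closed strip number `k`, the map is the quotient map up to a homeomorphism
  have hlf : LocallyFinite fun k : ℤ => {p : X × ℝ | k * ℓ ≤ p.2 ∧ p.2 ≤ (k + 1) * ℓ} := by
    intro p
    refine ⟨Prod.snd ⁻¹' Set.Ioo (p.2 - ℓ) (p.2 + ℓ),
      (isOpen_Ioo.preimage continuous_snd).mem_nhds ⟨by linarith, by linarith⟩, ?_⟩
    refine (Set.finite_Icc (⌊p.2 / ℓ⌋ - 2) (⌊p.2 / ℓ⌋ + 2)).subset ?_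
    rintro k ⟨q, ⟨h1, h2⟩, h3, h4⟩
    have h5 := (Int.floor_le (p.2 / ℓ))
    have h6 := (Int.lt_floor_add_one (p.2 / ℓ))
    rw [le_div_iff₀ hℓ] at h5
    rw [div_lt_iff₀ hℓ] at h6
    constructor
    · have h7 : ((⌊p.2 / ℓ⌋ : ℝ) - 2) * ℓ < k * ℓ := by linarith
      have h8 := lt_of_mul_lt_mul_right h7 hℓ.le
      exact_mod_cast h8.le
    · have h7 : (k : ℝ) * ℓ < ((⌊p.2 / ℓ⌋ : ℝ) + 2) * ℓ := by linarith
      have h8 := lt_of_mul_lt_mul_right h7 hℓ.le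
      exact_mod_cast h8.le
  refine hlf.continuous ?_ (fun k => ?_) (fun k => ?_)
  · refine Set.eq_univ_of_forall fun p => Set.mem_iUnion.2 ⟨⌊p.2 / ℓ⌋, ?_, ?_⟩
    · rw [← le_div_iff₀ hℓ]
      exact Int.floor_le _
    · rw [← div_le_iff₀ hℓ]
      exact (Int.lt_floor_add_one _).le
  · exact (isClosed_le continuous_const continuous_snd).inter
      (isClosed_le continuous_snd continuous_const)
  · have h1 : ∀ p ∈ {p : X × ℝ | k * ℓ ≤ p.2 ∧ p.2 ≤ (k + 1) * ℓ}, torusPoint F S hℓ p =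
        MappingTorus.mk F ((S ^ k) p.1) (Set.projIcc 0 ℓ hℓ.le (p.2 - k * ℓ)) := by
      rintro ⟨x, s⟩ ⟨h2, h3⟩
      have h4 : s - k * ℓ ∈ Set.Icc (0 : ℝ) ℓ := ⟨by linarith, by simp only at h3; linarith⟩
      rw [← torusPoint_of_mem hF hℓ, Set.projIcc_of_mem hℓ.le h4, ← torusPoint_add]
      simp
    refine ContinuousOn.congr (Continuous.continuousOn ?_) h1
    refine (continuous_mk (F := F)).comp (((S ^ k).continuous.comp continuous_fst).prodMk
      ((continuous_projIcc (h := hℓ.le)).comp ?_))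
    fun_prop

include hF in
/-- The fibres of the quotient map are the orbits of `(x, s) ↦ (S x, s - ℓ)`. -/
lemma torusPoint_eq_iff {x y : X} {s r : ℝ} :
    torusPoint F S hℓ (x, s) = torusPoint F S hℓ (y, r) ↔ ∃ k : ℤ, s = r + k * ℓ ∧ y = (S ^ k) x := by
  constructor
  · intro h
    -- the fibre of the quotient map over a point, as an invariant of the point
    let Φ : MappingTorus F ℓ → Set (X × ℝ) := Quot.lift
      (fun a => {p | ∃ k : ℤ, p.2 = (a.2 : ℝ) + k * ℓ ∧ a.1 = (S ^ k) p.1}) (by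
        rintro ⟨x, s⟩ ⟨y, r⟩ ⟨h1, h2, h3⟩
        ext ⟨q, t⟩
        simp only at h1 h2 h3
        simp only [Set.mem_ofPred_eq, h1, h2, h3, zero_add, hF]
        constructor
        · rintro ⟨k, rfl, rfl⟩
          exact ⟨k + 1, by push_cast; ring, by
            rw [add_comm, zpow_add, zpow_one, homeomorph_mul_apply]⟩
        · rintro ⟨k, rfl, hk⟩
          refine ⟨k - 1, by push_cast; ring, S.injective ?_⟩
          rw [hk, ← homeomorph_mul_apply, ← zpow_one_add]
          congr 2
          ring)
    have hΦ : ∀ x s, Φ (torusPoint F S hℓ (x, s)) =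
        {p | ∃ k : ℤ, p.2 = ℓ * Int.fract (s / ℓ) + k * ℓ ∧ (S ^ ⌊s / ℓ⌋) x = (S ^ k) p.1} :=
      fun _ _ => rfl
    have hfr : ∀ s, s = ℓ * Int.fract (s / ℓ) + ⌊s / ℓ⌋ * ℓ := fun s => by
      rw [Int.fract]
      field_simp
      ring
    have hmem : (x, s) ∈ Φ (torusPoint F S hℓ (y, r)) := by
      rw [← h, hΦ]
      exact ⟨⌊s / ℓ⌋, hfr s, rfl⟩
    rw [hΦ] at hmem
    obtain ⟨k, h1, h2⟩ := hmem
    refine ⟨k - ⌊r / ℓ⌋, ?_, (S ^ ⌊r / ℓ⌋).injective ?_⟩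
    · have := hfr r
      simp only at h1
      push_cast
      linarith
    · rw [h2, ← homeomorph_mul_apply, ← zpow_add]
      congr 2
      ring
  · rintro ⟨k, rfl, rfl⟩
    exact torusPoint_add hℓ x r k

include hF in
lemma isOpenMap_torusPoint : IsOpenMap (torusPoint F S hℓ) := by
  intro W hW
  refine isOpen_coinduced.2 ?_
  have h : (Quot.mk (torusRel F ℓ)) ⁻¹' (torusPoint F S hℓ '' W) =
      ⋃ k : ℤ, (fun a : X × Set.Icc (0 : ℝ) ℓ => ((S ^ k) a.1, (a.2 : ℝ) - k * ℓ)) ⁻¹' W := by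
    ext ⟨x, t⟩
    simp only [Set.mem_preimage, Set.mem_iUnion]
    have h1 : Quot.mk (torusRel F ℓ) (x, t) = torusPoint F S hℓ (x, t) :=
      (torusPoint_of_mem hF hℓ x t).symm
    rw [h1]
    constructor
    · rintro ⟨⟨y, r⟩, hyr, h2⟩
      obtain ⟨k, h3, rfl⟩ := (torusPoint_eq_iff hF hℓ).1 h2.symm
      exact ⟨k, by rwa [h3, add_sub_cancel_right]⟩
    · rintro ⟨k, hk⟩
      exact ⟨_, hk, ((torusPoint_eq_iff hF hℓ).2 ⟨k, by ring, rfl⟩).symm⟩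
  refine (congrArg IsOpen h).mpr (isOpen_iUnion fun k => hW.preimage ?_)
  exact ((S ^ k).continuous.comp continuous_fst).prodMk (by fun_prop)

end Torus

/-! ### The covering of a mapping torus by the mapping torus of an iterate -/

section Covering

variable {Y : Type*} [TopologicalSpace Y] (T : Y ≃ₜ Y) {e : ℕ} (he : 0 < e)

lemma iterate_eq_pow (y : Y) : T^[e] y = (T ^ e) y := by
  induction e with
  | zero => rfl
  | succ e ih => rw [Function.iterate_succ_apply', ih, pow_succ', homeomorph_mul_apply]

/-- The projection `[y, s] ↦ [T ^ ⌊s⌋ y, s - ⌊s⌋]`. -/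
def torusCovering : C(MappingTorus (T^[e]) (e : ℝ), MappingTorus T 1) where
  toFun := Quot.lift (fun a => torusPoint T T one_pos (a.1, (a.2 : ℝ))) (by
    rintro ⟨x, s⟩ ⟨y, r⟩ ⟨h1, h2, h3⟩
    simp only at h1 h2 h3
    simp only [h1, h2, h3]
    rw [torusPoint_eq_iff (fun _ => rfl)]
    exact ⟨e, by simp, by rw [iterate_eq_pow, zpow_natCast]⟩)
  continuous_toFun := continuous_quot_lift _
    ((continuous_torusPoint (fun _ => rfl) one_pos).comp (by fun_prop))

lemma torusCovering_mk (y : Y) (s : Set.Icc (0 : ℝ) (e : ℝ)) :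
    torusCovering T (MappingTorus.mk _ y s) = torusPoint T T one_pos (y, (s : ℝ)) := rfl

variable {T}

lemma torusCovering_torusPoint (he' : (0 : ℝ) < e) (y : Y) (s : ℝ) :
    torusCovering T (torusPoint (T^[e]) (T ^ e) he' (y, s)) = torusPoint T T one_pos (y, s) := by
  rw [torusPoint, torusCovering_mk, torusPoint_eq_iff (fun _ => rfl)]
  refine ⟨-(e * ⌊s / e⌋), ?_, ?_⟩
  · push_cast
    rw [Int.fract]
    field_simp
    ring
  · rw [← zpow_natCast, ← zpow_mul, ← homeomorph_mul_apply, ← zpow_add, neg_add_cancel, zpow_zero]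
    rfl

lemma torusCovering_mk_fract (y : Y) (s : Set.Icc (0 : ℝ) (e : ℝ)) (t : Set.Icc (0 : ℝ) 1)
    (hst : (t : ℝ) = Int.fract (s : ℝ)) :
    torusCovering T (MappingTorus.mk _ y s) = MappingTorus.mk _ (T^[⌊(s : ℝ)⌋₊] y) t := by
  rw [torusCovering_mk, torusPoint, iterate_eq_pow]
  have h1 : (T ^ ⌊(s : ℝ) / 1⌋) y = (T ^ ⌊(s : ℝ)⌋₊) y := by
    rw [div_one, ← zpow_natCast, Int.natCast_floor_eq_floor s.2.1]
  simp only [h1]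
  congr 1
  refine Subtype.ext ?_
  show 1 * Int.fract ((s : ℝ) / 1) = t
  rw [one_mul, div_one, hst]

include he in
/-- Over an interval of length one in the second coordinate, the mapping torus of `T ^ e` consists of
`e` disjoint copies of the mapping torus of `T`. -/
lemma isCoveringMap_torusCovering : IsCoveringMap (torusCovering T (e := e)) := by
  have he' : (0 : ℝ) < e := by exact_mod_cast he
  have hFe : ∀ y, T^[e] y = (T ^ e) y := fun y => iterate_eq_pow T y
  have hF : ∀ y, T y = T y := fun _ => rfl
  have hopen1 := isOpenMap_torusPoint hF one_pos
  have hopene := isOpenMap_torusPoint hFe he'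
  have hcont := continuous_torusPoint hFe he'
  have hopen : IsOpenMap (torusCovering T (e := e)) := by
    intro W hW
    have : torusCovering T '' W =
        torusPoint T T one_pos '' (torusPoint (T^[e]) (T ^ e) he' ⁻¹' W) := by
      ext z
      constructor
      · rintro ⟨w, hw, rfl⟩
        obtain ⟨⟨y, s⟩, rfl⟩ := torusPoint_surjective hFe he' w
        exact ⟨(y, s), hw, (torusCovering_torusPoint he' y s).symm⟩
      · rintro ⟨⟨y, s⟩, hw, rfl⟩
        exact ⟨_, hw, torusCovering_torusPoint he' y s⟩
    rw [this]
    exact hopen1 _ (hW.preimage hcont)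
  intro z
  obtain ⟨⟨y₀, t⟩, rfl⟩ := torusPoint_surjective hF one_pos z
  -- the neighbourhood `V` is given by an interval of length one, the sheet `U i` by its translate
  let I : ℝ → Set (Y × ℝ) := fun r => Set.univ ×ˢ Set.Ioo (r - 1 / 2) (r + 1 / 2)
  have hI : ∀ r, IsOpen (I r) := fun r => isOpen_univ.prod isOpen_Ioo
  let V : Set (MappingTorus T 1) := torusPoint T T one_pos '' I t
  let U : Fin e → Set (MappingTorus (T^[e]) (e : ℝ)) := fun i =>
    torusPoint (T^[e]) (T ^ e) he' '' I (t + i)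
  have hVmem : torusPoint T T one_pos (y₀, t) ∈ V :=
    ⟨_, ⟨trivial, by simp, by simp⟩, rfl⟩
  have hV : IsOpen V := hopen1 _ (hI t)
  have hU : ∀ i, IsOpen (U i) := fun i => hopene _ (hI _)
  have hsurj : ∀ i, (U i).SurjOn (torusCovering T) V := by
    rintro i _ ⟨⟨y, s⟩, ⟨-, h1, h2⟩, rfl⟩
    refine ⟨_, ⟨((T ^ (-(i : ℤ))) y, s + i), ⟨trivial, ?_, ?_⟩, rfl⟩, ?_⟩
    · simp only at h1 h2 ⊢; linarith
    · simp only at h1 h2 ⊢; linarith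
    · rw [torusCovering_torusPoint, torusPoint_eq_iff hF]
      refine ⟨i, by simp, ?_⟩
      rw [← homeomorph_mul_apply, ← zpow_add,
        add_neg_cancel, zpow_zero]
      rfl
  have hinj : ∀ i, (U i).InjOn (torusCovering T) := by
    rintro i _ ⟨⟨y, s⟩, ⟨-, h1, h2⟩, rfl⟩ _ ⟨⟨y', s'⟩, ⟨-, h3, h4⟩, rfl⟩ h
    rw [torusCovering_torusPoint, torusCovering_torusPoint, torusPoint_eq_iff hF] at h
    obtain ⟨k, h5, rfl⟩ := h
    simp only at h1 h2 h3 h4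
    have h6 : (-1 : ℝ) < k := by linarith
    have h7 : (k : ℝ) < 1 := by linarith
    have h8 : k = 0 := by
      have h6' : (-1 : ℤ) < k := by exact_mod_cast h6
      have h7' : k < (1 : ℤ) := by exact_mod_cast h7
      omega
    subst h8
    rw [h5]
    simp
  have hdisj : Pairwise (Function.onFun Disjoint U) := by
    intro i j hij
    refine Set.disjoint_left.2 ?_
    rintro _ ⟨⟨y, s⟩, ⟨-, h1, h2⟩, rfl⟩ ⟨⟨y', s'⟩, ⟨-, h3, h4⟩, h⟩
    obtain ⟨k, h5, -⟩ := (torusPoint_eq_iff hFe he').1 h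
    simp only at h1 h2 h3 h4
    have h6 : (-1 : ℝ) < k * e + i - j := by linarith
    have h7 : (k * e + i - j : ℝ) < 1 := by linarith
    have h6' : (-1 : ℤ) < k * e + i - j := by exact_mod_cast h6
    have h7' : (k * e + i - j : ℤ) < 1 := by exact_mod_cast h7
    have h8 : ((i : ℕ) : ℤ) - (j : ℕ) = (-k) * e := by
      linarith [show k * e + ((i : ℕ) : ℤ) - (j : ℕ) = 0 by omega]
    have hi := i.2
    have hj := j.2
    have h9 : -k = 0 := by
      by_contra h9
      have h10 : (e : ℤ) ≤ |(-k) * e| := by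
        rw [abs_mul, Nat.abs_cast]
        exact le_mul_of_one_le_left (by positivity) (Int.one_le_abs h9)
      rw [← h8] at h10
      have : |((i : ℕ) : ℤ) - (j : ℕ)| < e := by
        rw [abs_lt]
        omega
      omega
    rw [h9, zero_mul] at h8
    exact hij (Fin.ext (by omega))
  have hexh : torusCovering T ⁻¹' V ⊆ ⋃ i, U i := by
    intro w hw
    obtain ⟨⟨y, s⟩, rfl⟩ := torusPoint_surjective hFe he' w
    obtain ⟨⟨y', r⟩, ⟨-, h1, h2⟩, h⟩ := hw
    rw [torusCovering_torusPoint, torusPoint_eq_iff hF] at h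
    obtain ⟨k, h3, -⟩ := h
    -- the number of the sheet is the residue of the integral part modulo `e`
    have heZ : (0 : ℤ) < e := by exact_mod_cast he
    have h4 := Int.emod_nonneg (-k) heZ.ne'
    have h5 := Int.emod_lt_of_pos (-k) heZ
    have h6 := Int.emod_add_mul_ediv (-k) e
    refine Set.mem_iUnion.2 ⟨⟨((-k) % e).toNat, by omega⟩,
      ⟨((T ^ e) ^ ((-k) / e) : Y ≃ₜ Y) y, s - ((-k) / e : ℤ) * e⟩, ⟨trivial, ?_⟩, ?_⟩
    · have h7 : ((((-k) % e).toNat : ℕ) : ℝ) = -k - e * ((-k) / e : ℤ) := by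
        have h8 : ((((-k) % e).toNat : ℕ) : ℤ) = -k - e * ((-k) / e) := by
          rw [Int.toNat_of_nonneg h4]
          linarith
        exact_mod_cast h8
      simp only at h1 h2 ⊢
      rw [h7]
      constructor <;> linarith
    · refine ((torusPoint_eq_iff hFe he').2 ⟨(-k) / e, by ring, rfl⟩).symm
  have : Nonempty (MappingTorus T 1 → MappingTorus (T^[e]) (e : ℝ)) :=
    ⟨fun _ => torusPoint _ (T ^ e) he' (y₀, t)⟩
  have : Nonempty (Fin e) := ⟨⟨0, he⟩⟩
  let triv := IsOpen.trivializationDiscrete (f := torusCovering T (e := e)) U V hV (fun i W hW =>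
    ⟨fun h => (h.preimage (torusCovering T).continuous).inter (hU i), fun h => by
      have : W = torusCovering T '' (torusCovering T ⁻¹' W ∩ U i) := by
        ext w
        constructor
        · intro hw
          obtain ⟨v, hv, rfl⟩ := hsurj i (hW hw)
          exact ⟨v, ⟨hw, hv⟩, rfl⟩
        · rintro ⟨v, hv, rfl⟩
          exact hv.1
      rw [this]
      exact hopen _ h⟩) hinj hsurj hdisj hexh
  exact (IsEvenlyCovered.of_trivialization (t := triv) hVmem).to_isEvenlyCovered_preimage

end Covering

/-! ### Maps to the circle -/

section CircleMaps

/-- Maps to the circle whose quotient lifts to the real line are homotopic. -/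
lemma homotopic_of_eq_mul_exp {Z : Type*} [TopologicalSpace Z] {u v : C(Z, Circle)} (D : C(Z, ℝ))
    (h : ∀ z, u z = v z * Circle.exp (2 * Real.pi * D z)) : u.Homotopic v := by
  refine ContinuousMap.Homotopic.symm ⟨⟨⟨fun p => v p.2 * Circle.exp (2 * Real.pi * (p.1 * D p.2)),
    by fun_prop⟩, fun z => ?_, fun z => ?_⟩⟩
  · simp
  · simp [h]

variable {X : Type*} [TopologicalSpace X]

/-- Cohomologous functions have the same class: the angle `t (h (S x) - h x)` differs from
`(1 - t) h x + t h (S x)`, which is well defined on the mapping torus, by an integer. -/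
lemma expClass_eq_of_cohomologous (S : X ≃ₜ X) {f g h : C(X, ℤ)}
    (H : ∀ x, f x = g x + (h (S x) - h x)) : expClass S f = expClass S g := by
  refine (H1.mk_eq_mk _ _).2 (homotopic_of_eq_mul_exp ⟨Quot.lift
    (fun a => (1 - (a.2 : ℝ)) * (h a.1 : ℝ) + a.2 * (h (S a.1) : ℝ)) ?_, ?_⟩ ?_)
  · rintro ⟨x, s⟩ ⟨y, r⟩ ⟨h1, h2, h3⟩
    simp only at h1 h2 h3
    simp [h1, h2, h3]
  · exact continuous_quot_lift _ (by fun_prop)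
  · intro z
    induction z using Quot.inductionOn with
    | _ a =>
      obtain ⟨x, t⟩ := a
      show Circle.exp (2 * Real.pi * ((t : ℝ) * (f x : ℝ))) =
        Circle.exp (2 * Real.pi * ((t : ℝ) * (g x : ℝ))) *
        Circle.exp (2 * Real.pi * ((1 - (t : ℝ)) * (h x : ℝ) + t * (h (S x) : ℝ)))
      rw [← Circle.exp_add, H, show 2 * Real.pi * ((t : ℝ) * (g x : ℝ)) +
        2 * Real.pi * ((1 - (t : ℝ)) * (h x : ℝ) + t * (h (S x) : ℝ)) =
        2 * Real.pi * ((t : ℝ) * ((g x + (h (S x) - h x) : ℤ) : ℝ)) + h x * (2 * Real.pi) by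
          push_cast; ring, Circle.exp_add, Circle.exp_int_mul_two_pi, mul_one]

variable {Y : Type*} [TopologicalSpace Y] {S : X ≃ₜ X} {T : Y ≃ₜ Y} {e : ℕ} (J : C(X, Y))
  (hJ : ∀ x, J (S x) = T^[e] (J x))

/-- The map `[x, t] ↦ [J x, e t]`. -/
def torusMap (hJ : ∀ x, J (S x) = T^[e] (J x)) :
    C(MappingTorus S 1, MappingTorus (T^[e]) (e : ℝ)) where
  toFun := Quot.lift (fun a => MappingTorus.mk _ (J a.1) ⟨e * (a.2 : ℝ),
      mul_nonneg (Nat.cast_nonneg e) a.2.2.1, mul_le_of_le_one_right (Nat.cast_nonneg e) a.2.2.2⟩) (by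
    rintro ⟨x, s⟩ ⟨y, r⟩ ⟨h1, h2, h3⟩
    simp only at h1 h2 h3
    exact Quot.sound ⟨by simp [h1], by simp [h2], by simp [h3, hJ]⟩)
  continuous_toFun := continuous_quot_lift _ ((continuous_mk (F := T^[e])).comp
    ((J.continuous.comp continuous_fst).prodMk (Continuous.subtype_mk (by fun_prop) _)))

lemma torusMap_mk (x : X) (t : Set.Icc (0 : ℝ) 1) (s : Set.Icc (0 : ℝ) (e : ℝ))
    (hst : (s : ℝ) = e * (t : ℝ)) :
    torusMap J hJ (MappingTorus.mk _ x t) = MappingTorus.mk _ (J x) s :=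
  congrArg (MappingTorus.mk (T^[e]) (J x)) (Subtype.ext hst.symm)

/-- The sum of a function over `e` consecutive points of the orbit of `J x`. -/
def birkhoffSumComp (T : Y ≃ₜ Y) (e : ℕ) (J : C(X, Y)) (f : C(Y, ℤ)) : C(X, ℤ) where
  toFun x := ∑ i ∈ Finset.range e, f (T^[i] (J x))
  continuous_toFun := continuous_finsetSum _ fun i _ =>
    f.continuous.comp ((T.continuous.iterate i).comp J.continuous)

/-- The weights `max 0 (min 1 (s - i))` cut the interval `[0, s]` into unit steps. -/
lemma sum_clamp_mul {s : ℝ} (h0 : 0 ≤ s) (h1 : s ≤ e) (F : ℕ → ℝ) :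
    ∑ i ∈ Finset.range e, max 0 (min 1 (s - i)) * F i =
      ∑ i ∈ Finset.range ⌊s⌋₊, F i + Int.fract s * F ⌊s⌋₊ := by
  have h2 : (⌊s⌋₊ : ℝ) ≤ s := Nat.floor_le h0
  have h3 : ⌊s⌋₊ ≤ e := Nat.floor_le_of_le h1
  have h4 : s < ⌊s⌋₊ + 1 := Nat.lt_floor_add_one s
  have h5 : Int.fract s = s - ⌊s⌋₊ := by
    rw [Int.fract, ← Int.natCast_floor_eq_floor h0, Int.cast_natCast]
  have hzero : ∀ i : ℕ, s ≤ i → max 0 (min 1 (s - i)) * F i = 0 := fun i hi => by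
    rw [max_eq_left ((min_le_right _ _).trans (by linarith)), zero_mul]
  have h6 : ∑ i ∈ Finset.range e, max 0 (min 1 (s - i)) * F i =
      ∑ i ∈ Finset.range (e + 1), max 0 (min 1 (s - i)) * F i := by
    rw [Finset.sum_range_succ, hzero e h1, add_zero]
  rw [h6, ← Finset.sum_subset (Finset.range_subset_range.2 (Nat.succ_le_succ h3)),
    Finset.sum_range_succ]
  · congr 1
    · refine Finset.sum_congr rfl fun i hi => ?_
      have h7 : (i : ℝ) + 1 ≤ ⌊s⌋₊ := by exact_mod_cast Finset.mem_range.1 hi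
      rw [min_eq_left (by linarith), max_eq_right zero_le_one, one_mul]
    · rw [min_eq_right (by linarith), max_eq_right (by linarith), h5]
  · intro i _ hi
    refine hzero i (h4.le.trans ?_)
    have h8 := Finset.mem_range.not.1 hi
    exact_mod_cast not_lt.1 h8

/-- The pullback of the class of `f` is the class of the sum of `f` over `e` consecutive points:
the argument of the pulled back map grows by this sum when `t` runs through `[0, 1]`. -/
lemma pullback_expClass (f : C(Y, ℤ)) :
    H1.pullback ((torusCovering T).comp (torusMap J hJ)) (expClass T f) =
      expClass S (birkhoffSumComp T e J f) := by
  -- the lift of the angle: `clamp (e t - i)` is the part of the `i`-th step done at time `t`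
  let c : ℝ → ℝ := fun r => max 0 (min 1 r)
  have hc : Continuous c := by fun_prop
  let θ : X × Set.Icc (0 : ℝ) 1 → ℝ := fun a =>
    ∑ i ∈ Finset.range e, c (e * (a.2 : ℝ) - i) * (f (T^[i] (J a.1)) : ℝ)
  have hθ : Continuous θ := by
    refine continuous_finsetSum _ fun i _ => (hc.comp (by fun_prop)).mul ?_
    exact continuous_of_discreteTopology.comp (f.continuous.comp
      ((T.continuous.iterate i).comp (J.continuous.comp continuous_fst)))
  have hθ0 : ∀ a : X × Set.Icc (0 : ℝ) 1, (a.2 : ℝ) = 0 → θ a = 0 := by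
    intro a ha
    refine Finset.sum_eq_zero fun i _ => ?_
    have : c (e * (a.2 : ℝ) - i) = 0 := by
      simp only [c, ha, mul_zero, zero_sub]
      exact max_eq_left ((min_le_right _ _).trans (by simp))
    rw [this, zero_mul]
  have hθ1 : ∀ a : X × Set.Icc (0 : ℝ) 1, (a.2 : ℝ) = 1 →
      θ a = (birkhoffSumComp T e J f a.1 : ℝ) := by
    intro a ha
    show _ = ((∑ i ∈ Finset.range e, f (T^[i] (J a.1)) : ℤ) : ℝ)
    push_cast
    refine Finset.sum_congr rfl fun i hi => ?_
    have h1 : ((i : ℝ) + 1) ≤ e := by exact_mod_cast Finset.mem_range.1 hi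
    have : c (e * (a.2 : ℝ) - i) = 1 := by
      simp only [c, ha, mul_one]
      rw [min_eq_left (by linarith), max_eq_right zero_le_one]
    rw [this, one_mul]
  have hexp : ∀ (x : X) (t : Set.Icc (0 : ℝ) 1),
      expMap T f ((torusCovering T).comp (torusMap J hJ) (MappingTorus.mk _ x t)) =
        Circle.exp (2 * Real.pi * θ (x, t)) := by
    intro x t
    have h1 : θ (x, t) = _ := sum_clamp_mul (mul_nonneg (Nat.cast_nonneg e) t.2.1)
      (mul_le_of_le_one_right (Nat.cast_nonneg e) t.2.2) fun i => (f (T^[i] (J x)) : ℝ)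
    have h2 : (torusCovering T).comp (torusMap J hJ) (MappingTorus.mk _ x t) =
        MappingTorus.mk _ (T^[⌊(e * t : ℝ)⌋₊] (J x))
          ⟨Int.fract (e * t : ℝ), Int.fract_nonneg _, (Int.fract_lt_one _).le⟩ :=
      torusCovering_mk_fract (J x) ⟨e * (t : ℝ), mul_nonneg (Nat.cast_nonneg e) t.2.1,
        mul_le_of_le_one_right (Nat.cast_nonneg e) t.2.2⟩ _ rfl
    rw [h1, h2, ← Int.cast_sum, mul_add, Circle.exp_add, mul_comm (2 * Real.pi) (Int.cast _),
      Circle.exp_int_mul_two_pi, one_mul]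
    rfl
  refine (H1.mk_eq_mk _ _).2 (homotopic_of_eq_mul_exp ⟨Quot.lift
    (fun a => θ a - (a.2 : ℝ) * (birkhoffSumComp T e J f a.1 : ℝ)) ?_, ?_⟩ ?_)
  · rintro ⟨x, s⟩ ⟨y, r⟩ ⟨h1, h2, h3⟩
    rw [hθ0 _ h2, hθ1 _ h1, h1, h2]
    simp
  · exact continuous_quot_lift _ (by fun_prop)
  · intro z
    induction z using Quot.inductionOn with
    | _ a =>
      obtain ⟨x, t⟩ := a
      refine (hexp x t).trans ?_
      show _ = Circle.exp (2 * Real.pi * ((t : ℝ) * (birkhoffSumComp T e J f x : ℝ))) *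
        Circle.exp (2 * Real.pi * (θ (x, t) - (t : ℝ) * (birkhoffSumComp T e J f x : ℝ)))
      rw [← Circle.exp_add]
      congr 1
      ring

end CircleMaps

/-! ### Edges of the quotient of the reduction graph -/

section Edges

open TreeMetric

variable {K : Type*} [NormedField K] [IsUltrametricDist K] {ϖ : K} {Γ : Subgroup (PGL K)}

lemma pairOrbit_eq_iff {a b a' b' : Vertex K} :
    pairOrbit Γ a b = pairOrbit Γ a' b' ↔ ∃ γ ∈ Γ, γ • a' = a ∧ γ • b' = b := by
  refine Quotient.eq.trans ⟨?_, ?_⟩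
  · rintro ⟨⟨γ, hγ⟩, h⟩
    exact ⟨γ, hγ, congrArg Prod.fst h, congrArg Prod.snd h⟩
  · rintro ⟨γ, hγ, rfl, rfl⟩
    exact ⟨⟨γ, hγ⟩, rfl⟩

lemma vertexOrbit_eq_iff {a a' : Vertex K} :
    vertexOrbit Γ a = vertexOrbit Γ a' ↔ ∃ γ ∈ Γ, γ • a' = a := by
  refine Quotient.eq.trans ⟨?_, ?_⟩
  · rintro ⟨⟨γ, hγ⟩, h⟩
    exact ⟨γ, hγ, h⟩
  · rintro ⟨γ, hγ, rfl⟩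
    exact ⟨⟨γ, hγ⟩, rfl⟩

lemma pairOrbit_smul {γ : PGL K} (hγ : γ ∈ Γ) (a b : Vertex K) :
    pairOrbit Γ (γ • a) (γ • b) = pairOrbit Γ a b :=
  pairOrbit_eq_iff.2 ⟨γ, hγ, rfl, rfl⟩

lemma smul_mem_redVertices (hϖ : IsUnif ϖ) {γ : PGL K} (hγ : γ ∈ Γ) {e n : ℕ} {v : Vertex K}
    (hv : v ∈ redVertices Γ e n) : γ • v ∈ redVertices Γ e n := by
  obtain ⟨u, hu, h⟩ := hv
  exact ⟨γ • u, smul_mem_axesHull hϖ hγ hu, by rwa [vdist_smul hϖ]⟩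

variable {n : ℕ} {x₀ : Vertex K} {w w' : Edge Γ 1 n}

lemma Edge.adj (hϖ : IsUnif ϖ) {a b : Vertex K} (h : w.1 = pairOrbit Γ a b) :
    a ∈ redVertices Γ 1 n ∧ b ∈ redVertices Γ 1 n ∧ Adj a b := by
  obtain ⟨a', ha', b', hb', hab, hw⟩ := w.2
  obtain ⟨γ, hγ, rfl, rfl⟩ := pairOrbit_eq_iff.1 (h.symm.trans hw)
  exact ⟨smul_mem_redVertices hϖ hγ ha', smul_mem_redVertices hϖ hγ hb', by
    rwa [Adj, vdist_smul hϖ]⟩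

lemma Edge.EntersTail.atDist (hϖ : IsUnif ϖ) (hw : w.EntersTail x₀) {a b : Vertex K}
    (h : w.1 = pairOrbit Γ a b) : AtDist Γ b n ∧ 0 < n := by
  obtain ⟨v, hv, hwv⟩ := hw
  rw [h] at hwv
  obtain ⟨γ, hγ, rfl⟩ := vertexOrbit_eq_iff.1 hwv
  obtain ⟨h1, h2⟩ := hv.atDist hϖ
  exact ⟨h1.smul hϖ hγ, h2⟩

lemma Edge.LeavesTail.atDist (hϖ : IsUnif ϖ) (hw : w.LeavesTail x₀) {a b : Vertex K}
    (h : w.1 = pairOrbit Γ a b) : AtDist Γ a n ∧ 0 < n := by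
  obtain ⟨v, hv, hwv⟩ := hw
  rw [h] at hwv
  obtain ⟨γ, hγ, rfl⟩ := vertexOrbit_eq_iff.1 hwv
  obtain ⟨h1, h2⟩ := hv.atDist hϖ
  exact ⟨h1.smul hϖ hγ, h2⟩

lemma Edge.EntersTail.not_leavesTail (hϖ : IsUnif ϖ) (hw : w.EntersTail x₀) :
    ¬ w.LeavesTail x₀ := by
  intro hw'
  obtain ⟨a, -, b, -, hab, h⟩ := w.2
  have := (hw'.atDist hϖ h).1.eq_zero_of_adj hϖ (hw.atDist hϖ h).1 hab
  have := (hw.atDist hϖ h).2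
  omega

/-- Lifting of a path of length two without backtracking to the tree. -/
lemma exists_lift_pair (hr : w.1.range = w'.1.source) (hne : w'.1 ≠ w.1.rev) :
    ∃ a b b', w.1 = pairOrbit Γ a b ∧ w'.1 = pairOrbit Γ b b' ∧ a ≠ b' := by
  obtain ⟨a, -, b, -, -, h⟩ := w.2
  obtain ⟨c, -, d, -, -, h'⟩ := w'.2
  rw [h, h'] at hr
  obtain ⟨γ, hγ, rfl⟩ := vertexOrbit_eq_iff.1 hr
  refine ⟨a, γ • c, γ • d, h, by rw [h', pairOrbit_smul hγ], ?_⟩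
  rintro rfl
  exact hne (by rw [h, h']; exact (pairOrbit_smul hγ c d).symm)

/-- An edge next to a sink is no loop. -/
lemma Edge.range_ne_source (hϖ : IsUnif ϖ) (hw : w.EntersTail x₀ ∨ w.LeavesTail x₀) :
    w.1.range ≠ w.1.source := by
  intro hr
  obtain ⟨a, -, b, -, hab, h⟩ := w.2
  rw [h] at hr
  change vertexOrbit Γ b = vertexOrbit Γ a at hr
  obtain ⟨γ, hγ, rfl⟩ := vertexOrbit_eq_iff.1 hr
  have key : AtDist Γ a n ∧ AtDist Γ (γ • a) n ∧ 0 < n := by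
    rcases hw with hw | hw
    · obtain ⟨h1, h2⟩ := hw.atDist hϖ h
      refine ⟨?_, h1, h2⟩
      have := h1.smul hϖ (Γ.inv_mem hγ)
      rwa [inv_smul_smul] at this
    · obtain ⟨h1, h2⟩ := hw.atDist hϖ h
      exact ⟨h1, h1.smul hϖ hγ, h2⟩
  have := key.1.eq_zero_of_adj hϖ key.2.1 hab
  omega

/-- Sinks are end points of the reduction graph. -/
lemma AtDist.eq_of_adj (hϖ : IsUnif ϖ) {v a b : Vertex K} (hv : AtDist Γ v n) (hn : 0 < n)
    (ha : a ∈ redVertices Γ 1 n) (hb : b ∈ redVertices Γ 1 n) (hva : Adj v a) (hvb : Adj v b) :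
    a = b := by
  have T := treeMetric_vdist hϖ
  obtain ⟨p, hp, hvp⟩ := hv
  have key : ∀ w ∈ redVertices Γ 1 n, vdist v w = 1 → vdist w p + 1 = n := by
    intro w hw hvw
    obtain ⟨u, hu, hwu⟩ := (mem_redVertices one_pos).1 hw
    have h1 := hp.2 u hu
    have := T.tri v w u
    have := T.tri v w p
    have := T.parity v w p
    have := T.parity v w u
    have := T.tri w u p
    have := T.tri w v p
    have := T.symm w v
    have := T.symm p v
    have := T.symm p u
    have := T.fourPt w p v u
    omega
  have h1 := key a ha hva
  have h2 := key b hb hvb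
  have h3 : vdist v a = 1 := hva
  have h4 : vdist v b = 1 := hvb
  exact T.between_unique (x := v) (y := p) (by omega) (by omega) (by omega)

lemma Edge.EntersTail.eq_of_admissible (hϖ : IsUnif ϖ) (hw : w.EntersTail x₀)
    (h : Admissible x₀ w w') : w' = w := by
  rcases h with ⟨h1, h2⟩ | ⟨h1, -⟩
  · obtain ⟨a, b, b', h3, h4, h5⟩ := exists_lift_pair h1 h2
    obtain ⟨h6, h7⟩ := hw.atDist hϖ h3
    obtain ⟨ha, -, hab⟩ := Edge.adj hϖ h3
    obtain ⟨-, hb', hbb'⟩ := Edge.adj hϖ h4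
    refine absurd (h6.eq_of_adj hϖ h7 ha hb' ?_ hbb') h5
    rwa [Adj, (treeMetric_vdist hϖ).symm]
  · exact h1.symm

lemma Edge.LeavesTail.eq_of_admissible (hϖ : IsUnif ϖ) (hw : w'.LeavesTail x₀)
    (h : Admissible x₀ w w') : w = w' := by
  rcases h with ⟨h1, h2⟩ | ⟨h1, -⟩
  · obtain ⟨a, b, b', h3, h4, h5⟩ := exists_lift_pair h1 h2
    obtain ⟨h6, h7⟩ := hw.atDist hϖ h4
    obtain ⟨ha, -, hab⟩ := Edge.adj hϖ h3
    obtain ⟨-, hb', hbb'⟩ := Edge.adj hϖ h4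
    refine absurd (h6.eq_of_adj hϖ h7 ha hb' ?_ hbb') h5
    rwa [Adj, (treeMetric_vdist hϖ).symm]
  · exact h1

end Edges

/-! ### Subdivision of edges -/

section Segments

open TreeMetric

variable {K L : Type*} [NormedField K] [IsUltrametricDist K] [NormedField L]
  [IsUltrametricDist L] [NormedAlgebra K L] {ϖ : K} {ϖ' : L} {Γ : Subgroup (PGL K)} {n : ℕ}

variable (L) in
/-- `s w i` is the `i`-th of the `e_{L/K}` edges into which the edge `w` is subdivided over `L`.
Only the indices below `e_{L/K}` are meaningful. -/
def IsSegmentMap (s : Edge Γ 1 n → ℕ → Edge (extGroup L Γ) (ramIndex K L) n) : Prop :=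
  ∀ (w : Edge Γ 1 n) (a b : Vertex K) (c : ℕ → Vertex L), w.1 = pairOrbit Γ a b →
    c 0 = extVertex L a → c (ramIndex K L) = extVertex L b →
    (∀ i < ramIndex K L, Adj (c i) (c (i + 1))) →
    ∀ i < ramIndex K L, (s w i).1 = pairOrbit (extGroup L Γ) (c i) (c (i + 1))

lemma exists_extPath (hϖ : IsUnif ϖ) (hϖ' : IsUnif ϖ') {a b : Vertex K} (hab : Adj a b) :
    ∃ c : ℕ → Vertex L, c 0 = extVertex L a ∧ c (ramIndex K L) = extVertex L b ∧
      ∀ i < ramIndex K L, Adj (c i) (c (i + 1)) := by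
  have h := (treeMetric_vdist hϖ').exists_path (extVertex L a) (extVertex L b)
  rwa [vdist_extVertex hϖ hϖ', show vdist a b = 1 from hab, mul_one] at h

lemma extPath_dist (hϖ : IsUnif ϖ) (hϖ' : IsUnif ϖ') {a b : Vertex K} (hab : Adj a b)
    {c : ℕ → Vertex L} (h0 : c 0 = extVertex L a) (h1 : c (ramIndex K L) = extVertex L b)
    (hc : ∀ i < ramIndex K L, Adj (c i) (c (i + 1))) {i j : ℕ} (hij : i ≤ j)
    (hj : j ≤ ramIndex K L) : vdist (c i) (c j) = j - i := by
  refine (treeMetric_vdist hϖ').walk_dist hc ?_ hij hj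
  rw [h0, h1, vdist_extVertex hϖ hϖ', show vdist a b = 1 from hab, mul_one]

/-- The path between the images of adjacent vertices of the reduction graph over `K` lies in the
reduction graph over `L`. -/
lemma extPath_mem_redVertices (hϖ : IsUnif ϖ) (hϖ' : IsUnif ϖ') (hΓ : IsSchottky Γ)
    {a b : Vertex K} (ha : a ∈ redVertices Γ 1 n) (hb : b ∈ redVertices Γ 1 n) (hab : Adj a b)
    {c : ℕ → Vertex L} (h0 : c 0 = extVertex L a) (h1 : c (ramIndex K L) = extVertex L b)
    (hc : ∀ i < ramIndex K L, Adj (c i) (c (i + 1))) {i : ℕ} (hi : i ≤ ramIndex K L) :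
    c i ∈ redVertices (extGroup L Γ) (ramIndex K L) n := by
  have T := treeMetric_vdist hϖ
  have T' := treeMetric_vdist hϖ'
  have h2 := extPath_dist hϖ hϖ' hab h0 h1 hc (Nat.zero_le i) hi
  have h3 := extPath_dist hϖ hϖ' hab h0 h1 hc hi le_rfl
  rw [h0] at h2
  rw [h1] at h3
  obtain ⟨u, hu, hau⟩ := (mem_redVertices one_pos).1 ha
  obtain ⟨u', hu', hbu⟩ := (mem_redVertices one_pos).1 hb
  obtain ⟨p, hp⟩ := T.exists_proj (convex_axesHull hϖ) ⟨u, hu⟩ a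
  obtain ⟨q, hq⟩ := T.exists_proj (convex_axesHull hϖ) ⟨u, hu⟩ b
  have h4 := hp.2 u hu
  have h5 := hq.2 u' hu'
  refine (mem_redVertices (norm_uniformizer_eq hϖ hϖ').1).2 ?_
  -- from the end point that is closer to the tree of `Γ`
  have near : ∀ x y : Vertex K, y ∈ axesHull Γ → vdist x y + 1 ≤ n →
      vdist (c i) (extVertex L x) ≤ ramIndex K L → ∃ u ∈ axesHull (extGroup L Γ),
        vdist (c i) u ≤ n * ramIndex K L := by
    intro x y hy hxy hx
    refine ⟨_, extVertex_mem_axesHull (L := L) hϖ hϖ' hΓ hy, ?_⟩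
    have h6 := T'.tri (c i) (extVertex L x) (extVertex L y)
    rw [vdist_extVertex hϖ hϖ'] at h6
    calc _ ≤ ramIndex K L * (vdist x y + 1) := by linarith
      _ ≤ ramIndex K L * n := Nat.mul_le_mul_left _ hxy
      _ = _ := mul_comm _ _
  rcases lt_trichotomy (vdist a p) (vdist b q) with h | h | h
  · exact near a p hp.1 (by omega) (by rw [T'.symm]; omega)
  · have h6 := T.proj_eq_zero hp hq hab h
    refine ⟨c i, convex_axesHull hϖ' _ (extVertex_mem_axesHull (L := L) hϖ hϖ' hΓ hp.1) _
      (extVertex_mem_axesHull (L := L) hϖ hϖ' hΓ hq.1) _ ?_, by rw [T'.self]; omega⟩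
    rw [← T.eq_of_zero h6, ← T.eq_of_zero (h.symm.trans h6), vdist_extVertex hϖ hϖ',
      show vdist a b = 1 from hab]
    omega
  · exact near b q hq.1 (by omega) (by omega)

lemma exists_isSegmentMap (hϖ : IsUnif ϖ) (hϖ' : IsUnif ϖ') (hΓ : IsSchottky Γ) :
    ∃ s : Edge Γ 1 n → ℕ → Edge (extGroup L Γ) (ramIndex K L) n, IsSegmentMap L s := by
  have T' := treeMetric_vdist hϖ'
  have hpos := (norm_uniformizer_eq hϖ hϖ').1
  choose a ha b hb hab hw using fun w : Edge Γ 1 n => w.2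
  choose c h0 h1 hc using fun w : Edge Γ 1 n => exists_extPath (L := L) hϖ hϖ' (hab w)
  have hmin : ∀ i, min i (ramIndex K L - 1) < ramIndex K L := fun i => by omega
  refine ⟨fun w i => ⟨pairOrbit _ (c w (min i (ramIndex K L - 1)))
    (c w (min i (ramIndex K L - 1) + 1)), _,
    extPath_mem_redVertices hϖ hϖ' hΓ (ha w) (hb w) (hab w) (h0 w) (h1 w) (hc w) (hmin i).le, _,
    extPath_mem_redVertices hϖ hϖ' hΓ (ha w) (hb w) (hab w) (h0 w) (h1 w) (hc w) (hmin i),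
    hc w _ (hmin i), rfl⟩, ?_⟩
  intro w a' b' c' hw' h0' h1' hc' i hi
  obtain ⟨γ, hγ, hγa, hγb⟩ := pairOrbit_eq_iff.1 ((hw w).symm.trans hw')
  have key : ∀ j ≤ ramIndex K L, c w j = pglMap K L γ • c' j := by
    intro j hj
    refine T'.walk_unique (c := c w) (c' := fun j => pglMap K L γ • c' j) (hc w) (fun i hi => ?_)
      ?_ ?_ ?_ hj
    · rw [vdist_smul hϖ']
      exact hc' i hi
    · rw [h0, h1, vdist_extVertex hϖ hϖ', show vdist (a w) (b w) = 1 from hab w, mul_one]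
    · rw [h0, h0', ← extVertex_smul hϖ, hγa]
    · rw [h1, h1', ← extVertex_smul hϖ, hγb]
  simp only [min_eq_left (show i ≤ ramIndex K L - 1 by omega)]
  rw [key i hi.le, key (i + 1) hi]
  exact pairOrbit_smul (Subgroup.mem_map_of_mem _ hγ) _ _

variable {s : Edge Γ 1 n → ℕ → Edge (extGroup L Γ) (ramIndex K L) n} (hs : IsSegmentMap L s)
include hs

/-- Consecutive segments of an edge. -/
lemma IsSegmentMap.admissible_succ (hϖ : IsUnif ϖ) (hϖ' : IsUnif ϖ') (hΓ : IsSchottky Γ)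
    (x : Vertex L) (w : Edge Γ 1 n) {i : ℕ} (hi : i + 1 < ramIndex K L) :
    Admissible x (s w i) (s w (i + 1)) := by
  obtain ⟨a, -, b, -, hab, hw⟩ := w.2
  obtain ⟨c, h0, h1, hc⟩ := exists_extPath (L := L) hϖ hϖ' hab
  have h2 := hs w a b c hw h0 h1 hc i (by omega)
  have h3 := hs w a b c hw h0 h1 hc (i + 1) hi
  refine Or.inl ⟨by rw [h2, h3]; rfl, fun h => ?_⟩
  rw [h2, h3] at h
  change _ = pairOrbit _ (c (i + 1)) (c i) at h
  obtain ⟨_, ⟨γ, hγ, rfl⟩, h4, h5⟩ := pairOrbit_eq_iff.1 h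
  rw [hΓ.eq_one_of_ext_smul_eq hϖ hϖ' hγ h4, map_one, one_smul] at h5
  have h6 := extPath_dist hϖ hϖ' hab h0 h1 hc (show i ≤ i + 1 + 1 by omega) (by omega)
  rw [← h5, (treeMetric_vdist hϖ').self] at h6
  omega

/-- The last segment of an edge and the first segment of the next one. -/
lemma IsSegmentMap.admissible_next (hϖ : IsUnif ϖ) (hϖ' : IsUnif ϖ') (hΓ : IsSchottky Γ)
    (x : Vertex L) {w w' : Edge Γ 1 n} (hr : w.1.range = w'.1.source) (hne : w'.1 ≠ w.1.rev) :
    Admissible x (s w (ramIndex K L - 1)) (s w' 0) := by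
  have T := treeMetric_vdist hϖ
  have T' := treeMetric_vdist hϖ'
  have hpos := (norm_uniformizer_eq hϖ hϖ').1
  obtain ⟨a, b, b', hw, hw', hab'⟩ := exists_lift_pair hr hne
  have hab := (Edge.adj hϖ hw).2.2
  have hbb' := (Edge.adj hϖ hw').2.2
  obtain ⟨c, h0, h1, hc⟩ := exists_extPath (L := L) hϖ hϖ' hab
  obtain ⟨c', h0', h1', hc'⟩ := exists_extPath (L := L) hϖ hϖ' hbb'
  have h2 := hs w a b c hw h0 h1 hc (ramIndex K L - 1) (by omega)
  have h3 := hs w' b b' c' hw' h0' h1' hc' 0 hpos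
  rw [show ramIndex K L - 1 + 1 = ramIndex K L by omega, h1] at h2
  rw [h0'] at h3
  refine Or.inl ⟨by rw [h2, h3]; rfl, fun h => ?_⟩
  rw [h2, h3] at h
  change _ = pairOrbit _ (extVertex L b) (c (ramIndex K L - 1)) at h
  obtain ⟨_, ⟨γ, hγ, rfl⟩, h4, h5⟩ := pairOrbit_eq_iff.1 h
  rw [hΓ.eq_one_of_ext_smul_eq hϖ hϖ' hγ h4, map_one, one_smul, zero_add] at h5
  have h6 := extPath_dist hϖ hϖ' hab h0 h1 hc (Nat.zero_le (ramIndex K L - 1)) (by omega)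
  have h7 := extPath_dist hϖ hϖ' hbb' h0' h1' hc' (show 1 ≤ ramIndex K L from hpos) le_rfl
  rw [h0, h5] at h6
  rw [h1'] at h7
  have h8 := T'.tri (extVertex L a) (c' 1) (extVertex L b')
  rw [vdist_extVertex hϖ hϖ'] at h8
  have h9 : 2 ≤ vdist a b' := by
    have h10 : vdist a b = 1 := hab
    have h11 : vdist b b' = 1 := hbb'
    have := T.parity a b b'
    have : vdist a b' ≠ 0 := fun h => hab' (T.eq_of_zero h)
    omega
  have := Nat.mul_le_mul_left (ramIndex K L) h9
  omega

lemma IsSegmentMap.entersTail (hϖ : IsUnif ϖ) (hϖ' : IsUnif ϖ') (hΓ : IsSchottky Γ) {x₀ : Vertex K}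
    (hx₀ : x₀ ∈ axesHull Γ) {w : Edge Γ 1 n} (hw : w.EntersTail x₀) :
    (s w (ramIndex K L - 1)).EntersTail (extVertex L x₀) := by
  have hpos := (norm_uniformizer_eq hϖ hϖ').1
  obtain ⟨a, -, b, -, hab, hwab⟩ := w.2
  obtain ⟨c, h0, h1, hc⟩ := exists_extPath (L := L) hϖ hϖ' hab
  obtain ⟨h2, h3⟩ := hw.atDist hϖ hwab
  refine ⟨_, h2.isSink_ext hϖ hϖ' hΓ hx₀ h3, ?_⟩
  rw [hs w a b c hwab h0 h1 hc _ (by omega), show ramIndex K L - 1 + 1 = ramIndex K L by omega, h1]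
  rfl

lemma IsSegmentMap.leavesTail (hϖ : IsUnif ϖ) (hϖ' : IsUnif ϖ') (hΓ : IsSchottky Γ) {x₀ : Vertex K}
    (hx₀ : x₀ ∈ axesHull Γ) {w : Edge Γ 1 n} (hw : w.LeavesTail x₀) :
    (s w 0).LeavesTail (extVertex L x₀) := by
  have hpos := (norm_uniformizer_eq hϖ hϖ').1
  obtain ⟨a, -, b, -, hab, hwab⟩ := w.2
  obtain ⟨c, h0, h1, hc⟩ := exists_extPath (L := L) hϖ hϖ' hab
  obtain ⟨h2, h3⟩ := hw.atDist hϖ hwab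
  refine ⟨_, h2.isSink_ext hϖ hϖ' hΓ hx₀ h3, ?_⟩
  rw [hs w a b c hwab h0 h1 hc _ hpos, h0]
  rfl

/-- An edge is determined by any of its segments. For suitable lifts `(a, b)`, `(a', b')` of two
edges with a common segment, the distances of the images of `a` and `b'` and of `a'` and `b` are
multiples of `e`, so that the segment has the same position in both edges; then the images of `a`
and `a'`, and of `b` and `b'`, are closer than `2 e`. -/
lemma IsSegmentMap.injective (hϖ : IsUnif ϖ) (hϖ' : IsUnif ϖ') {w w' : Edge Γ 1 n} {i i' : ℕ}
    (hi : i < ramIndex K L) (hi' : i' < ramIndex K L) (h : s w i = s w' i') : w = w' := by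
  have T := treeMetric_vdist hϖ
  have T' := treeMetric_vdist hϖ'
  obtain ⟨a, -, b, -, hab, hw⟩ := w.2
  obtain ⟨a₁, -, b₁, -, hab₁, hw₁⟩ := w'.2
  obtain ⟨c, h0, h1, hc⟩ := exists_extPath (L := L) hϖ hϖ' hab
  obtain ⟨c₁, h0₁, h1₁, hc₁⟩ := exists_extPath (L := L) hϖ hϖ' hab₁
  have h' := congrArg Subtype.val h
  rw [hs w a b c hw h0 h1 hc i hi, hs w' a₁ b₁ c₁ hw₁ h0₁ h1₁ hc₁ i' hi'] at h'
  obtain ⟨_, ⟨γ, hγ, rfl⟩, h2, h3⟩ := pairOrbit_eq_iff.1 h'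
  rw [← pairOrbit_smul hγ] at hw₁
  have hab' := (Edge.adj hϖ hw₁).2.2
  have d1 := extPath_dist hϖ hϖ' hab h0 h1 hc (Nat.zero_le i) hi.le
  have d2 := extPath_dist hϖ hϖ' hab h0 h1 hc (Nat.zero_le (i + 1)) (show i + 1 ≤ _ from hi)
  have d3 := extPath_dist hϖ hϖ' hab h0 h1 hc hi.le le_rfl
  have d4 := extPath_dist hϖ hϖ' hab h0 h1 hc (show i + 1 ≤ ramIndex K L from hi) le_rfl
  have d5 := extPath_dist hϖ hϖ' hab h0 h1 hc (show i ≤ i + 1 by omega) hi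
  have d1' := extPath_dist hϖ hϖ' hab₁ h0₁ h1₁ hc₁ (Nat.zero_le i') hi'.le
  have d2' := extPath_dist hϖ hϖ' hab₁ h0₁ h1₁ hc₁ (Nat.zero_le (i' + 1)) hi'
  have d3' := extPath_dist hϖ hϖ' hab₁ h0₁ h1₁ hc₁ hi'.le le_rfl
  have d4' := extPath_dist hϖ hϖ' hab₁ h0₁ h1₁ hc₁ (show i' + 1 ≤ ramIndex K L from hi') le_rfl
  rw [← vdist_smul hϖ' (pglMap K L γ)] at d1' d2' d3' d4'
  rw [h2, h0₁, ← extVertex_smul hϖ] at d1'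
  rw [h3, h0₁, ← extVertex_smul hϖ] at d2'
  rw [h2, h1₁, ← extVertex_smul hϖ] at d3'
  rw [h3, h1₁, ← extVertex_smul hϖ] at d4'
  rw [h0] at d1 d2
  rw [h1] at d3 d4
  have d6 : vdist a b = 1 := hab
  have d6' : vdist (γ • a₁) (γ • b₁) = 1 := hab'
  set a' := γ • a₁
  set b' := γ • b₁
  have e1 := vdist_extVertex hϖ hϖ' a b'
  have e2 := vdist_extVertex hϖ hϖ' a' b
  have e3 := vdist_extVertex hϖ hϖ' a a'
  have e4 := vdist_extVertex hϖ hϖ' b b'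
  have f1 := T'.fourPt (extVertex L a) (c (i + 1)) (c i) (extVertex L b')
  have f2 := T'.fourPt (extVertex L a') (c (i + 1)) (c i) (extVertex L b)
  have t1 := T'.tri (extVertex L a) (c (i + 1)) (extVertex L b')
  have t2 := T'.tri (extVertex L a') (c (i + 1)) (extVertex L b)
  have t3 := T'.tri (extVertex L a) (c i) (extVertex L a')
  have t4 := T'.tri (extVertex L b) (c (i + 1)) (extVertex L b')
  have s1 := T'.symm (extVertex L a') (c i)
  have s2 := T'.symm (extVertex L b) (c (i + 1))
  have s3 := T'.symm (c (i + 1)) (c i)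
  have g1 : vdist (extVertex L a) (extVertex L b') + i' = ramIndex K L + i := by omega
  have g2 : vdist (extVertex L a') (extVertex L b) + i = ramIndex K L + i' := by omega
  rw [e1] at g1
  rw [e2] at g2
  have k1 : vdist a b' = 1 := by
    have : vdist a b' < 2 := by
      by_contra hk
      have := Nat.mul_le_mul_left (ramIndex K L) (not_lt.1 hk)
      omega
    have : vdist a b' ≠ 0 := by
      intro hk
      rw [hk] at g1
      omega
    omega
  have k2 : i = i' := by
    rw [k1] at g1
    omega
  have k3 : vdist a a' < 2 := by
    by_contra hk
    have := Nat.mul_le_mul_left (ramIndex K L) (not_lt.1 hk)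
    omega
  have k4 : vdist b b' < 2 := by
    by_contra hk
    have := Nat.mul_le_mul_left (ramIndex K L) (not_lt.1 hk)
    omega
  have p1 := T.parity a a' b'
  have p2 := T.parity a b b'
  have q1 : a = a' := T.eq_of_zero (by omega)
  have q2 : b = b' := T.eq_of_zero (by omega)
  exact Subtype.ext (by rw [hw, hw₁, q1, q2])

end Segments

/-! ### Subdivision of walks -/

section Subdivision

variable {K : Type*} [NormedField K] [IsUltrametricDist K] {ϖ : K} {Γ : Subgroup (PGL K)}
  {e n : ℕ} {x₀ : Vertex K}

lemma shift_iterate_apply (η : WalkSpace Γ e n x₀) (j : ℕ) (m : ℤ) :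
    ((shift Γ e n x₀)^[j] η).1 m = η.1 (m + j) := by
  induction j generalizing m with
  | zero => simp
  | succ j ih =>
    rw [Function.iterate_succ_apply']
    show ((shift Γ e n x₀)^[j] η).1 (m + 1) = _
    rw [ih, add_assoc, add_comm 1 (j : ℤ), Nat.cast_succ]

lemma continuous_coordinate (k : ℤ) : Continuous fun ω : WalkSpace Γ e n x₀ => ω.1 k :=
  (continuous_apply k).comp continuous_subtype_val

lemma OutTail.not_inTail (hϖ : IsUnif ϖ) {ω : WalkSpace Γ 1 n x₀} {k : ℤ} (h : OutTail ω k) :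
    ¬ InTail ω k := fun h' => h.2.not_leavesTail hϖ h'.2

/-- A walk that has entered a tail stays there. -/
lemma outTail_succ (hϖ : IsUnif ϖ) {ω : WalkSpace Γ 1 n x₀} {k : ℤ}
    (h : (ω.1 k).EntersTail x₀) : ω.1 (k + 1) = ω.1 k ∧ OutTail ω (k + 1) := by
  have h1 := h.eq_of_admissible hϖ (ω.2 k)
  refine ⟨h1, ?_, ?_⟩
  · rw [add_sub_cancel_right, h1]
  · rwa [h1]

lemma inTail_pred (hϖ : IsUnif ϖ) {ω : WalkSpace Γ 1 n x₀} {k : ℤ}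
    (h : (ω.1 (k + 1)).LeavesTail x₀) : ω.1 (k + 1) = ω.1 k ∧ InTail ω k := by
  have h1 := (h.eq_of_admissible hϖ (ω.2 k)).symm
  exact ⟨h1, h1, by rwa [← h1]⟩

variable {L : Type*} [NormedField L] [IsUltrametricDist L] [NormedAlgebra K L] {ϖ' : L}

open Classical in
/-- The index of the segment of the edge `ω k` that is written at position `k e + i`. -/
def tailIndex (e : ℕ) (ω : WalkSpace Γ 1 n x₀) (k : ℤ) (i : ℕ) : ℕ :=
  if OutTail ω k then e - 1 else if InTail ω k then 0 else i

variable {s : Edge Γ 1 n → ℕ → Edge (extGroup L Γ) (ramIndex K L) n}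

/-- The letters of the subdivision of a walk. -/
def subdivLetter (s : Edge Γ 1 n → ℕ → Edge (extGroup L Γ) (ramIndex K L) n)
    (ω : WalkSpace Γ 1 n x₀) (m : ℤ) : Edge (extGroup L Γ) (ramIndex K L) n :=
  s (ω.1 (m / ramIndex K L))
    (tailIndex (ramIndex K L) ω (m / ramIndex K L) (m % ramIndex K L).toNat)

lemma tailIndex_lt {e : ℕ} (ω : WalkSpace Γ 1 n x₀) (k : ℤ) {i : ℕ} (hi : i < e) :
    tailIndex e ω k i < e := by
  unfold tailIndex
  split_ifs <;> omega

lemma ediv_emod_mul_add {e : ℕ} (k : ℤ) {i : ℕ} (hi : i < e) :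
    (k * e + i) / e = k ∧ ((k * e + i) % e).toNat = i := by
  have he : (0 : ℤ) < e := by omega
  have h1 : (i : ℤ) / e = 0 := Int.ediv_eq_zero_of_lt (by omega) (by omega)
  have h2 : (i : ℤ) % e = i := Int.emod_eq_of_lt (by omega) (by omega)
  constructor
  · rw [add_comm, Int.add_mul_ediv_right _ _ he.ne', h1, zero_add]
  · rw [add_comm, Int.add_mul_emod_self_right, h2, Int.toNat_natCast]

lemma exists_eq_mul_add {e : ℕ} (he : 0 < e) (m : ℤ) : ∃ (k : ℤ) (i : ℕ), i < e ∧ m = k * e + i := by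
  have h1 := Int.emod_add_mul_ediv m e
  have h2 := Int.emod_nonneg m (show (e : ℤ) ≠ 0 by omega)
  have h3 := Int.emod_lt_of_pos m (show (0 : ℤ) < e by omega)
  exact ⟨m / e, (m % e).toNat, by omega, by rw [mul_comm]; omega⟩

lemma subdivLetter_mul_add (ω : WalkSpace Γ 1 n x₀) (k : ℤ) {i : ℕ} (hi : i < ramIndex K L) :
    subdivLetter s ω (k * ramIndex K L + i) = s (ω.1 k) (tailIndex (ramIndex K L) ω k i) := by
  obtain ⟨h1, h2⟩ := ediv_emod_mul_add k hi
  rw [subdivLetter, h1, h2]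

/-- Blocks inside a tail repeat an admissible letter. At the boundary of two blocks, the walk either
continues along an edge that is not a loop at a sink, so that neither of the adjoining letters
belongs to a tail, or it enters or leaves a tail, and the two letters agree. -/
lemma IsSegmentMap.admissible_subdivLetter (hs : IsSegmentMap L s) (hϖ : IsUnif ϖ)
    (hϖ' : IsUnif ϖ') (hΓ : IsSchottky Γ) (hx₀ : x₀ ∈ axesHull Γ) (ω : WalkSpace Γ 1 n x₀) (m : ℤ) :
    Admissible (extVertex L x₀) (subdivLetter s ω m) (subdivLetter s ω (m + 1)) := by
  have hpos := (norm_uniformizer_eq hϖ hϖ').1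
  obtain ⟨k, i, hi, rfl⟩ := exists_eq_mul_add hpos m
  rw [subdivLetter_mul_add ω k hi]
  by_cases hlast : i + 1 < ramIndex K L
  · rw [show k * (ramIndex K L : ℤ) + i + 1 = k * ramIndex K L + (i + 1 : ℕ) by push_cast; ring,
      subdivLetter_mul_add ω k hlast]
    by_cases hout : OutTail ω k
    · simp only [tailIndex, hout, if_true]
      exact Or.inr ⟨rfl, Or.inl (hs.entersTail hϖ hϖ' hΓ hx₀ hout.2)⟩
    by_cases hin : InTail ω k
    · simp only [tailIndex, hout, hin, if_true, if_false]
      exact Or.inr ⟨rfl, Or.inr (hs.leavesTail hϖ hϖ' hΓ hx₀ hin.2)⟩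
    simp only [tailIndex, hout, hin, if_false]
    exact hs.admissible_succ hϖ hϖ' hΓ _ _ hlast
  · have hi' : i = ramIndex K L - 1 := by omega
    have h0 : (k + 1) * (ramIndex K L : ℤ) + (0 : ℕ) = k * ramIndex K L + i + 1 := by
      push_cast [hi', Nat.cast_sub hpos]
      ring
    rw [← h0, subdivLetter_mul_add ω (k + 1) hpos, hi']
    rcases ω.2 k with ⟨h1, h2⟩ | ⟨h1, h2 | h2⟩
    · have hin : ¬ InTail ω k := by
        rintro ⟨h3, h4⟩
        rw [h3] at h1
        exact Edge.range_ne_source hϖ (Or.inr h4) h1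
      have hout : ¬ OutTail ω (k + 1) := by
        rintro ⟨h3, h4⟩
        rw [add_sub_cancel_right] at h3
        rw [h3] at h1
        exact Edge.range_ne_source hϖ (Or.inl h4) h1
      have e1 : tailIndex (ramIndex K L) ω k (ramIndex K L - 1) = ramIndex K L - 1 := by
        simp [tailIndex, hin]
      have e2 : tailIndex (ramIndex K L) ω (k + 1) 0 = 0 := by
        simp [tailIndex, hout]
      rw [e1, e2]
      exact hs.admissible_next hϖ hϖ' hΓ _ h1 h2
    · have hin : ¬ InTail ω k := fun h => h2.not_leavesTail hϖ h.2
      have hout := (outTail_succ hϖ h2).2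
      have e1 : tailIndex (ramIndex K L) ω k (ramIndex K L - 1) = ramIndex K L - 1 := by
        simp [tailIndex, hin]
      have e2 : tailIndex (ramIndex K L) ω (k + 1) 0 = ramIndex K L - 1 := by
        simp [tailIndex, hout]
      rw [e1, e2, ← h1]
      exact Or.inr ⟨rfl, Or.inl (hs.entersTail hϖ hϖ' hΓ hx₀ h2)⟩
    · have hin : InTail ω k := ⟨h1.symm, h2⟩
      have hout : ¬ OutTail ω k := fun h => h.not_inTail hϖ hin
      have hout' : ¬ OutTail ω (k + 1) := fun h => (h1 ▸ h.2).not_leavesTail hϖ h2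
      have e1 : tailIndex (ramIndex K L) ω k (ramIndex K L - 1) = 0 := by
        simp [tailIndex, hin, hout]
      have e2 : tailIndex (ramIndex K L) ω (k + 1) 0 = 0 := by
        simp [tailIndex, hout']
      rw [e1, e2, ← h1]
      exact Or.inr ⟨rfl, Or.inr (hs.leavesTail hϖ hϖ' hΓ hx₀ h2)⟩

/-- A letter of the subdivision depends on three letters of the walk. -/
lemma continuous_subdivLetter (m : ℤ) :
    Continuous fun ω : WalkSpace Γ 1 n x₀ => subdivLetter s ω m := by
  classical
  set k := m / (ramIndex K L : ℤ) with hk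
  let φ : Edge Γ 1 n × Edge Γ 1 n × Edge Γ 1 n → Edge (extGroup L Γ) (ramIndex K L) n := fun w =>
    s w.2.1 (if w.1 = w.2.1 ∧ w.2.1.EntersTail x₀ then ramIndex K L - 1 else
      if w.2.2 = w.2.1 ∧ w.2.1.LeavesTail x₀ then 0 else (m % ramIndex K L).toNat)
  have h : (fun ω : WalkSpace Γ 1 n x₀ => subdivLetter s ω m) =
      φ ∘ fun ω => (ω.1 (k - 1), ω.1 k, ω.1 (k + 1)) := by
    funext ω
    simp only [subdivLetter, tailIndex, OutTail, InTail, φ, Function.comp_apply, ← hk]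
  rw [h]
  exact (continuous_of_discreteTopology (f := φ)).comp ((continuous_coordinate _).prodMk
    ((continuous_coordinate _).prodMk (continuous_coordinate _)))

lemma subdivides_iff (hs : IsSegmentMap L s) (hϖ : IsUnif ϖ) (hϖ' : IsUnif ϖ')
    (ω : WalkSpace Γ 1 n x₀)
    (η : WalkSpace (extGroup L Γ) (ramIndex K L) n (extVertex L x₀)) :
    Subdivides L ω η ↔ ∀ m, η.1 m = subdivLetter s ω m := by
  have hpos := (norm_uniformizer_eq hϖ hϖ').1
  have hlast : ramIndex K L - 1 + 1 = ramIndex K L := by omega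
  constructor
  · intro h m
    obtain ⟨k, i, hi, rfl⟩ := exists_eq_mul_add hpos m
    obtain ⟨a, b, c, hw, h0, h1, hc, hη⟩ := h k
    obtain ⟨hη1, hη2, hη3⟩ := hη i hi
    rw [subdivLetter_mul_add ω k hi]
    refine Subtype.ext ?_
    rw [hs _ a b c hw h0 h1 hc _ (tailIndex_lt ω k hi)]
    by_cases hout : OutTail ω k
    · simp only [tailIndex, hout, if_true, hlast]
      exact hη1 hout
    by_cases hin : InTail ω k
    · simp only [tailIndex, hout, hin, if_true, if_false]
      exact hη2 hin
    simp only [tailIndex, hout, hin, if_false]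
    exact hη3 hout hin
  · intro h k
    obtain ⟨a, -, b, -, hab, hw⟩ := (ω.1 k).2
    obtain ⟨c, h0, h1, hc⟩ := exists_extPath (L := L) hϖ hϖ' hab
    refine ⟨a, b, c, hw, h0, h1, hc, fun i hi => ?_⟩
    rw [h, subdivLetter_mul_add ω k hi, hs _ a b c hw h0 h1 hc _ (tailIndex_lt ω k hi)]
    refine ⟨fun hout => ?_, fun hin => ?_, fun hout hin => ?_⟩
    · simp only [tailIndex, hout, if_true, hlast]
    · have hout : ¬ OutTail ω k := fun h => h.not_inTail hϖ hin
      simp only [tailIndex, hout, hin, if_true, if_false, zero_add]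
    · simp only [tailIndex, hout, hin, if_false]

lemma subdivLetter_shift (hpos : 0 < ramIndex K L) (ω : WalkSpace Γ 1 n x₀) (m : ℤ) :
    subdivLetter s (shift Γ 1 n x₀ ω) m = subdivLetter s ω (m + ramIndex K L) := by
  obtain ⟨k, i, hi, rfl⟩ := exists_eq_mul_add hpos m
  rw [show k * (ramIndex K L : ℤ) + i + ramIndex K L = (k + 1) * ramIndex K L + i by ring,
    subdivLetter_mul_add _ _ hi, subdivLetter_mul_add _ _ hi]
  have h1 : OutTail (shift Γ 1 n x₀ ω) k ↔ OutTail ω (k + 1) := by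
    show (ω.1 (k - 1 + 1) = ω.1 (k + 1) ∧ _) ↔ (ω.1 (k + 1 - 1) = ω.1 (k + 1) ∧ _)
    rw [sub_add_cancel, add_sub_cancel_right]
    rfl
  have h2 : InTail (shift Γ 1 n x₀ ω) k ↔ InTail ω (k + 1) := Iff.rfl
  refine congrArg (s (ω.1 (k + 1))) ?_
  unfold tailIndex
  by_cases hout : OutTail ω (k + 1)
  · rw [if_pos hout, if_pos (h1.2 hout)]
  by_cases hin : InTail ω (k + 1)
  · rw [if_neg hout, if_neg (h1.not.2 hout), if_pos hin, if_pos (h2.2 hin)]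
  · rw [if_neg hout, if_neg (h1.not.2 hout), if_neg hin, if_neg (h2.not.2 hin)]

/-- The map `J` that replaces the edges of a walk by their subdivisions over `L`. -/
lemma exists_subdivisionMap (hϖ : IsUnif ϖ) (hϖ' : IsUnif ϖ') (hΓ : IsSchottky Γ)
    (hx₀ : x₀ ∈ axesHull Γ) (hs : IsSegmentMap L s) :
    ∃ J : C(WalkSpace Γ 1 n x₀, WalkSpace (extGroup L Γ) (ramIndex K L) n (extVertex L x₀)),
      ∀ ω m, (J ω).1 m = subdivLetter s ω m :=
  ⟨⟨fun ω => ⟨subdivLetter s ω, hs.admissible_subdivLetter hϖ hϖ' hΓ hx₀ ω⟩,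
    continuous_induced_rng.2 (continuous_pi continuous_subdivLetter)⟩, fun _ _ => rfl⟩

/-- Since an edge is determined by any of its segments, the walk can be recovered from its
subdivision letter by letter. -/
lemma isEmbedding_of_subdivLetter (hs : IsSegmentMap L s) (hϖ : IsUnif ϖ) (hϖ' : IsUnif ϖ')
    (J : C(WalkSpace Γ 1 n x₀, WalkSpace (extGroup L Γ) (ramIndex K L) n (extVertex L x₀)))
    (hJ : ∀ ω m, (J ω).1 m = subdivLetter s ω m) : Topology.IsEmbedding J := by
  have hpos := (norm_uniformizer_eq hϖ hϖ').1
  rcases isEmpty_or_nonempty (WalkSpace Γ 1 n x₀) with hempty | ⟨⟨ω₀⟩⟩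
  · exact .of_subsingleton _
  have : Nonempty (Edge Γ 1 n) := ⟨ω₀.1 0⟩
  let φ : Edge (extGroup L Γ) (ramIndex K L) n → Edge Γ 1 n := fun z =>
    Classical.epsilon fun w => ∃ i < ramIndex K L, s w i = z
  have hφ : ∀ w, ∀ i < ramIndex K L, φ (s w i) = w := by
    intro w i hi
    obtain ⟨i', hi', h⟩ := Classical.epsilon_spec
      (p := fun w' => ∃ i' < ramIndex K L, s w' i' = s w i) ⟨w, i, hi, rfl⟩
    exact hs.injective hϖ hϖ' hi' hi h
  let Φ : WalkSpace (extGroup L Γ) (ramIndex K L) n (extVertex L x₀) → ℤ → Edge Γ 1 n :=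
    fun η k => φ (η.1 (k * ramIndex K L + (0 : ℕ)))
  have hΦ : Continuous Φ := continuous_pi fun k =>
    (continuous_of_discreteTopology (f := φ)).comp (continuous_coordinate _)
  refine Topology.IsEmbedding.of_comp J.continuous hΦ ?_
  have h : Φ ∘ J = Subtype.val := by
    funext ω k
    show φ ((J ω).1 (k * ramIndex K L + (0 : ℕ))) = ω.1 k
    rw [hJ, subdivLetter_mul_add ω k hpos, hφ _ _ (tailIndex_lt ω k hpos)]
  rw [h]
  exact Topology.IsEmbedding.subtypeVal

end Subdivision

/-! ### The pullback of the filtration -/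

section Filtration

variable {K : Type*} [NormedField K] [IsUltrametricDist K] {ϖ : K} {Γ : Subgroup (PGL K)}
  {n : ℕ} {x₀ : Vertex K}

lemma outTail_of_entersTail (hϖ : IsUnif ϖ) {ω : WalkSpace Γ 1 n x₀} (h : (ω.1 0).EntersTail x₀)
    (k : ℕ) : ω.1 k = ω.1 0 ∧ OutTail ω (k + 1) := by
  induction k with
  | zero =>
    have := (outTail_succ hϖ (k := 0) h).2
    exact ⟨rfl, by simpa using this⟩
  | succ k ih =>
    have h1 : (ω.1 k).EntersTail x₀ := ih.1 ▸ h
    have h2 := outTail_succ hϖ h1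
    rw [← ih.1, Nat.cast_succ, h2.1]
    refine ⟨rfl, (outTail_succ hϖ ?_).2⟩
    rwa [h2.1]

/-- The walk all of whose letters are the terminal edge `w`: it runs inside a tail for all time. -/
def constWalk {w : Edge Γ 1 n} (h : w.EntersTail x₀ ∨ w.LeavesTail x₀) : WalkSpace Γ 1 n x₀ :=
  ⟨fun _ => w, fun _ => Or.inr ⟨rfl, h⟩⟩

variable {L : Type*} [NormedField L] [IsUltrametricDist L] [NormedAlgebra K L]
  {s : Edge Γ 1 n → ℕ → Edge (extGroup L Γ) (ramIndex K L) n}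

lemma subdivLetter_congr {ω ω' : WalkSpace Γ 1 n x₀} {k : ℤ} {i : ℕ} (hi : i < ramIndex K L)
    (h : ω.1 k = ω'.1 k) (hout : OutTail ω k ↔ OutTail ω' k)
    (hin : i = 0 ∨ (InTail ω k ↔ InTail ω' k)) :
    subdivLetter s ω (k * ramIndex K L + i) = subdivLetter s ω' (k * ramIndex K L + i) := by
  rw [subdivLetter_mul_add ω k hi, subdivLetter_mul_add ω' k hi, h]
  congr 1
  by_cases h1 : OutTail ω k
  · simp only [tailIndex, h1, hout.1 h1, if_true]
  have h1' := hout.not.1 h1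
  rcases hin with rfl | hin
  · simp only [tailIndex, h1, h1', if_false, ite_self]
  by_cases h2 : InTail ω k
  · simp only [tailIndex, h1, h1', h2, hin.1 h2, if_true, if_false]
  · simp only [tailIndex, h1, h1', h2, hin.not.1 h2, if_false]

variable {J : C(WalkSpace Γ 1 n x₀, WalkSpace (extGroup L Γ) (ramIndex K L) n (extVertex L x₀))}
  {j : ℕ} {f : C(WalkSpace (extGroup L Γ) (ramIndex K L) n (extVertex L x₀), ℤ)}

/-- The sum of `f` over `e` consecutive points depends on the blocks `0, …, j` of letters, and
on the first letter of block `j` only, unless `j = 0`. -/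
lemma birkhoffSumComp_congr (hJ : ∀ ω m, (J ω).1 m = subdivLetter s ω m)
    (hf : f ∈ futureFun (extGroup L Γ) (ramIndex K L) n (extVertex L x₀) j)
    {ω ω' : WalkSpace Γ 1 n x₀}
    (h : ∀ k i : ℕ, i < ramIndex K L → k ≤ j → (k = j → 0 < j → i = 0) →
      subdivLetter s ω (k * ramIndex K L + i) = subdivLetter s ω' (k * ramIndex K L + i)) :
    birkhoffSumComp (shift _ _ _ _) (ramIndex K L) J f ω =
      birkhoffSumComp (shift _ _ _ _) (ramIndex K L) J f ω' := by
  show ∑ r ∈ Finset.range _, f ((shift _ _ _ _)^[r] (J ω)) =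
    ∑ r ∈ Finset.range _, f ((shift _ _ _ _)^[r] (J ω'))
  refine Finset.sum_congr rfl fun r hr => ?_
  refine hf ((shift _ _ _ _)^[r] (J ω)) ((shift _ _ _ _)^[r] (J ω')) fun l hl => ?_
  have hr' := Finset.mem_range.1 hr
  have hpos : 0 < ramIndex K L := by omega
  rw [shift_iterate_apply, shift_iterate_apply, hJ, hJ]
  have hm : ((l : ℤ) + r) = (((l + r) / ramIndex K L : ℕ) : ℤ) * ramIndex K L +
      ((l + r) % ramIndex K L : ℕ) := by
    have := Nat.mod_add_div (l + r) (ramIndex K L)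
    rw [mul_comm] at this
    norm_cast
    omega
  rw [hm]
  have h1 := Nat.mod_lt (l + r) hpos
  have h2 := Nat.mod_add_div (l + r) (ramIndex K L)
  set k := (l + r) / ramIndex K L
  set i := (l + r) % ramIndex K L
  refine h k i h1 ?_ ?_
  · by_contra hk
    have h3 : ramIndex K L * (j + 1) ≤ ramIndex K L * k := Nat.mul_le_mul_left _ (by omega)
    have h4 : 1 * j ≤ ramIndex K L * j := Nat.mul_le_mul_right j hpos
    rw [mul_add] at h3
    omega
  · intro hk hj
    obtain ⟨j', rfl⟩ : ∃ j', j = j' + 1 := ⟨j - 1, by omega⟩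
    have h4 : 1 * j' ≤ ramIndex K L * j' := Nat.mul_le_mul_right j' hpos
    rw [hk, mul_add] at h2
    omega

variable (hϖ : IsUnif ϖ) (hJ : ∀ ω m, (J ω).1 m = subdivLetter s ω m)
  (hf : f ∈ futureFun (extGroup L Γ) (ramIndex K L) n (extVertex L x₀) j)
include hϖ hJ hf

lemma birkhoffSumComp_eq_of_entersTail {ω ω' : WalkSpace Γ 1 n x₀} (h : ω.1 0 = ω'.1 0)
    (hw : (ω.1 0).EntersTail x₀) (hout : OutTail ω 0 ↔ OutTail ω' 0) :
    birkhoffSumComp (shift _ _ _ _) (ramIndex K L) J f ω =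
      birkhoffSumComp (shift _ _ _ _) (ramIndex K L) J f ω' := by
  have hw' : (ω'.1 0).EntersTail x₀ := h ▸ hw
  refine birkhoffSumComp_congr hJ hf fun k i hi _ _ => ?_
  have h1 := outTail_of_entersTail hϖ hw k
  have h1' := outTail_of_entersTail hϖ hw' k
  have h2 : ω.1 k = ω'.1 k := by rw [h1.1, h1'.1, h]
  refine subdivLetter_congr hi h2 ?_ (Or.inr (iff_of_false ?_ ?_))
  · cases k with
    | zero => exact hout
    | succ k =>
      have h3 := (outTail_of_entersTail hϖ hw k).2
      have h4 := (outTail_of_entersTail hϖ hw' k).2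
      rw [Nat.cast_succ]
      exact iff_of_true h3 h4
  · exact fun hin => (h1.1 ▸ hw : (ω.1 k).EntersTail x₀).not_leavesTail hϖ hin.2
  · exact fun hin => (h1'.1 ▸ hw' : (ω'.1 k).EntersTail x₀).not_leavesTail hϖ hin.2

lemma birkhoffSumComp_eq_of_leavesTail (hj : j = 0) {ω ω' : WalkSpace Γ 1 n x₀}
    (h : ω.1 0 = ω'.1 0) (hw : (ω.1 0).LeavesTail x₀) (hin : InTail ω 0 ↔ InTail ω' 0) :
    birkhoffSumComp (shift _ _ _ _) (ramIndex K L) J f ω =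
      birkhoffSumComp (shift _ _ _ _) (ramIndex K L) J f ω' := by
  have hw' : (ω'.1 0).LeavesTail x₀ := h ▸ hw
  refine birkhoffSumComp_congr hJ hf fun k i hi hk _ => ?_
  obtain rfl : k = 0 := by omega
  exact subdivLetter_congr hi h (iff_of_false (fun hout => hout.2.not_leavesTail hϖ hw)
    (fun hout => hout.2.not_leavesTail hϖ hw')) (Or.inr hin)

omit hϖ in
lemma birkhoffSumComp_eq_of_agree {ω ω' : WalkSpace Γ 1 n x₀}
    (h : ∀ i : ℕ, i ≤ j → ω.1 (i : ℤ) = ω'.1 (i : ℤ)) (hw : ¬ (ω.1 0).EntersTail x₀)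
    (hw' : j = 0 → ¬ (ω.1 0).LeavesTail x₀) :
    birkhoffSumComp (shift _ _ _ _) (ramIndex K L) J f ω =
      birkhoffSumComp (shift _ _ _ _) (ramIndex K L) J f ω' := by
  have h0 : ω.1 0 = ω'.1 0 := h 0 (Nat.zero_le _)
  refine birkhoffSumComp_congr hJ hf fun k i hi hk hki => ?_
  refine subdivLetter_congr hi (h k hk) ?_ ?_
  · cases k with
    | zero => exact iff_of_false (fun hout => hw hout.2) fun hout => hw (h0 ▸ hout.2)
    | succ k =>
      have h1 := h k (by omega)
      have h2 := h (k + 1) hk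
      rw [OutTail, OutTail, h2, Nat.cast_succ, add_sub_cancel_right, h1]
  · rcases hk.lt_or_eq with hkj | rfl
    · have h1 := h k hk
      have h2 := h (k + 1) hkj
      rw [Nat.cast_succ] at h2
      rw [InTail, InTail, h1, h2]
      exact Or.inr Iff.rfl
    · rcases Nat.eq_zero_or_pos k with rfl | hpos
      · exact Or.inr (iff_of_false (fun hin => hw' rfl hin.2) fun hin => hw' rfl (h0 ▸ hin.2))
      · exact Or.inl (hki rfl hpos)

/-- The pulled back function is cohomologous to a function of `ω 0, …, ω j`: a walk that enters a
tail with the letter `ω 0`, and for `j = 0` one that leaves a tail with this letter, is replaced by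
the constant walk, and the difference, a function of the terminal edge alone, is collected only
once along the walk, when the walk passes the sink. -/
lemma exists_cohomologous_futureFun : ∃ g ∈ futureFun Γ 1 n x₀ j, ∃ h : C(WalkSpace Γ 1 n x₀, ℤ),
    ∀ ω, birkhoffSumComp (shift _ _ _ _) (ramIndex K L) J f ω =
      g ω + (h (shift Γ 1 n x₀ ω) - h ω) := by
  classical
  set G := birkhoffSumComp (shift _ _ _ _) (ramIndex K L) J f with hG
  -- the value at the constant walk
  let c : Edge Γ 1 n → ℤ := fun w =>
    if hw : w.EntersTail x₀ ∨ w.LeavesTail x₀ then G (constWalk hw) else 0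
  -- the differences for walks that enter, respectively leave, a tail with the letter `w`
  let φ : Edge Γ 1 n → ℤ := fun w => if w.EntersTail x₀ then
    Classical.epsilon fun z => ∃ ω : WalkSpace Γ 1 n x₀, ω.1 0 = w ∧ ¬ OutTail ω 0 ∧ z = G ω - c w
    else 0
  let ψ : Edge Γ 1 n → ℤ := fun w => if j = 0 ∧ w.LeavesTail x₀ then
    Classical.epsilon fun z => ∃ ω : WalkSpace Γ 1 n x₀, ω.1 0 = w ∧ ¬ InTail ω 0 ∧ z = G ω - c w
    else 0
  have hφ : ∀ ω : WalkSpace Γ 1 n x₀,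
      φ (ω.1 0) - φ (ω.1 (-1)) = if (ω.1 0).EntersTail x₀ then G ω - c (ω.1 0) else 0 := by
    intro ω
    by_cases hw : (ω.1 0).EntersTail x₀
    · rw [if_pos hw]
      by_cases hout : OutTail ω 0
      · have h1 : ω.1 (-1) = ω.1 0 := hout.1
        have h2 : c (ω.1 0) = G ω := by
          simp only [c, dif_pos (Or.inl hw : _ ∨ (ω.1 0).LeavesTail x₀)]
          exact (birkhoffSumComp_eq_of_entersTail hϖ hJ hf (ω := ω)
            (ω' := constWalk (Or.inl hw)) rfl hw (iff_of_true hout ⟨rfl, hw⟩)).symm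
        rw [h1, h2, sub_self, sub_self]
      · have h1 : φ (ω.1 (-1)) = 0 := by
          refine if_neg fun h => hout ⟨?_, hw⟩
          exact (outTail_succ hϖ h).1.symm
        have h2 := Classical.epsilon_spec (p := fun z => ∃ ω' : WalkSpace Γ 1 n x₀,
          ω'.1 0 = ω.1 0 ∧ ¬ OutTail ω' 0 ∧ z = G ω' - c (ω.1 0)) ⟨_, ω, rfl, hout, rfl⟩
        obtain ⟨ω', h3, h4, h5⟩ := h2
        rw [h1, sub_zero]
        refine (if_pos hw).trans (h5.trans ?_)
        rw [birkhoffSumComp_eq_of_entersTail hϖ hJ hf h3 (h3 ▸ hw) (iff_of_false h4 hout)]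
    · rw [if_neg hw]
      have h1 : φ (ω.1 0) = 0 := if_neg hw
      have h2 : φ (ω.1 (-1)) = 0 := by
        refine if_neg fun h => hw ?_
        have h3 := (outTail_succ hϖ h).1
        rw [neg_add_cancel] at h3
        rwa [h3]
      rw [h1, h2, sub_zero]
  have hψ : ∀ ω : WalkSpace Γ 1 n x₀,
      ψ (ω.1 0) - ψ (ω.1 1) = if j = 0 ∧ (ω.1 0).LeavesTail x₀ then G ω - c (ω.1 0) else 0 := by
    intro ω
    by_cases hw : j = 0 ∧ (ω.1 0).LeavesTail x₀
    · rw [if_pos hw]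
      obtain ⟨hj, hw1⟩ := hw
      by_cases hin : InTail ω 0
      · have h1 : ω.1 1 = ω.1 0 := hin.1
        have h2 : c (ω.1 0) = G ω := by
          simp only [c, dif_pos (Or.inr hw1 : (ω.1 0).EntersTail x₀ ∨ _)]
          exact (birkhoffSumComp_eq_of_leavesTail hϖ hJ hf hj (ω := ω)
            (ω' := constWalk (Or.inr hw1)) rfl hw1 (iff_of_true hin ⟨rfl, hw1⟩)).symm
        rw [h1, h2, sub_self, sub_self]
      · have h1 : ψ (ω.1 1) = 0 := by
          refine if_neg fun h => hin ⟨?_, hw1⟩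
          exact (inTail_pred hϖ (k := 0) h.2).1
        have h2 := Classical.epsilon_spec (p := fun z => ∃ ω' : WalkSpace Γ 1 n x₀,
          ω'.1 0 = ω.1 0 ∧ ¬ InTail ω' 0 ∧ z = G ω' - c (ω.1 0)) ⟨_, ω, rfl, hin, rfl⟩
        obtain ⟨ω', h3, h4, h5⟩ := h2
        rw [h1, sub_zero]
        refine (if_pos ⟨hj, hw1⟩).trans (h5.trans ?_)
        rw [birkhoffSumComp_eq_of_leavesTail hϖ hJ hf hj h3 (h3 ▸ hw1) (iff_of_false h4 hin)]
    · rw [if_neg hw]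
      have h1 : ψ (ω.1 0) = 0 := if_neg hw
      have h2 : ψ (ω.1 1) = 0 := by
        refine if_neg fun h => hw ⟨h.1, ?_⟩
        have h3 : ω.1 1 = ω.1 0 := (inTail_pred hϖ (k := 0) h.2).1
        exact h3 ▸ h.2
      rw [h1, h2, sub_zero]
  let h : C(WalkSpace Γ 1 n x₀, ℤ) := ⟨fun ω => φ (ω.1 (-1)) - ψ (ω.1 0),
    ((continuous_of_discreteTopology (f := φ)).comp (continuous_coordinate _)).sub
      ((continuous_of_discreteTopology (f := ψ)).comp (continuous_coordinate _))⟩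
  have hh : ∀ ω, h (shift Γ 1 n x₀ ω) - h ω =
      (φ (ω.1 0) - φ (ω.1 (-1))) + (ψ (ω.1 0) - ψ (ω.1 1)) := by
    intro ω
    show (φ (ω.1 (-1 + 1)) - ψ (ω.1 (0 + 1))) - (φ (ω.1 (-1)) - ψ (ω.1 0)) = _
    rw [neg_add_cancel, zero_add]
    ring
  refine ⟨G - (h.comp ⟨shift Γ 1 n x₀, (shift Γ 1 n x₀).continuous⟩ - h), ?_, h, fun ω => ?_⟩
  · have hval : ∀ ω, (G - (h.comp ⟨shift Γ 1 n x₀, (shift Γ 1 n x₀).continuous⟩ - h)) ω =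
        if (ω.1 0).EntersTail x₀ ∨ (j = 0 ∧ (ω.1 0).LeavesTail x₀) then c (ω.1 0) else G ω := by
      intro ω
      show G ω - (h (shift Γ 1 n x₀ ω) - h ω) = _
      rw [hh, hφ, hψ]
      by_cases h1 : (ω.1 0).EntersTail x₀
      · have h2 := h1.not_leavesTail hϖ
        simp [h1, h2]
      · by_cases h2 : j = 0 ∧ (ω.1 0).LeavesTail x₀
        · rw [if_neg h1, if_pos h2, if_pos (Or.inr h2)]
          ring
        · rw [if_neg h1, if_neg h2, if_neg (not_or.2 ⟨h1, h2⟩)]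
          ring
    intro ω ω' hω
    have h0 : ω.1 0 = ω'.1 0 := hω 0 (Nat.zero_le _)
    rw [hval, hval, ← h0]
    by_cases h1 : (ω.1 0).EntersTail x₀ ∨ (j = 0 ∧ (ω.1 0).LeavesTail x₀)
    · rw [if_pos h1, if_pos h1]
    · rw [if_neg h1, if_neg h1]
      obtain ⟨h2, h3⟩ := not_or.1 h1
      exact birkhoffSumComp_eq_of_agree hJ hf hω h2 fun hj hl => h3 ⟨hj, hl⟩
  · show G ω = G ω - (h (shift Γ 1 n x₀ ω) - h ω) + (h (shift Γ 1 n x₀ ω) - h ω)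
    ring

end Filtration

/-! ### Finite extensions of the `p`-adic numbers -/

/-- Finite extensions of `ℚ_p` are locally compact, with `p` in the open unit ball. -/
lemma exists_uniformizers (p : ℕ) [Fact p.Prime] (K L : Type*)
    [NormedField K] [IsUltrametricDist K] [NormedAlgebra ℚ_[p] K] [FiniteDimensional ℚ_[p] K]
    [NormedField L] [IsUltrametricDist L] [NormedAlgebra K L] [FiniteDimensional K L] :
    (∃ ϖ : K, IsUnif ϖ) ∧ ∃ ϖ' : L, IsUnif ϖ' := by
  have hp : (p : ℚ_[p]) ≠ 0 := by
    exact_mod_cast (Fact.out : p.Prime).ne_zero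
  have hp1 : ‖algebraMap ℚ_[p] K p‖ < 1 := by
    rw [norm_algebraMap']
    exact Padic.norm_p_lt_one
  have hp0 : algebraMap ℚ_[p] K p ≠ 0 := (map_ne_zero _).2 hp
  have hK : ProperSpace K := FiniteDimensional.proper ℚ_[p] K
  let _ : NontriviallyNormedField K := NontriviallyNormedField.ofNormNeOne
    ⟨_, hp0, hp1.ne⟩
  have hL : ProperSpace L := FiniteDimensional.proper K L
  refine ⟨exists_isUnif ⟨_, hp0, hp1⟩, exists_isUnif ⟨algebraMap K L (algebraMap ℚ_[p] K p),
    (map_ne_zero _).2 hp0, ?_⟩⟩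
  rwa [norm_algebraMap']

end SchottkyWalk

end

theorem mainTheorem8 (p : ℕ) [Fact p.Prime] {K L : Type*}
    [NormedField K] [IsUltrametricDist K] [NormedAlgebra ℚ_[p] K] [FiniteDimensional ℚ_[p] K]
    [NormedField L] [IsUltrametricDist L] [NormedAlgebra K L] [FiniteDimensional K L]
    (Γ : Subgroup (PGL K)) (hΓ : IsSchottky Γ)
    (x₀ : Vertex K) (hx₀ : x₀ ∈ axesHull Γ) (n : ℕ) :
    ∃ J : C(WalkSpace Γ 1 n x₀,
        WalkSpace (extGroup L Γ) (ramIndex K L) n (extVertex L x₀)),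
      (∀ ω η, Subdivides L ω η ↔ η = J ω) ∧
      Topology.IsEmbedding J ∧
      (∀ ω, J (shift Γ 1 n x₀ ω) =
        (shift (extGroup L Γ) (ramIndex K L) n (extVertex L x₀))^[ramIndex K L] (J ω)) ∧
      ∃ (JT : C(WalkTorus Γ 1 n x₀,
            MappingTorus
              ((shift (extGroup L Γ) (ramIndex K L) n (extVertex L x₀))^[ramIndex K L])
              (ramIndex K L : ℝ)))
        (π : C(MappingTorus
              ((shift (extGroup L Γ) (ramIndex K L) n (extVertex L x₀))^[ramIndex K L])
              (ramIndex K L : ℝ),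
            WalkTorus (extGroup L Γ) (ramIndex K L) n (extVertex L x₀))),
        (∀ (ω : WalkSpace Γ 1 n x₀) (t : Set.Icc (0 : ℝ) 1)
            (s : Set.Icc (0 : ℝ) (ramIndex K L : ℝ)), (s : ℝ) = ramIndex K L * (t : ℝ) →
          JT (MappingTorus.mk _ ω t) = MappingTorus.mk _ (J ω) s) ∧
        IsCoveringMap π ∧
        (∀ (η : WalkSpace (extGroup L Γ) (ramIndex K L) n (extVertex L x₀))
            (s : Set.Icc (0 : ℝ) (ramIndex K L : ℝ)) (t : Set.Icc (0 : ℝ) 1),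
            (t : ℝ) = Int.fract (s : ℝ) →
          π (MappingTorus.mk _ η s) = MappingTorus.mk _
            ((shift (extGroup L Γ) (ramIndex K L) n (extVertex L x₀))^[⌊(s : ℝ)⌋₊] η) t) ∧
        ∀ j : ℕ,
          (filtration (extGroup L Γ) (ramIndex K L) n (extVertex L x₀) j).map
              (H1.pullback (π.comp JT)) ≤
            filtration Γ 1 n x₀ j := by
  obtain ⟨⟨ϖ, hϖ⟩, ϖ', hϖ'⟩ := exists_uniformizers p K L
  have hpos := (norm_uniformizer_eq hϖ hϖ').1
  obtain ⟨s, hs⟩ := exists_isSegmentMap (n := n) (L := L) hϖ hϖ' hΓ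
  obtain ⟨J, hJ⟩ := exists_subdivisionMap hϖ hϖ' hΓ hx₀ hs
  have hJT : ∀ ω, J (shift Γ 1 n x₀ ω) =
      (shift (extGroup L Γ) (ramIndex K L) n (extVertex L x₀))^[ramIndex K L] (J ω) := fun ω =>
    Subtype.ext (funext fun m => by
      rw [hJ, subdivLetter_shift hpos, shift_iterate_apply, hJ])
  refine ⟨J, fun ω η => ?_, isEmbedding_of_subdivLetter hs hϖ hϖ' J hJ, hJT,
    torusMap J hJT, torusCovering _, torusMap_mk J hJT, isCoveringMap_torusCovering hpos,
    torusCovering_mk_fract, ?_⟩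
  · rw [subdivides_iff hs hϖ hϖ']
    exact ⟨fun h => Subtype.ext (funext fun m => by rw [h, hJ]), fun h m => by rw [h, hJ]⟩
  · rintro j _ ⟨_, ⟨f, hf, rfl⟩, rfl⟩
    obtain ⟨g, hg, h, H⟩ := exists_cohomologous_futureFun hϖ hJ hf
    exact ⟨g, hg, ((pullback_expClass J hJT f).trans (expClass_eq_of_cohomologous _ H)).symm⟩
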